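/- **Theorem (optimal noise distribution, all-noise limit, non-parametric error).** Let $\mu$ be a $\sigma$-finite measure on a space $\mathcal X$, and let $p_\beta$, $\beta\in\Theta\subseteq\mathbb R^d$ ($d\ge 1$), be nonnegative functions with a common support, jointly measurable in $(\beta,x)$. The model is well specified: the data density is $p_d=p_{\beta^*}$, a probability density with respect to $\mu$, with $\beta^*$ an interior point of $\Theta$. The model is either normalized ($\int p_\beta\,d\mu=1$ for all $\beta\in\Theta$) or unnormalized with the log-normalization as a parameter ($\beta=(\theta,c)$, $p_\beta(x)=\tilde p(x;\theta)e^{-c}$). Near $\beta^*$ the function $\beta\mapsto\log p_\beta(x)$ is $C^2$ and $(p_d+p_\beta)\bigl(\|\nabla_\beta\log p_\beta\|^2+\|\nabla^2_\beta\log p_\beta\|\bigr)$ is bounded by a fixed integrable function of $x$. Write $g(x)=\nabla_\beta\log p_{\beta^*}(x)$, which is also the gradient $\nabla_\beta F(x;\beta^*)$ of the classifier $F(x;\beta)=\log\frac{p_\beta(x)}{\nu p_n(x)}$, and $$m=\mathbb E_{p_d}[g],\qquad I=\mathbb E_{p_d}[gg^\top],\quad\text{with } I \text{ nonsingular}.$$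 A noise density is a probability density $p_n$ with respect to $\mu$ such that $p_n>0$ almost everywhere on $\{p_d>0,\ g\ne0\}$. For $\nu>0$ put $$w=\frac{\nu p_n}{p_d+\nu p_n},\quad m_w=\mathbb E_{p_d}[w\,g],\quad I_w=\mathbb E_{p_d}[w\,gg^\top],\quad \Sigma=I_w^{-1}-\bigl(1+\tfrac1\nu\bigr)I_w^{-1}m_wm_w^\top I_w^{-1}.$$ Write $D_{\mathrm{KL}}(f,h)=\int(f\log\frac fh-f+h)\,d\mu$, $D_{\chi^2}(f,h)=\int\frac{f^2}{h}\,d\mu-1\in[0,\infty]$, $f\bullet h=fh/\int fh\,d\mu$ and $\|u\|_A=\sqrt{u^\top Au}$. Let $w_3(x)=\|\nabla_\beta F(x;\beta^*)\|_{I^{-1}}$ and $Z=\int p_d\,w_3\,d\mu$. Then: 1. (Error.) Let $p_n$ be a noise density and $\nu>0$. Let $\hat\beta$ be a consistent NCE estimator computed from $T_d$ i.i.d. data points and $T_n$ independent i.i.d. noise points, with $T=T_d+T_n$, $T_d\to\infty$, $T_n/T_d\to\nu$; that is, with probability tending to one, $\hat\beta$ minimizes over $\Theta$ the empirical logistic loss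 $-\frac1{T_d}\sum_i\log\sigma(F(x_i;\beta))-\frac{\nu}{T_n}\sum_j\log\sigma(-F(y_j;\beta))$, where $\sigma$ is the sigmoid, $x_i$ are the data points and $y_j$ the noise points. Then to leading order $$\mathbb E\bigl[D_{\mathrm{KL}}(p_d,p_{\hat\beta})\bigr]=\frac{\nu+1}{2T}\operatorname{tr}(\Sigma I),$$ in the following sense: $\lim_{M\to\infty}\lim_{T\to\infty}\mathbb E[\min(T\,D_{\mathrm{KL}}(p_d,p_{\hat\beta}),M)]=\frac{\nu+1}{2}\operatorname{tr}(\Sigma I)$; and $T\,\mathbb E[D_{\mathrm{KL}}(p_d,p_{\hat\beta})]\to\frac{\nu+1}{2}\operatorname{tr}(\Sigma I)$ whenever $T\,D_{\mathrm{KL}}(p_d,p_{\hat\beta})$ is asymptotically uniformly integrable. 2. (All-noise limit.) Let $\mathrm{Err}(T,\nu,p_n)=\frac{\nu+1}{2T}\operatorname{tr}(\Sigma I)$ and $q=m^\top I^{-1}m$. For every noise density $p_n$ and every $T>0$, as $\nu\to\infty$, $$\mathrm{Err}(T,\nu,p_n)-\frac1{2T}\Bigl(\nu(d-q)+d-2q+Z^2\Bigr)\;\longrightarrow\;\frac{Z^2}{2T}\,D_{\chi^2}(p_d\bullet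 w_3,\,p_n)\in[0,\infty],$$ with $0<Z<\infty$, so that the noise enters the limit only through $D_{\chi^2}(p_d\bullet w_3,p_n)$. 3. (Optimal noise.) $p_n^{\mathrm{opt}}=p_d\bullet w_3$ is a noise density, and it is the optimal one: $D_{\chi^2}(p_d\bullet w_3,p_n)=0$ if and only if $p_n=p_n^{\mathrm{opt}}$ almost everywhere, and for every noise density $p_n$ that is not almost everywhere equal to $p_n^{\mathrm{opt}}$, for all sufficiently large $\nu$ one has $\mathrm{Err}(T,\nu,p_n^{\mathrm{opt}})<\mathrm{Err}(T,\nu,p_n)$ for all $T>0$. -/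

import Mathlib

open MeasureTheory ProbabilityTheory Filter Topology Matrix
open scoped ENNReal NNReal

noncomputable section

namespace NCE

variable {X : Type*} [MeasurableSpace X] {ι : Type*} [Fintype ι]

/-! ### Parametric models -/

/-- The (generalized) Fisher score `∇_β log p(x; β₀)`; it is also the parameter gradient
`∇_β F(x; β₀)` of the model classifier `F(x; β) = log (p(x; β) / (ν pₙ(x)))`. -/
def score (p : EuclideanSpace ℝ ι → X → ℝ) (β₀ : EuclideanSpace ℝ ι) (x : X) :
    EuclideanSpace ℝ ι :=
  gradient (fun β => Real.log (p β x)) β₀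

/-- The covariance (second moment) `E_d[u(x) g(x) g(x)ᵀ]` of the score `g`, reweighted by `u`,
under the data density `p_d = p β₀`. -/
def scoreCov (μ : Measure X) (p : EuclideanSpace ℝ ι → X → ℝ) (β₀ : EuclideanSpace ℝ ι)
    (u : X → ℝ) : Matrix ι ι ℝ :=
  Matrix.of fun i j => ∫ x, u x * (score p β₀ x i * score p β₀ x j) * p β₀ x ∂μ

/-- The mean `E_d[u(x) g(x)]` of the score `g`, reweighted by `u`. -/
def scoreMean (μ : Measure X) (p : EuclideanSpace ℝ ι → X → ℝ) (β₀ : EuclideanSpace ℝ ι)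
    (u : X → ℝ) : ι → ℝ :=
  fun i => ∫ x, u x * score p β₀ x i * p β₀ x ∂μ

/-- The generalized Fisher information `I = E_d[g(x) g(x)ᵀ]`. -/
def fisher (μ : Measure X) (p : EuclideanSpace ℝ ι → X → ℝ) (β₀ : EuclideanSpace ℝ ι) :
    Matrix ι ι ℝ :=
  scoreCov μ p β₀ fun _ => 1

/-- A well-specified smooth parametric model with parameter set `Θ` and true parameter `β₀`
(so that the data density is `p β₀`), the densities being taken with respect to `μ`. -/
structure RegularModel [DecidableEq ι] (μ : Measure X) (p : EuclideanSpace ℝ ι → X → ℝ)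
    (Θ : Set (EuclideanSpace ℝ ι)) (β₀ : EuclideanSpace ℝ ι) : Prop where
  measurable : Measurable (Function.uncurry p)
  nonneg : ∀ β ∈ Θ, ∀ x, 0 ≤ p β x
  /-- common support -/
  support : ∀ β ∈ Θ, ∀ x, p β x = 0 ↔ p β₀ x = 0
  /-- the data density is a probability density -/
  data_prob : ∫⁻ x, ENNReal.ofReal (p β₀ x) ∂μ = 1
  /-- near `β₀`, an interior point of `Θ`, the log-density is twice continuously differentiable,
  and two derivatives may be taken under the integral sign -/
  smooth : ∃ r > 0, Metric.ball β₀ r ⊆ Θ ∧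
    (∀ x, ContDiffOn ℝ 2 (fun β => Real.log (p β x)) (Metric.ball β₀ r)) ∧
    ∃ G : X → ℝ, Integrable G μ ∧ ∀ β ∈ Metric.ball β₀ r, ∀ x,
      (p β₀ x + p β x) * (‖fderiv ℝ (fun b => Real.log (p b x)) β‖ ^ 2 +
        ‖fderiv ℝ (fderiv ℝ fun b => Real.log (p b x)) β‖) ≤ G x
  /-- the information matrix is nonsingular -/
  fisher_det : (fisher μ p β₀).det ≠ 0

/-- A normalized model: every `p β` integrates to one. -/
def IsNormalized (μ : Measure X) (p : EuclideanSpace ℝ ι → X → ℝ)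
    (Θ : Set (EuclideanSpace ℝ ι)) : Prop :=
  ∀ β ∈ Θ, ∫ x, p β x ∂μ = 1

/-- An unnormalized (energy-based) model `p(x; (θ, c)) = p̃(x; θ) exp (-c)`: the coordinate `i₀` of
the parameter is the log-normalization `c`, the other coordinates form `θ`. -/
def IsUnnormalized (p : EuclideanSpace ℝ ι → X → ℝ) (Θ : Set (EuclideanSpace ℝ ι)) : Prop :=
  ∃ (i₀ : ι) (q : ({i : ι // i ≠ i₀} → ℝ) → X → ℝ),
    ∀ β ∈ Θ, ∀ x, p β x = q (fun i => β i) x * Real.exp (-β i₀)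

/-- Admissible noise: a probability density `pn` that is positive wherever a data point carries
information on the parameter. -/
structure IsNoise (μ : Measure X) (p : EuclideanSpace ℝ ι → X → ℝ) (β₀ : EuclideanSpace ℝ ι)
    (pn : X → ℝ) : Prop where
  measurable : Measurable pn
  nonneg : ∀ x, 0 ≤ pn x
  prob : ∫⁻ x, ENNReal.ofReal (pn x) ∂μ = 1
  pos : ∀ᵐ x ∂μ, p β₀ x ≠ 0 → score p β₀ x ≠ 0 → 0 < pn x

/-! ### Divergences -/

/-- Generalized Kullback-Leibler divergence `∫ (f log (f / g) - f + g)` of nonnegative functions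
(the integrand is nonnegative). -/
def genKL (μ : Measure X) (f g : X → ℝ) : ℝ≥0∞ :=
  ∫⁻ x, ENNReal.ofReal (f x * Real.log (f x / g x) - f x + g x) ∂μ

/-- Chi-squared divergence `(∫ f² / g) - 1` of probability densities, with value in `[0, ∞]`. -/
def chiSq (μ : Measure X) (f g : X → ℝ) : ℝ≥0∞ :=
  (∫⁻ x, ENNReal.ofReal (f x) ^ 2 / ENNReal.ofReal (g x) ∂μ) - 1

/-! ### The NCE estimator -/

/-- Model classifier `F(x; β) = log (p_β(x) / (ν pₙ(x)))`. -/
def classifier (p : EuclideanSpace ℝ ι → X → ℝ) (pn : X → ℝ) (ν : ℝ)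
    (β : EuclideanSpace ℝ ι) (x : X) : ℝ :=
  Real.log (p β x / (ν * pn x))

/-- Empirical logistic (Jensen-Shannon) classification loss computed from `Td` data points and
`Tn` noise points, with noise-data ratio `ν`. -/
def logisticLoss (p : EuclideanSpace ℝ ι → X → ℝ) (pn : X → ℝ) (ν : ℝ) (Td Tn : ℕ)
    (xd xn : ℕ → X) (β : EuclideanSpace ℝ ι) : ℝ :=
  -(1 / (Td : ℝ)) * ∑ i ∈ Finset.range Td,
      Real.log (Real.sigmoid (classifier p pn ν β (xd i)))
    - ν / (Tn : ℝ) * ∑ j ∈ Finset.range Tn,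
      Real.log (Real.sigmoid (-classifier p pn ν β (xn j)))

/-- `est k` is a consistent NCE estimator computed from `Td k` i.i.d. data points and `Tn k` i.i.d.
noise points, where `Td k → ∞` and `Tn k / Td k → ν`: with probability tending to one it minimizes
the empirical classification loss over the parameter set. -/
structure IsNCEEstimator {Ω : Type*} [MeasurableSpace Ω] (P : Measure Ω) (μ : Measure X)
    (p : EuclideanSpace ℝ ι → X → ℝ) (Θ : Set (EuclideanSpace ℝ ι)) (β₀ : EuclideanSpace ℝ ι)
    (pn : X → ℝ) (ν : ℝ) (ξ η : ℕ → Ω → X) (Td Tn : ℕ → ℕ)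
    (est : ℕ → Ω → EuclideanSpace ℝ ι) : Prop where
  data_law : ∀ i, HasLaw (ξ i) (μ.withDensity fun x => ENNReal.ofReal (p β₀ x)) P
  noise_law : ∀ j, HasLaw (η j) (μ.withDensity fun x => ENNReal.ofReal (pn x)) P
  indep : iIndepFun (fun s : ℕ ⊕ ℕ => Sum.elim ξ η s) P
  data_size : Tendsto Td atTop atTop
  ratio : Tendsto (fun k => (Tn k : ℝ) / (Td k : ℝ)) atTop (𝓝 ν)
  measurable : ∀ k, AEMeasurable (est k) P
  mem : ∀ k ω, est k ω ∈ Θ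
  minimizer : Tendsto (fun k => P {ω | ¬ IsMinOn
    (logisticLoss p pn ν (Td k) (Tn k) (fun i => ξ i ω) (fun j => η j ω)) Θ (est k ω)})
    atTop (𝓝 0)
  consistent : TendstoInMeasure P est atTop fun _ => β₀

/-- Asymptotic uniform integrability of a sequence of nonnegative random variables. -/
def AsympUnifIntegrable {Ω : Type*} [MeasurableSpace Ω] (P : Measure Ω)
    (Y : ℕ → Ω → ℝ≥0∞) : Prop :=
  ∀ ε : ℝ≥0∞, 0 < ε → ∃ C : ℝ≥0, ∀ᶠ k in atTop, ∫⁻ ω, (Y k ω - C) ∂P ≤ ε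

/-! ### The estimation error -/

/-- Reweighting by the misclassification probability
`w(x) = P(Y = 0 | x) = ν pₙ(x) / (p_d(x) + ν pₙ(x))`. -/
def misclass (pd pn : X → ℝ) (ν : ℝ) (x : X) : ℝ :=
  ν * pn x / (pd x + ν * pn x)

/-- The norm `‖u‖_A = √⟨u, A u⟩` of a positive semidefinite matrix `A`. -/
def matNorm (A : Matrix ι ι ℝ) (u : EuclideanSpace ℝ ι) : ℝ :=
  √((fun i => u i) ⬝ᵥ (A *ᵥ fun i => u i))

variable [DecidableEq ι]

/-- Asymptotic covariance matrix of the NCE estimator,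
`Σ = I_w⁻¹ - (1 + 1 / ν) I_w⁻¹ m_w m_wᵀ I_w⁻¹`. -/
def asympCov (μ : Measure X) (p : EuclideanSpace ℝ ι → X → ℝ) (β₀ : EuclideanSpace ℝ ι)
    (pn : X → ℝ) (ν : ℝ) : Matrix ι ι ℝ :=
  let w := misclass (p β₀) pn ν
  let Iw := scoreCov μ p β₀ w
  let mw := scoreMean μ p β₀ w
  Iw⁻¹ - (1 + 1 / ν) • (Iw⁻¹ * Matrix.vecMulVec mw mw * Iw⁻¹)

/-- Non-parametric estimation error `((ν + 1) / (2 T)) tr (Σ I)` for the total budget `T`. -/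
def klError (μ : Measure X) (p : EuclideanSpace ℝ ι → X → ℝ) (β₀ : EuclideanSpace ℝ ι)
    (T ν : ℝ) (pn : X → ℝ) : ℝ :=
  (ν + 1) / (2 * T) * (asympCov μ p β₀ pn ν * fisher μ p β₀).trace

/-! ### The optimal noise -/

/-- The reweighting function `w₃(x) = ‖∇_β F(x; β₀)‖_{I⁻¹}`. -/
def w₃ (μ : Measure X) (p : EuclideanSpace ℝ ι → X → ℝ) (β₀ : EuclideanSpace ℝ ι) (x : X) : ℝ :=
  matNorm (fisher μ p β₀)⁻¹ (score p β₀ x)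

/-- Normalized product `f • g = f g / ∫ f g`. -/
def normProd (μ : Measure X) (f g : X → ℝ) (x : X) : ℝ :=
  f x * g x / ∫ y, f y * g y ∂μ

/-- The reweighted data density `p_d • w₃`. -/
def optNoise (μ : Measure X) (p : EuclideanSpace ℝ ι → X → ℝ) (β₀ : EuclideanSpace ℝ ι) :
    X → ℝ :=
  normProd μ (p β₀) (w₃ μ p β₀)

/-- The part of the non-parametric error, up to `o(1)` as `ν → ∞`, that does not involve the
noise: `(1 / (2 T)) (ν (d - q) + d - 2 q + Z²)` with `d` the number of parameters,
`q = mᵀ I⁻¹ m` and `Z = ∫ p_d w₃`. -/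
def noiseFreePart (μ : Measure X) (p : EuclideanSpace ℝ ι → X → ℝ) (β₀ : EuclideanSpace ℝ ι)
    (T ν : ℝ) : ℝ :=
  let d : ℝ := Fintype.card ι
  let m := scoreMean μ p β₀ fun _ => 1
  let q : ℝ := m ⬝ᵥ ((fisher μ p β₀)⁻¹ *ᵥ m)
  1 / (2 * T) * (ν * (d - q) + d - 2 * q + (∫ x, p β₀ x * w₃ μ p β₀ x ∂μ) ^ 2)

end NCE

end

open MeasureTheory ProbabilityTheory Filter Topology Matrix
open scoped ENNReal NNReal

noncomputable section

set_option linter.unusedSectionVars false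

namespace NCE

/-! ### Taylor remainders of first and second order -/

section Taylor

variable {E : Type*} [NormedAddCommGroup E] [NormedSpace ℝ E]

/-! Error. Let `U` be the gradient of the empirical logistic loss at `β₀`. Along any random `h`
tending to `0` in probability, the loss at `β₀ + h` exceeds the loss at `β₀` by `⟨U, h⟩ + hᵀ I_w h /
2 + o(‖h‖²)`. The limiting Hessian is `I_w`, because the identity `ν pₙ (1 - w) = w p_d` cancels the
Hessians of `log p` between the data and noise terms and merges the weights `w (1 - w)` and `w²`
into `w`. No empirical-process theory is needed. Divided by `‖h‖²`, the pointwise Taylor remainders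
near `0` have a measurable supremum, dominated by an integrable function, whose integral tends to
zero (`exists_small_quadratic_bound`). Markov's inequality then controls the empirical mean
uniformly in `h` (`empMean_remainder_isLittleO`).

Comparing the loss at its minimizer with its value at the vertex `g = -I_w⁻¹ U` of the parabola
gives `β̂ - β₀ = g + o(‖g‖)` (`isLittleO_sub_of_le`). The divergence is half the Fisher form up to
`o(‖h‖²)` (`RegularModel.genKL_expansion`), so `T · KL` is equivalent, with probability tending to
one, to `(ν + 1) / 2` times the quadratic form of `I_w⁻¹ I I_w⁻¹` at `√T_d U`. A two-sample central
limit theorem gives `√T_d U → N(0, V)` with `V = I_w - (1 + 1/ν) m_w m_wᵀ`. Truncated means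
therefore converge to truncated Gaussian means. These increase to `(ν + 1) / 2` times `tr (I_w⁻¹ I
I_w⁻¹ V) = tr (Σ I)`, and uniform integrability removes the truncation.

All-noise limit. Put `J = E_d[ν (1 - w) g gᵀ]`, so that `I = I_w + J / ν` and `tr (I_w⁻¹ I) = d + tr
(I_w⁻¹ J) / ν`. Since `ν (1 - w) = p_d / (p_d / ν + pₙ)` increases to `p_d / pₙ`, the quantity `τ =
tr (I⁻¹ J)` tends to `∫ p_d² w₃² / pₙ`, which is `Z² (1 + χ²)` and may be infinite. Replacing `I_w`
by `I` costs `o(τ)`. The term in `m_w` is handled by the kind of model: if normalized, `m = 0` and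
Cauchy-Schwarz gives `ν ‖m_w‖² = o(τ)`; if unnormalized, some direction `v` has `⟨g, v⟩ = 1`, so
`m_w = I_w v` and the term is constant. All errors are relative, `o(1 + τ)`
(`noisePart_sub_isLittleO`), so one argument covers finite and infinite limits.

Optimality. Integrating `2 a ≤ a² / b + b`, with equality only for `a = b`, shows that the
chi-squared divergence of probability densities vanishes only at equality. Any other noise has a
strictly larger limit, and since the error is a function of `ν` divided by `T`, the comparison is
uniform in `T`. -/

theorem abs_taylor_one_le {f : E → ℝ} {F₁ : E → E →L[ℝ] ℝ} {F₂ : E → E →L[ℝ] E →L[ℝ] ℝ}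
    {b : E} {r K : ℝ} (h₁ : ∀ β ∈ Metric.ball b r, HasFDerivAt f (F₁ β) β)
    (h₂ : ∀ β ∈ Metric.ball b r, HasFDerivAt F₁ (F₂ β) β)
    (hK : ∀ β ∈ Metric.ball b r, ‖F₂ β‖ ≤ K) {h : E} (hh : ‖h‖ < r) :
    |f (b + h) - f b - F₁ b h| ≤ K * ‖h‖ ^ 2 := by
  have hsub : Metric.closedBall b ‖h‖ ⊆ Metric.ball b r := Metric.closedBall_subset_ball hh
  have hb : b ∈ Metric.closedBall b ‖h‖ := Metric.mem_closedBall_self (norm_nonneg _)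
  have hbh : b + h ∈ Metric.closedBall b ‖h‖ := by simp
  have hK0 : 0 ≤ K := (norm_nonneg (F₂ b)).trans (hK b (hsub hb))
  have hD : ∀ β ∈ Metric.closedBall b ‖h‖, ‖F₁ β - F₁ b‖ ≤ K * ‖h‖ := fun β hβ => by
    have := (convex_closedBall b ‖h‖).norm_image_sub_le_of_norm_hasFDerivWithin_le
      (fun x hx => (h₂ x (hsub hx)).hasFDerivWithinAt) (fun x hx => hK x (hsub hx)) hb hβ
    refine this.trans (mul_le_mul_of_nonneg_left ?_ hK0)
    simpa [dist_eq_norm] using hβ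
  have := (convex_closedBall b ‖h‖).norm_image_sub_le_of_norm_hasFDerivWithin_le'
    (fun x hx => (h₁ x (hsub hx)).hasFDerivWithinAt) hD hb hbh
  simpa [pow_two, mul_assoc] using this

/-- Mean value inequality applied to the remainder itself: by symmetry of the second derivative, its
gradient at `y` is `F₁ (b + y) - F₁ b - F₂ y`, which is `o(‖y‖)` because `F₁` is differentiable at
the single point `b`. -/
theorem isLittleO_taylor_two {f : E → ℝ} {F₁ : E → E →L[ℝ] ℝ} {F₂ : E →L[ℝ] E →L[ℝ] ℝ}
    {b : E} (h₁ : ∀ᶠ β in 𝓝 b, HasFDerivAt f (F₁ β) β) (h₂ : HasFDerivAt F₁ F₂ b) :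
    (fun h => f (b + h) - f b - F₁ b h - F₂ h h / 2) =o[𝓝 0] fun h => ‖h‖ ^ 2 := by
  have hsymm := second_derivative_symmetric_of_eventually h₁ h₂
  rw [Asymptotics.isLittleO_iff]
  intro c hc
  have h₂' := (hasFDerivAt_iff_isLittleO_nhds_zero.1 h₂).bound hc
  have h₁' : ∀ᶠ h in 𝓝 (0 : E), HasFDerivAt f (F₁ (b + h)) (b + h) := by
    have : Tendsto (fun h => b + h) (𝓝 0) (𝓝 b) := by
      simpa using (tendsto_const_nhds (x := b)).add (tendsto_id (α := E) (x := 𝓝 0))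
    exact this.eventually h₁
  obtain ⟨ρ, hρ, hball⟩ := Metric.eventually_nhds_iff_ball.1 (h₁'.and h₂')
  filter_upwards [Metric.ball_mem_nhds (0 : E) hρ] with h hh
  have hh' : ‖h‖ < ρ := by simpa using hh
  set g : E → ℝ := fun y => f (b + y) - f b - F₁ b y - F₂ y y / 2
  have hg : ∀ y ∈ Metric.closedBall (0 : E) ‖h‖,
      HasFDerivWithinAt g (F₁ (b + y) - F₁ b - F₂ y) (Metric.closedBall (0 : E) ‖h‖) y := by
    intro y hy
    have hyρ := Metric.closedBall_subset_ball hh' hy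
    have d1 : HasFDerivAt (fun y => f (b + y)) (F₁ (b + y)) y := by
      exact (hball y hyρ).1.comp y ((hasFDerivAt_id y).const_add b)
    have d2 : HasFDerivAt (fun y => F₂ y y) (F₂ y + F₂.flip y) y := by
      exact F₂.hasFDerivAt (x := y) |>.clm_apply (hasFDerivAt_id y)
    have d3 : F₂ y + F₂.flip y = (2 : ℝ) • F₂ y := by
      ext v
      simp [hsymm v y, two_mul]
    rw [d3] at d2
    have d4 := ((d1.sub_const (f b)).sub (F₁ b).hasFDerivAt).sub (d2.mul_const (1 / 2 : ℝ))
    refine (d4.congr_of_eventuallyEq (Eventually.of_forall fun z => ?_)).hasFDerivWithinAt.congr_fderiv ?_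
    · simp [g]; ring
    · ext v; simp
  have hD : ∀ y ∈ Metric.closedBall (0 : E) ‖h‖, ‖F₁ (b + y) - F₁ b - F₂ y‖ ≤ c * ‖h‖ := by
    intro y hy
    refine ((hball y (Metric.closedBall_subset_ball hh' hy)).2).trans ?_
    exact mul_le_mul_of_nonneg_left (by simpa using hy) hc.le
  have := (convex_closedBall (0 : E) ‖h‖).norm_image_sub_le_of_norm_hasFDerivWithin_le hg hD
    (Metric.mem_closedBall_self (norm_nonneg _)) (y := h) (by simp)
  simpa [g, pow_two, mul_assoc] using this

/-- First and second order expansions of `Ψ ∘ ℓ` for a twice differentiable `ℓ`. -/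
theorem taylor_comp {ℓ : E → ℝ} {b : E} {r K : ℝ} {Ψ Ψ₁ Ψ₂ : ℝ → ℝ}
    (hr : 0 < r) (hℓ : ContDiffOn ℝ 2 ℓ (Metric.ball b r))
    (hΨ : ∀ t, HasDerivAt Ψ (Ψ₁ t) t) (hΨ₁ : ∀ t, HasDerivAt Ψ₁ (Ψ₂ t) t)
    (hK₁ : ∀ β ∈ Metric.ball b r,
      |Ψ₁ (ℓ β)| * (‖fderiv ℝ ℓ β‖ ^ 2 + ‖fderiv ℝ (fderiv ℝ ℓ) β‖) ≤ K)
    (hK₂ : ∀ β ∈ Metric.ball b r,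
      |Ψ₂ (ℓ β)| * (‖fderiv ℝ ℓ β‖ ^ 2 + ‖fderiv ℝ (fderiv ℝ ℓ) β‖) ≤ K) :
    (∀ h, ‖h‖ < r →
      |Ψ (ℓ (b + h)) - Ψ (ℓ b) - Ψ₁ (ℓ b) * fderiv ℝ ℓ b h| ≤ (2 * K) * ‖h‖ ^ 2) ∧
    (fun h => Ψ (ℓ (b + h)) - Ψ (ℓ b) - Ψ₁ (ℓ b) * fderiv ℝ ℓ b h
      - (Ψ₂ (ℓ b) * (fderiv ℝ ℓ b h) ^ 2 + Ψ₁ (ℓ b) * fderiv ℝ (fderiv ℝ ℓ) b h h) / 2)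
      =o[𝓝 0] fun h => ‖h‖ ^ 2 := by
  have hat : ∀ β ∈ Metric.ball b r, ContDiffAt ℝ 2 ℓ β := fun β hβ =>
    hℓ.contDiffAt (Metric.isOpen_ball.mem_nhds hβ)
  have hd1 : ∀ β ∈ Metric.ball b r, HasFDerivAt ℓ (fderiv ℝ ℓ β) β := fun β hβ =>
    ((hat β hβ).differentiableAt (by norm_num)).hasFDerivAt
  have hd2 : ∀ β ∈ Metric.ball b r,
      HasFDerivAt (fderiv ℝ ℓ) (fderiv ℝ (fderiv ℝ ℓ) β) β := fun β hβ =>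
    (((hat β hβ).fderiv_right (m := 1) (by norm_num)).differentiableAt (by norm_num)).hasFDerivAt
  have e1 : ∀ β ∈ Metric.ball b r,
      HasFDerivAt (fun β => Ψ (ℓ β)) (Ψ₁ (ℓ β) • fderiv ℝ ℓ β) β := fun β hβ =>
    (hΨ _).comp_hasFDerivAt β (hd1 β hβ)
  have e2 : ∀ β ∈ Metric.ball b r, HasFDerivAt (fun β => Ψ₁ (ℓ β) • fderiv ℝ ℓ β)
      (Ψ₁ (ℓ β) • fderiv ℝ (fderiv ℝ ℓ) β +
        (Ψ₂ (ℓ β) • fderiv ℝ ℓ β).smulRight (fderiv ℝ ℓ β)) β := fun β hβ =>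
    ((hΨ₁ _).comp_hasFDerivAt β (hd1 β hβ)).smul (hd2 β hβ)
  refine ⟨fun h hh => ?_, ?_⟩
  · refine abs_taylor_one_le e1 e2 (fun β hβ => ?_) hh
    have h1 := hK₁ β hβ
    have h2 := hK₂ β hβ
    rw [mul_add] at h1 h2
    -- The second derivative of `Ψ ∘ ℓ` is `Ψ₁ D²ℓ + Ψ₂ Dℓ ⊗ Dℓ`. Each summand is part of the left
    -- side of one hypothesis, whence `2 * K`.
    calc _ ≤ ‖Ψ₁ (ℓ β) • fderiv ℝ (fderiv ℝ ℓ) β‖ +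
          ‖(Ψ₂ (ℓ β) • fderiv ℝ ℓ β).smulRight (fderiv ℝ ℓ β)‖ :=
            ContinuousLinearMap.opNorm_add_le _ _
      _ ≤ |Ψ₁ (ℓ β)| * ‖fderiv ℝ (fderiv ℝ ℓ) β‖ + |Ψ₂ (ℓ β)| * ‖fderiv ℝ ℓ β‖ ^ 2 := by
          refine add_le_add (ContinuousLinearMap.opNorm_smul_le _ _) ?_
          rw [ContinuousLinearMap.norm_smulRight_apply, pow_two, ← mul_assoc]
          exact mul_le_mul_of_nonneg_right (ContinuousLinearMap.opNorm_smul_le _ _)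
            (norm_nonneg (fderiv ℝ ℓ β))
      _ ≤ 2 * K := by
          have : 0 ≤ |Ψ₁ (ℓ β)| * ‖fderiv ℝ ℓ β‖ ^ 2 := by positivity
          have : 0 ≤ |Ψ₂ (ℓ β)| * ‖fderiv ℝ (fderiv ℝ ℓ) β‖ := by positivity
          linarith
  · have hb : b ∈ Metric.ball b r := Metric.mem_ball_self hr
    have := isLittleO_taylor_two (f := fun β => Ψ (ℓ β))
      (F₁ := fun β => Ψ₁ (ℓ β) • fderiv ℝ ℓ β) (b := b)
      (Filter.eventually_of_mem (Metric.ball_mem_nhds b hr) e1) (e2 b hb)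
    refine this.congr_left fun h => ?_
    simp
    ring

end Taylor

/-! ### Uniform control of quadratic remainders -/

section Sup

variable {E : Type*} [NormedAddCommGroup E] [SecondCountableTopology E]
  {X : Type*} [MeasurableSpace X]

/-- A remainder which is `o(‖h‖²)` pointwise and dominated by `K x * ‖h‖²` is bounded, near `0`, by
`S x * ‖h‖²` with a measurable `S` of arbitrarily small integral. -/
theorem exists_small_quadratic_bound (m : Measure X) {R : E → X → ℝ} {K : X → ℝ} {r : ℝ}
    (hr : 0 < r) (hK : Integrable K m) (hRm : ∀ h ∈ Metric.ball (0 : E) r, Measurable (R h))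
    (hRc : ∀ x, ContinuousOn (fun h => R h x) (Metric.ball 0 r))
    (hRK : ∀ h x, ‖h‖ < r → |R h x| ≤ K x * ‖h‖ ^ 2)
    (hRo : ∀ x, (fun h => R h x) =o[𝓝 0] fun h => ‖h‖ ^ 2) {ε : ℝ≥0∞} (hε : 0 < ε) :
    ∃ ρ > 0, ρ < r ∧ ∃ S : X → ℝ, Measurable S ∧ (∀ x, 0 ≤ S x) ∧ (∀ x, S x ≤ |K x|) ∧
      ∫⁻ x, ENNReal.ofReal (S x) ∂m ≤ ε ∧
      ∀ h x, ‖h‖ ≤ ρ → |R h x| ≤ S x * ‖h‖ ^ 2 := by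
  let D := TopologicalSpace.denseSeq E
  have : Nonempty E := ⟨0⟩
  let q : E → X → ℝ := fun h x => |R h x| / ‖h‖ ^ 2
  have hqK : ∀ h x, ‖h‖ < r → q h x ≤ |K x| := by
    intro h x hh
    rcases eq_or_ne h 0 with rfl | h0
    · simp [q]
    · have : 0 < ‖h‖ ^ 2 := by positivity
      rw [div_le_iff₀ this]
      exact (hRK h x hh).trans (mul_le_mul_of_nonneg_right (le_abs_self _) this.le)
  -- The supremum of the normalized remainder over a shrinking ball, taken along a dense sequence to
  -- be measurable. The radius `r / (n + 2)` is always smaller than `r`.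
  let S : ℕ → X → ℝ := fun n x => ⨆ i : ℕ, if ‖TopologicalSpace.denseSeq E i‖ < r / (n + 2)
    then q (TopologicalSpace.denseSeq E i) x else 0
  have hrn : ∀ n : ℕ, r / (n + 2) < r := fun n => by
    rw [div_lt_iff₀ (by positivity)]
    nlinarith [(Nat.cast_nonneg n : (0 : ℝ) ≤ n)]
  have hterm : ∀ n x i, (if ‖TopologicalSpace.denseSeq E i‖ < r / ((n : ℕ) + 2)
      then q (TopologicalSpace.denseSeq E i) x else 0) ≤ |K x| := by
    intro n x i
    split_ifs with h
    · exact hqK _ _ (h.trans (hrn n))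
    · positivity
  have hbdd : ∀ n x, BddAbove (Set.range fun i : ℕ =>
      if ‖TopologicalSpace.denseSeq E i‖ < r / ((n : ℕ) + 2)
        then q (TopologicalSpace.denseSeq E i) x else 0) := fun n x =>
    ⟨|K x|, by rintro _ ⟨i, rfl⟩; exact hterm n x i⟩
  have hterm0 : ∀ n x i, 0 ≤ (if ‖TopologicalSpace.denseSeq E i‖ < r / ((n : ℕ) + 2)
      then q (TopologicalSpace.denseSeq E i) x else 0) := by
    intro n x i
    split_ifs <;> positivity
  have hS0 : ∀ n x, 0 ≤ S n x := fun n x => Real.iSup_nonneg (hterm0 n x)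
  have hSK : ∀ n x, S n x ≤ |K x| := fun n x => ciSup_le (hterm n x)
  have hSm : ∀ n, Measurable (S n) := fun n => by
    refine Measurable.iSup fun i => ?_
    split_ifs with h
    · exact ((hRm _ (by simpa using h.trans (hrn n))).abs).div_const _
    · exact measurable_const
  -- Continuity of the remainder in `h` carries the bound from the dense sequence to the whole open
  -- ball.
  have hSle : ∀ n x h, ‖h‖ < r / ((n : ℕ) + 2) → |R h x| ≤ S n x * ‖h‖ ^ 2 := by
    intro n x h hh
    have hopen : IsOpen (Metric.ball (0 : E) (r / ((n : ℕ) + 2))) := Metric.isOpen_ball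
    have hmem : h ∈ closure (Metric.ball (0 : E) (r / ((n : ℕ) + 2)) ∩
        Set.range (TopologicalSpace.denseSeq E)) :=
      (TopologicalSpace.denseRange_denseSeq E).open_subset_closure_inter hopen (by simpa using hh)
    rw [mem_closure_iff_nhdsWithin_neBot] at hmem
    have hc : ContinuousAt (fun h => R h x) h :=
      (hRc x).continuousAt (Metric.isOpen_ball.mem_nhds (by simpa using hh.trans (hrn n)))
    have hc2 : ContinuousAt (fun h => S n x * ‖h‖ ^ 2 - |R h x|) h :=
      (continuousAt_const.mul (continuous_norm.continuousAt.pow 2)).sub hc.abs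
    have := ge_of_tendsto (hc2.tendsto.mono_left (nhdsWithin_le_nhds
      (s := Metric.ball (0 : E) (r / ((n : ℕ) + 2)) ∩
        Set.range (TopologicalSpace.denseSeq E)))) (b := 0) ?_
    · linarith
    · refine eventually_nhdsWithin_iff.2 (Eventually.of_forall ?_)
      rintro _ ⟨hd, i, rfl⟩
      have hd' : ‖TopologicalSpace.denseSeq E i‖ < r / ((n : ℕ) + 2) := by simpa using hd
      have h1 : q (TopologicalSpace.denseSeq E i) x ≤ S n x := by
        have := le_ciSup (hbdd n x) i
        simpa [hd'] using this
      -- At the origin the quotient is the default value `0`; there the remainder itself vanishes,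
      -- by the bound `hRK`.
      rcases eq_or_ne (TopologicalSpace.denseSeq E i) 0 with h0 | h0
      · have := hRK 0 x (by simpa using hr)
        simp at this
        simp [h0, this]
      · have : 0 < ‖TopologicalSpace.denseSeq E i‖ ^ 2 := by positivity
        rw [div_le_iff₀ this] at h1
        linarith
  have hlim : ∀ x, Tendsto (fun n => S n x) atTop (𝓝 0) := by
    intro x
    rw [Metric.tendsto_atTop]
    intro δ hδ
    have := (hRo x).bound (half_pos hδ)
    obtain ⟨η, hη, hball⟩ := Metric.eventually_nhds_iff_ball.1 this
    obtain ⟨N, hN⟩ := exists_nat_gt (r / η)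
    refine ⟨N, fun n hn => ?_⟩
    rw [Real.dist_eq, sub_zero, abs_of_nonneg (hS0 n x)]
    refine (ciSup_le fun i => ?_ : S n x ≤ δ / 2).trans_lt (half_lt_self hδ)
    split_ifs with h
    · have hlt : ‖TopologicalSpace.denseSeq E i‖ < η := by
        refine h.trans ?_
        rw [div_lt_iff₀ (by positivity)]
        rw [div_lt_iff₀ hη] at hN
        have : (N : ℝ) ≤ n := by exact_mod_cast hn
        nlinarith
      have h1 := hball _ (by simpa using hlt : TopologicalSpace.denseSeq E i ∈ Metric.ball 0 η)
      rcases eq_or_ne (TopologicalSpace.denseSeq E i) 0 with h0 | h0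
      · simp [q, h0]; positivity
      · have : 0 < ‖TopologicalSpace.denseSeq E i‖ ^ 2 := by positivity
        rw [div_le_iff₀ this]
        simpa using h1
    · positivity
  have hint : Tendsto (fun n => ∫⁻ x, ENNReal.ofReal (S n x) ∂m) atTop (𝓝 0) := by
    have := tendsto_lintegral_of_dominated_convergence (μ := m)
      (F := fun n x => ENNReal.ofReal (S n x)) (f := fun _ => 0)
      (fun x => ENNReal.ofReal |K x|) (fun n => (hSm n).ennreal_ofReal)
      (fun n => Eventually.of_forall fun x => ENNReal.ofReal_le_ofReal (hSK n x)) ?_ ?_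
    · simpa using this
    · exact (hK.abs.lintegral_lt_top).ne
    · refine Eventually.of_forall fun x => ?_
      simpa [Function.comp_def] using (ENNReal.continuous_ofReal.tendsto 0).comp (hlim x)
  obtain ⟨n, hn⟩ := (hint.eventually (Iic_mem_nhds hε)).exists
  refine ⟨r / (n + 2) / 2, by positivity, ?_, S n, hSm n, hS0 n, hSK n, hn, fun h x hh => ?_⟩
  · exact (half_lt_self (by positivity)).trans (hrn n)
  · exact hSle n x h (hh.trans_lt (half_lt_self (by positivity)))

end Sup

/-- Directional derivatives depending measurably on a parameter are limits of difference quotients. -/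
theorem measurable_fderiv_apply_of_measurable {E : Type*} [NormedAddCommGroup E] [NormedSpace ℝ E]
    {X : Type*} [MeasurableSpace X] {F : E → X → ℝ} {U : Set E} (hU : IsOpen U)
    (hF : ∀ β ∈ U, Measurable (F β)) {b : E} (hb : b ∈ U)
    (hd : ∀ x, DifferentiableAt ℝ (fun β => F β x) b) (v : E) :
    Measurable fun x => fderiv ℝ (fun β => F β x) b v := by
  have hlim : Tendsto (fun n : ℕ => b + ((1 : ℝ) / (n + 1)) • v) atTop (𝓝 b) := by
    have h0 : Tendsto (fun n : ℕ => (1 : ℝ) / (n + 1)) atTop (𝓝 0) :=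
      tendsto_one_div_add_atTop_nhds_zero_nat
    simpa using (tendsto_const_nhds (x := b)).add (h0.smul_const v)
  -- Dropping the first `N` quotients keeps every evaluation point in `U`, where `F` is measurable.
  obtain ⟨N, hN⟩ := eventually_atTop.1 (hlim.eventually (hU.mem_nhds hb))
  refine measurable_of_tendsto_metrizable (f := fun (n : ℕ) x =>
    ((n + N : ℕ) + 1 : ℝ) * (F (b + ((1 : ℝ) / ((n + N : ℕ) + 1)) • v) x - F b x)) ?_ ?_
  · intro n
    exact ((hF _ (hN _ (Nat.le_add_left _ _))).sub (hF b hb)).const_mul _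
  · rw [tendsto_pi_nhds]
    intro x
    have h1 := (hd x).hasFDerivAt.lim_real v
    have h2 : Tendsto (fun n : ℕ => ((n + N : ℕ) + 1 : ℝ)) atTop atTop :=
      tendsto_atTop_add_const_right _ _
        (tendsto_natCast_atTop_atTop.comp (tendsto_add_atTop_nat N))
    have := h1.comp h2
    simpa [Function.comp_def] using this

/-! ### Quadratic forms of matrices -/

section QuadForm

variable {ι : Type*} [Fintype ι]

/-- The quadratic form `uᵀ A u`. -/
def quadForm (A : Matrix ι ι ℝ) (u : EuclideanSpace ℝ ι) : ℝ :=
  (fun i => u i) ⬝ᵥ (A *ᵥ fun i => u i)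

theorem quadForm_eq_sum (A : Matrix ι ι ℝ) (u : EuclideanSpace ℝ ι) :
    quadForm A u = ∑ i, ∑ j, A i j * (u i * u j) := by
  simp only [quadForm, dotProduct, mulVec, Finset.mul_sum]
  exact Finset.sum_congr rfl fun i _ => Finset.sum_congr rfl fun j _ => by ring

theorem quadForm_smul (A : Matrix ι ι ℝ) (c : ℝ) (u : EuclideanSpace ℝ ι) :
    quadForm A (c • u) = c ^ 2 * quadForm A u := by
  simp only [quadForm_eq_sum, Finset.mul_sum, PiLp.smul_apply, smul_eq_mul]
  exact Finset.sum_congr rfl fun i _ => Finset.sum_congr rfl fun j _ => by ring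

theorem quadForm_sub (A B : Matrix ι ι ℝ) (u : EuclideanSpace ℝ ι) :
    quadForm (A - B) u = quadForm A u - quadForm B u := by
  simp [quadForm, sub_mulVec]

@[fun_prop]
theorem continuous_quadForm (A : Matrix ι ι ℝ) : Continuous (quadForm A) := by
  simp only [funext (quadForm_eq_sum A)]
  fun_prop

theorem abs_apply_le_norm (u : EuclideanSpace ℝ ι) (i : ι) : |u i| ≤ ‖u‖ :=
  PiLp.norm_apply_le u i

theorem abs_quadForm_le (A : Matrix ι ι ℝ) (u : EuclideanSpace ℝ ι) :
    |quadForm A u| ≤ (∑ i, ∑ j, |A i j|) * ‖u‖ ^ 2 := by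
  rw [quadForm_eq_sum, Finset.sum_mul]
  refine (Finset.abs_sum_le_sum_abs _ _).trans (Finset.sum_le_sum fun i _ => ?_)
  rw [Finset.sum_mul]
  refine (Finset.abs_sum_le_sum_abs _ _).trans (Finset.sum_le_sum fun j _ => ?_)
  rw [abs_mul, abs_mul, pow_two]
  gcongr <;> exact abs_apply_le_norm u _

theorem quadForm_pos {A : Matrix ι ι ℝ} (hA : A.PosDef) {u : EuclideanSpace ℝ ι} (hu : u ≠ 0) :
    0 < quadForm A u := by
  have := hA.dotProduct_mulVec_pos (x := fun i => u i)
    (fun h => hu (by ext i; exact congrFun h i))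
  simpa [quadForm] using this

theorem quadForm_nonneg {A : Matrix ι ι ℝ} (hA : A.PosSemidef) (u : EuclideanSpace ℝ ι) :
    0 ≤ quadForm A u := by
  simpa [quadForm] using hA.dotProduct_mulVec_nonneg (fun i => u i)

/-- Homogeneity and the minimum over the compact unit sphere, which is empty when there are no
coordinates. -/
theorem exists_pos_le_quadForm {A : Matrix ι ι ℝ} (hA : A.PosDef) :
    ∃ c > 0, ∀ u, c * ‖u‖ ^ 2 ≤ quadForm A u := by
  rcases (Metric.sphere (0 : EuclideanSpace ℝ ι) 1).eq_empty_or_nonempty with he | hne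
  · refine ⟨1, one_pos, fun u => ?_⟩
    rcases eq_or_ne u 0 with rfl | hu
    · simp [quadForm_eq_sum]
    · have : ‖u‖⁻¹ • u ∈ Metric.sphere (0 : EuclideanSpace ℝ ι) 1 := by
        simp [norm_smul, inv_mul_cancel₀ (norm_ne_zero_iff.2 hu)]
      rw [he] at this
      exact this.elim
  · obtain ⟨v, hv, hmin⟩ := (isCompact_sphere (0 : EuclideanSpace ℝ ι) 1).exists_isMinOn hne
      (continuous_quadForm A).continuousOn
    have hv0 : v ≠ 0 := fun h => by simp [h] at hv
    refine ⟨quadForm A v, quadForm_pos hA hv0, fun u => ?_⟩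
    rcases eq_or_ne u 0 with rfl | hu
    · simp [quadForm_eq_sum]
    · have hmem : ‖u‖⁻¹ • u ∈ Metric.sphere (0 : EuclideanSpace ℝ ι) 1 := by
        simp [norm_smul, inv_mul_cancel₀ (norm_ne_zero_iff.2 hu)]
      have h1 : quadForm A v ≤ quadForm A (‖u‖⁻¹ • u) := hmin hmem
      rw [quadForm_smul, inv_pow, ← div_eq_inv_mul, le_div_iff₀ (by positivity)] at h1
      exact h1

end QuadForm

/-! ### Moments of the score -/

namespace RegularModel

variable {X : Type*} [MeasurableSpace X] {μ : Measure X}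
  {ι : Type*} [Fintype ι] [DecidableEq ι]
  {p : EuclideanSpace ℝ ι → X → ℝ} {Θ : Set (EuclideanSpace ℝ ι)} {β₀ : EuclideanSpace ℝ ι}

theorem mem_parameter (hreg : RegularModel μ p Θ β₀) : β₀ ∈ Θ := by
  obtain ⟨r, hr, hsub, -⟩ := hreg.smooth
  exact hsub (Metric.mem_ball_self hr)

theorem data_nonneg (hreg : RegularModel μ p Θ β₀) (x : X) : 0 ≤ p β₀ x :=
  hreg.nonneg _ hreg.mem_parameter x

theorem measurable_apply (hreg : RegularModel μ p Θ β₀) (β : EuclideanSpace ℝ ι) :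
    Measurable (p β) :=
  hreg.measurable.comp measurable_prodMk_left

theorem integrable_data (hreg : RegularModel μ p Θ β₀) : Integrable (p β₀) μ := by
  refine ⟨(hreg.measurable_apply β₀).aestronglyMeasurable, ?_⟩
  rw [hasFiniteIntegral_iff_ofReal (Eventually.of_forall hreg.data_nonneg), hreg.data_prob]
  exact ENNReal.one_lt_top

theorem integral_data (hreg : RegularModel μ p Θ β₀) : ∫ x, p β₀ x ∂μ = 1 := by
  rw [integral_eq_lintegral_of_nonneg_ae (Eventually.of_forall hreg.data_nonneg)
    (hreg.measurable_apply β₀).aestronglyMeasurable, hreg.data_prob]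
  simp

theorem fderiv_apply (x : X) (h : EuclideanSpace ℝ ι) :
    fderiv ℝ (fun β => Real.log (p β x)) β₀ h = inner ℝ (score p β₀ x) h := by
  rw [score, inner_gradient_left]

theorem norm_fderiv (x : X) :
    ‖fderiv ℝ (fun β => Real.log (p β x)) β₀‖ = ‖score p β₀ x‖ := by
  rw [score, gradient, LinearIsometryEquiv.norm_map]

theorem differentiableAt_log (hreg : RegularModel μ p Θ β₀) (x : X) :
    DifferentiableAt ℝ (fun β => Real.log (p β x)) β₀ := by
  obtain ⟨r, hr, -, hC, -⟩ := hreg.smooth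
  exact ((hC x).contDiffAt (Metric.ball_mem_nhds β₀ hr)).differentiableAt (by norm_num)

theorem measurable_log (hreg : RegularModel μ p Θ β₀) (β : EuclideanSpace ℝ ι) :
    Measurable fun x => Real.log (p β x) :=
  Real.measurable_log.comp (hreg.measurable_apply β)

theorem measurable_score (hreg : RegularModel μ p Θ β₀) : Measurable (score p β₀) := by
  have h : ∀ i, Measurable fun x => score p β₀ x i := fun i => by
    have := measurable_fderiv_apply_of_measurable (F := fun β x => Real.log (p β x)) (b := β₀)
      isOpen_univ (fun β _ => hreg.measurable_log β) (Set.mem_univ _) hreg.differentiableAt_log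
      (EuclideanSpace.single i 1)
    simpa only [fderiv_apply, EuclideanSpace.inner_single_right, mul_one, one_mul,
      conj_trivial] using this
  exact (PiLp.continuous_toLp 2 _).measurable.comp (measurable_pi_iff.2 h)

@[fun_prop]
theorem measurable_score_apply (hreg : RegularModel μ p Θ β₀) (i : ι) :
    Measurable fun x => score p β₀ x i :=
  (EuclideanSpace.proj (𝕜 := ℝ) i).measurable.comp hreg.measurable_score

theorem integrable_score_sq (hreg : RegularModel μ p Θ β₀) :
    Integrable (fun x => p β₀ x * ‖score p β₀ x‖ ^ 2) μ := by
  obtain ⟨r, hr, -, -, G, hG, hb⟩ := hreg.smooth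
  refine hG.mono' ((hreg.measurable_apply β₀).mul
    (hreg.measurable_score.norm.pow_const 2)).aestronglyMeasurable (Eventually.of_forall fun x => ?_)
  have h1 := hb β₀ (Metric.mem_ball_self hr) x
  have h0 := hreg.data_nonneg x
  rw [norm_fderiv] at h1
  rw [Real.norm_of_nonneg (by positivity)]
  refine le_trans ?_ h1
  have := norm_nonneg (fderiv ℝ (fderiv ℝ fun b => Real.log (p b x)) β₀)
  nlinarith [mul_nonneg h0 this, mul_nonneg h0 (sq_nonneg ‖score p β₀ x‖)]

theorem integrable_of_le_score_sq (hreg : RegularModel μ p Θ β₀) {u : X → ℝ} {C : ℝ}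
    (hu : Measurable u) (hb : ∀ x, |u x| ≤ C * (1 + ‖score p β₀ x‖ ^ 2)) :
    Integrable (fun x => u x * p β₀ x) μ := by
  refine ((hreg.integrable_data.add hreg.integrable_score_sq).const_mul C).mono'
    (hu.mul (hreg.measurable_apply β₀)).aestronglyMeasurable (Eventually.of_forall fun x => ?_)
  have h0 := hreg.data_nonneg x
  rw [Real.norm_eq_abs, abs_mul, abs_of_nonneg h0]
  refine (mul_le_mul_of_nonneg_right (hb x) h0).trans_eq ?_
  simp only [Pi.add_apply]
  ring

variable {u : X → ℝ} {C : ℝ}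

theorem integrable_mul_data (hreg : RegularModel μ p Θ β₀) (hu : Measurable u)
    (hb : ∀ x, |u x| ≤ C) : Integrable (fun x => u x * p β₀ x) μ := by
  refine hreg.integrable_of_le_score_sq (C := C) hu fun x => (hb x).trans ?_
  have : 0 ≤ C := (abs_nonneg _).trans (hb x)
  nlinarith [sq_nonneg ‖score p β₀ x‖]

theorem integrable_score_apply (hreg : RegularModel μ p Θ β₀) (hu : Measurable u)
    (hb : ∀ x, |u x| ≤ C) (i : ι) :
    Integrable (fun x => u x * score p β₀ x i * p β₀ x) μ := by
  refine hreg.integrable_of_le_score_sq (C := C) (hu.mul (hreg.measurable_score_apply i))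
    fun x => ?_
  rw [abs_mul]
  have h1 := abs_apply_le_norm (score p β₀ x) i
  refine mul_le_mul (hb x) ?_ (abs_nonneg _) ((abs_nonneg _).trans (hb x))
  nlinarith [sq_nonneg (‖score p β₀ x‖ - 1), sq_nonneg ‖score p β₀ x‖]

theorem integrable_score_mul_score (hreg : RegularModel μ p Θ β₀) (hu : Measurable u)
    (hb : ∀ x, |u x| ≤ C) (i j : ι) :
    Integrable (fun x => u x * (score p β₀ x i * score p β₀ x j) * p β₀ x) μ := by
  refine hreg.integrable_of_le_score_sq (C := C)
    (hu.mul ((hreg.measurable_score_apply i).mul (hreg.measurable_score_apply j))) fun x => ?_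
  rw [abs_mul, abs_mul]
  have h1 := abs_apply_le_norm (score p β₀ x) i
  have h2 := abs_apply_le_norm (score p β₀ x) j
  refine mul_le_mul (hb x) ?_ (by positivity) ((abs_nonneg _).trans (hb x))
  nlinarith [abs_nonneg (score p β₀ x i), abs_nonneg (score p β₀ x j)]

theorem integrable_quadForm_score (hreg : RegularModel μ p Θ β₀) (A : Matrix ι ι ℝ)
    (hu : Measurable u) (hb : ∀ x, |u x| ≤ C) :
    Integrable (fun x => u x * quadForm A (score p β₀ x) * p β₀ x) μ := by
  have : (fun x => u x * quadForm A (score p β₀ x) * p β₀ x) = fun x =>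
      ∑ i, ∑ j, A i j * (u x * (score p β₀ x i * score p β₀ x j) * p β₀ x) := by
    ext x
    rw [quadForm_eq_sum, Finset.mul_sum, Finset.sum_mul]
    refine Finset.sum_congr rfl fun i _ => ?_
    rw [Finset.mul_sum, Finset.sum_mul]
    exact Finset.sum_congr rfl fun j _ => by ring
  rw [this]
  exact integrable_finsetSum _ fun i _ => integrable_finsetSum _ fun j _ =>
    (hreg.integrable_score_mul_score hu hb i j).const_mul _

theorem trace_mul_scoreCov (hreg : RegularModel μ p Θ β₀) (A : Matrix ι ι ℝ)
    (hu : Measurable u) (hb : ∀ x, |u x| ≤ C) :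
    (A * scoreCov μ p β₀ u).trace = ∫ x, u x * quadForm A (score p β₀ x) * p β₀ x ∂μ := by
  have : (fun x => u x * quadForm A (score p β₀ x) * p β₀ x) = fun x =>
      ∑ i, ∑ j, A i j * (u x * (score p β₀ x j * score p β₀ x i) * p β₀ x) := by
    ext x
    rw [quadForm_eq_sum, Finset.mul_sum, Finset.sum_mul]
    refine Finset.sum_congr rfl fun i _ => ?_
    rw [Finset.mul_sum, Finset.sum_mul]
    exact Finset.sum_congr rfl fun j _ => by ring
  rw [this]
  refine Eq.symm ((integral_finsetSum _ fun i _ => integrable_finsetSum _ fun j _ =>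
    (hreg.integrable_score_mul_score hu hb j i).const_mul _).trans ?_)
  simp only [Matrix.trace, Matrix.diag, Matrix.mul_apply]
  refine Finset.sum_congr rfl fun i _ => ?_
  refine (integral_finsetSum _ fun j _ =>
    (hreg.integrable_score_mul_score hu hb j i).const_mul _).trans ?_
  exact Finset.sum_congr rfl fun j _ => integral_const_mul _ _

theorem inner_score_sq (v : EuclideanSpace ℝ ι) (x : X) :
    inner ℝ (score p β₀ x) v ^ 2 = quadForm (vecMulVec (fun i => v i) fun i => v i)
      (score p β₀ x) := by
  rw [quadForm_eq_sum, pow_two, PiLp.inner_apply, Finset.sum_mul_sum]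
  refine Finset.sum_congr rfl fun i _ => Finset.sum_congr rfl fun j _ => ?_
  simp [vecMulVec_apply]
  ring

theorem integrable_inner_score_sq (hreg : RegularModel μ p Θ β₀) (hu : Measurable u)
    (hb : ∀ x, |u x| ≤ C) (v : EuclideanSpace ℝ ι) :
    Integrable (fun x => u x * inner ℝ (score p β₀ x) v ^ 2 * p β₀ x) μ := by
  simp only [inner_score_sq]
  exact hreg.integrable_quadForm_score _ hu hb

theorem quadForm_scoreCov (hreg : RegularModel μ p Θ β₀) (hu : Measurable u)
    (hb : ∀ x, |u x| ≤ C) (v : EuclideanSpace ℝ ι) :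
    quadForm (scoreCov μ p β₀ u) v = ∫ x, u x * inner ℝ (score p β₀ x) v ^ 2 * p β₀ x ∂μ := by
  simp only [inner_score_sq]
  rw [← hreg.trace_mul_scoreCov _ hu hb, Matrix.trace_mul_comm, quadForm, Matrix.mul_vecMulVec,
    Matrix.trace_vecMulVec, dotProduct_comm]

theorem scoreCov_isHermitian (u : X → ℝ) : (scoreCov μ p β₀ u).IsHermitian := by
  ext i j
  simp only [scoreCov, conjTranspose_apply, of_apply, star_trivial]
  congr with x
  ring

theorem scoreCov_posSemidef (hreg : RegularModel μ p Θ β₀) (hu : Measurable u)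
    (hb : ∀ x, |u x| ≤ C) (h0 : ∀ x, 0 ≤ u x) : (scoreCov μ p β₀ u).PosSemidef := by
  refine .of_dotProduct_mulVec_nonneg (scoreCov_isHermitian u) fun v => ?_
  have := hreg.quadForm_scoreCov hu hb (WithLp.toLp 2 v)
  simp only [quadForm] at this
  simp only [star_trivial]
  rw [this]
  exact integral_nonneg fun x => mul_nonneg (mul_nonneg (h0 x) (sq_nonneg _)) (hreg.data_nonneg x)

theorem fisher_posSemidef (hreg : RegularModel μ p Θ β₀) : (fisher μ p β₀).PosSemidef :=
  hreg.scoreCov_posSemidef measurable_const (C := 1) (by simp) (by simp)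

theorem fisher_posDef (hreg : RegularModel μ p Θ β₀) : (fisher μ p β₀).PosDef :=
  hreg.fisher_posSemidef.posDef_iff_isUnit.2
    ((Matrix.isUnit_iff_isUnit_det _).2 hreg.fisher_det.isUnit)

/-- A null vector `v` would make `u ⟨g, v⟩² p_d` vanish almost everywhere. As `u` is positive
wherever `g` and `p_d` do not vanish, `⟨g, v⟩² p_d` would vanish too, against the definiteness of
the Fisher information. Admissibility of the noise is exactly this condition for `u = w`. -/
theorem scoreCov_posDef (hreg : RegularModel μ p Θ β₀) (hu : Measurable u)
    (hb : ∀ x, |u x| ≤ C) (h0 : ∀ x, 0 ≤ u x)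
    (hpos : ∀ᵐ x ∂μ, p β₀ x ≠ 0 → score p β₀ x ≠ 0 → 0 < u x) :
    (scoreCov μ p β₀ u).PosDef := by
  refine .of_dotProduct_mulVec_pos (scoreCov_isHermitian u) fun v hv => ?_
  have h1 := (hreg.scoreCov_posSemidef hu hb h0).dotProduct_mulVec_nonneg v
  refine lt_of_le_of_ne h1 fun heq => hv ?_
  have h2 := hreg.quadForm_scoreCov hu hb (WithLp.toLp 2 v)
  simp only [quadForm] at h2
  simp only [star_trivial] at heq
  rw [← heq, eq_comm, integral_eq_zero_iff_of_nonneg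
    (fun x => mul_nonneg (mul_nonneg (h0 x) (sq_nonneg _)) (hreg.data_nonneg x))
    (hreg.integrable_inner_score_sq hu hb _)] at h2
  by_contra hv0
  have h3 := quadForm_pos hreg.fisher_posDef (u := WithLp.toLp 2 v)
    (fun h => hv0 (by simpa using congrArg WithLp.ofLp h))
  rw [fisher, hreg.quadForm_scoreCov measurable_const (C := 1) (by simp)] at h3
  refine h3.ne' (integral_eq_zero_of_ae ?_)
  filter_upwards [h2, hpos] with x hx hx'
  simp only [Pi.zero_apply, mul_eq_zero, one_mul] at hx ⊢
  by_cases hp : p β₀ x = 0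
  · exact Or.inr hp
  · by_cases hs : score p β₀ x = 0
    · simp [hs]
    · have := (hx' hp hs).ne'
      tauto

theorem integral_inner_score (hreg : RegularModel μ p Θ β₀) (hu : Measurable u)
    (hb : ∀ x, |u x| ≤ C) (v : EuclideanSpace ℝ ι) :
    ∫ x, u x * inner ℝ (score p β₀ x) v * p β₀ x ∂μ = scoreMean μ p β₀ u ⬝ᵥ fun i => v i := by
  have : (fun x => u x * inner ℝ (score p β₀ x) v * p β₀ x) = fun x =>
      ∑ i, (u x * score p β₀ x i * p β₀ x) * v i := by
    ext x
    rw [PiLp.inner_apply, Finset.mul_sum, Finset.sum_mul]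
    refine Finset.sum_congr rfl fun i _ => ?_
    simp
    ring
  rw [this, integral_finsetSum _ fun i _ => (hreg.integrable_score_apply hu hb i).mul_const _]
  exact Finset.sum_congr rfl fun i _ => integral_mul_const _ _

end RegularModel

/-! ### The misclassification weight -/

section Misclass

variable {X : Type*}

theorem misclass_mem {pd pn : X → ℝ} {ν : ℝ} {x : X} (hd : 0 ≤ pd x) (hn : 0 ≤ pn x) (hν : 0 < ν) :
    0 ≤ misclass pd pn ν x ∧ misclass pd pn ν x ≤ 1 := by
  have : 0 ≤ ν * pn x := by positivity
  refine ⟨by unfold misclass; positivity, div_le_one_of_le₀ (by linarith) (by linarith)⟩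

theorem abs_misclass_le {pd pn : X → ℝ} {ν : ℝ} {x : X} (hd : 0 ≤ pd x) (hn : 0 ≤ pn x)
    (hν : 0 < ν) : |misclass pd pn ν x| ≤ 1 := by
  have := misclass_mem hd hn hν
  rw [abs_le]; constructor <;> linarith

/-- Both sides are `ν p_d pₙ / (p_d + ν pₙ)`. This identity converts noise expectations into data
expectations throughout. -/
theorem one_sub_misclass_mul {pd pn : X → ℝ} {ν : ℝ} {x : X} (hd : 0 ≤ pd x) (hn : 0 ≤ pn x)
    (hν : 0 < ν) : ν * pn x * (1 - misclass pd pn ν x) = misclass pd pn ν x * pd x := by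
  unfold misclass
  by_cases h : pd x + ν * pn x = 0
  · have h1 : 0 ≤ ν * pn x := by positivity
    have h2 : pd x = 0 := by linarith
    have h3 : ν * pn x = 0 := by linarith
    simp [h2, h3]
  · field_simp
    ring

theorem misclass_pos {pd pn : X → ℝ} {ν : ℝ} {x : X} (hd : 0 ≤ pd x) (hn : 0 < pn x)
    (hν : 0 < ν) : 0 < misclass pd pn ν x := by
  unfold misclass; positivity

theorem measurable_misclass [MeasurableSpace X] {pd pn : X → ℝ} (hd : Measurable pd)
    (hn : Measurable pn) (ν : ℝ) : Measurable (misclass pd pn ν) :=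
  (hn.const_mul ν).div (hd.add (hn.const_mul ν))

end Misclass

theorem tendsto_matrix_inv {ι α : Type*} [Fintype ι] [DecidableEq ι] {l : Filter α}
    {A : α → Matrix ι ι ℝ} {B : Matrix ι ι ℝ} (h : Tendsto A l (𝓝 B)) (hB : B.det ≠ 0) :
    Tendsto (fun a => (A a)⁻¹) l (𝓝 B⁻¹) := by
  simp only [Matrix.inv_def, Ring.inverse_eq_inv']
  have h1 : Tendsto (fun a => (A a).det) l (𝓝 B.det) :=
    ((continuous_id.matrix_det).tendsto B).comp h
  have h2 : Tendsto (fun a => (A a).adjugate) l (𝓝 B.adjugate) :=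
    ((continuous_id.matrix_adjugate).tendsto B).comp h
  exact (h1.inv₀ hB).smul h2

/-! ### The mean score, and reweighted moments for large noise ratio -/

namespace RegularModel

variable {X : Type*} [MeasurableSpace X] {μ : Measure X}
  {ι : Type*} [Fintype ι] [DecidableEq ι]
  {p : EuclideanSpace ℝ ι → X → ℝ} {Θ : Set (EuclideanSpace ℝ ι)} {β₀ : EuclideanSpace ℝ ι}

/-! ### The mean score of normalized and unnormalized models -/

/-- Differentiation of `∫ p_β = 1` under the integral sign. The first-order remainder of `p_β` is
dominated by a multiple of `G ‖h‖²` and both densities integrate to one, so the linear functional is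
`O(‖h‖²)`; dividing by the scale `t` of `h = t v` and letting `t → 0` makes it zero. -/
theorem integral_inner_score_eq_zero (hreg : RegularModel μ p Θ β₀) (hN : IsNormalized μ p Θ)
    (v : EuclideanSpace ℝ ι) : ∫ x, inner ℝ (score p β₀ x) v * p β₀ x ∂μ = 0 := by
  obtain ⟨r, hr, hsub, hC, G, hG, hb⟩ := hreg.smooth
  have hI : Integrable (fun x => inner ℝ (score p β₀ x) v * p β₀ x) μ := by
    refine hreg.integrable_of_le_score_sq (C := ‖v‖)
      (hreg.measurable_score.inner measurable_const) fun x => ?_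
    refine (abs_real_inner_le_norm _ _).trans ?_
    rw [mul_comm]
    refine mul_le_mul_of_nonneg_left ?_ (norm_nonneg v)
    nlinarith [sq_nonneg (‖score p β₀ x‖ - 1), sq_nonneg ‖score p β₀ x‖]
  have hint : ∀ β ∈ Θ, Integrable (p β) μ := fun β hβ => by
    by_contra h
    have := hN β hβ
    rw [integral_undef h] at this
    exact zero_ne_one this
  have key : ∀ h : EuclideanSpace ℝ ι, ‖h‖ < r →
      |∫ x, inner ℝ (score p β₀ x) h * p β₀ x ∂μ| ≤ 2 * (∫ x, G x ∂μ) * ‖h‖ ^ 2 := by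
    intro h hh
    have hmem : β₀ + h ∈ Metric.ball β₀ r := by simpa using hh
    have hpt : ∀ x, |p (β₀ + h) x - p β₀ x - inner ℝ (score p β₀ x) h * p β₀ x| ≤
        2 * G x * ‖h‖ ^ 2 := by
      intro x
      -- Off the common support all three terms vanish; on it, `p β = exp (log p β)` is expanded
      -- with `Ψ = exp`.
      by_cases hx : p β₀ x = 0
      · have h0 := hb β₀ (Metric.mem_ball_self hr) x
        have hG0 : 0 ≤ G x := by
          refine le_trans ?_ h0
          rw [hx]
          simp
        rw [(hreg.support _ (hsub hmem) x).2 hx, hx]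
        simp
        positivity
      · have hpos : ∀ β ∈ Metric.ball β₀ r, Real.exp (Real.log (p β x)) = p β x := fun β hβ =>
          Real.exp_log (lt_of_le_of_ne (hreg.nonneg β (hsub hβ) x)
            (Ne.symm fun h => hx ((hreg.support β (hsub hβ) x).1 h)))
        have hK : ∀ β ∈ Metric.ball β₀ r, |Real.exp (Real.log (p β x))| *
            (‖fderiv ℝ (fun b => Real.log (p b x)) β‖ ^ 2 +
              ‖fderiv ℝ (fderiv ℝ fun b => Real.log (p b x)) β‖) ≤ G x := fun β hβ => by
          refine le_trans ?_ (hb β hβ x)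
          rw [hpos β hβ, abs_of_nonneg (hreg.nonneg β (hsub hβ) x)]
          refine mul_le_mul_of_nonneg_right ?_ (add_nonneg (by positivity)
            (norm_nonneg (fderiv ℝ (fderiv ℝ fun b => Real.log (p b x)) β)))
          linarith [hreg.data_nonneg x]
        have := (taylor_comp hr (hC x) Real.hasDerivAt_exp Real.hasDerivAt_exp hK hK).1 h hh
        rw [hpos _ hmem, hpos _ (Metric.mem_ball_self hr), fderiv_apply] at this
        rwa [mul_comm (inner ℝ _ _)]
    have hIh : Integrable (fun x => inner ℝ (score p β₀ x) h * p β₀ x) μ := by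
      refine hreg.integrable_of_le_score_sq (C := ‖h‖)
        (hreg.measurable_score.inner measurable_const) fun x => ?_
      refine (abs_real_inner_le_norm _ _).trans ?_
      rw [mul_comm]
      refine mul_le_mul_of_nonneg_left ?_ (norm_nonneg h)
      nlinarith [sq_nonneg (‖score p β₀ x‖ - 1), sq_nonneg ‖score p β₀ x‖]
    have hIp := (hint _ (hsub hmem)).sub hreg.integrable_data
    have h1 : ∫ x, (p (β₀ + h) x - p β₀ x - inner ℝ (score p β₀ x) h * p β₀ x) ∂μ =
        - ∫ x, inner ℝ (score p β₀ x) h * p β₀ x ∂μ := by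
      refine (integral_sub hIp hIh).trans ?_
      have : ∫ x, (p (β₀ + h) - p β₀) x ∂μ = 0 :=
        (integral_sub (hint _ (hsub hmem)) hreg.integrable_data).trans
          (by rw [hN _ (hsub hmem), hreg.integral_data, sub_self])
      rw [this, zero_sub]
    rw [← abs_neg, ← h1]
    refine (abs_integral_le_integral_abs).trans ?_
    have h2 := integral_mono (μ := μ) (hIp.sub hIh).abs
      ((hG.const_mul 2).mul_const (‖h‖ ^ 2)) hpt
    refine h2.trans_eq ?_
    rw [integral_mul_const, integral_const_mul]
  set c := ∫ x, inner ℝ (score p β₀ x) v * p β₀ x ∂μ with hc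
  have hlim : Tendsto (fun t : ℝ => 2 * (∫ x, G x ∂μ) * (t * ‖v‖ ^ 2)) (𝓝[>] 0) (𝓝 0) := by
    have : Continuous fun t : ℝ => 2 * (∫ x, G x ∂μ) * (t * ‖v‖ ^ 2) := by fun_prop
    have h := (this.tendsto 0).mono_left (nhdsWithin_le_nhds (s := Set.Ioi 0))
    simpa using h
  have hsmall : ∀ᶠ t : ℝ in 𝓝[>] 0, |c| ≤ 2 * (∫ x, G x ∂μ) * (t * ‖v‖ ^ 2) := by
    have ht : Tendsto (fun t : ℝ => ‖t • v‖) (𝓝[>] 0) (𝓝 0) := by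
      have : Continuous fun t : ℝ => ‖t • v‖ := by fun_prop
      have h := (this.tendsto 0).mono_left (nhdsWithin_le_nhds (s := Set.Ioi 0))
      simpa using h
    filter_upwards [ht.eventually (gt_mem_nhds hr), self_mem_nhdsWithin] with t ht ht0
    have h0 : (0 : ℝ) < t := ht0
    have := key (t • v) ht
    simp only [inner_smul_right, mul_assoc] at this
    rw [integral_const_mul, abs_mul, abs_of_pos h0, norm_smul, Real.norm_of_nonneg h0.le] at this
    have h3 : t * |c| ≤ t * (2 * (∫ x, G x ∂μ) * (t * ‖v‖ ^ 2)) := by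
      rw [hc]; linarith
    exact le_of_mul_le_mul_left h3 h0
  have := ge_of_tendsto hlim hsmall
  exact abs_eq_zero.1 (le_antisymm this (abs_nonneg _))

theorem scoreMean_one_eq_zero (hreg : RegularModel μ p Θ β₀) (hN : IsNormalized μ p Θ) :
    scoreMean μ p β₀ (fun _ => 1) = 0 := by
  ext i
  have := hreg.integral_inner_score_eq_zero hN (EuclideanSpace.single i 1)
  simpa [scoreMean, EuclideanSpace.inner_single_right] using this

/-- Changing only the log-normalization `c` subtracts the change from `log p` on the support, so the
derivative in the direction of decreasing `c` is `1`. -/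
theorem exists_inner_score_eq_one (hreg : RegularModel μ p Θ β₀) (hU : IsUnnormalized p Θ) :
    ∃ v : EuclideanSpace ℝ ι, ∀ x, p β₀ x ≠ 0 → inner ℝ (score p β₀ x) v = 1 := by
  obtain ⟨i₀, q, hq⟩ := hU
  obtain ⟨r, hr, hsub, -⟩ := hreg.smooth
  refine ⟨-EuclideanSpace.single i₀ 1, fun x hx => ?_⟩
  rw [inner_neg_right, ← fderiv_apply]
  have hd := (hreg.differentiableAt_log x).hasFDerivAt
  have hline : HasDerivAt (fun t : ℝ => β₀ + t • EuclideanSpace.single i₀ (1 : ℝ))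
      (EuclideanSpace.single i₀ (1 : ℝ)) 0 := by
    simpa using ((hasDerivAt_id (0 : ℝ)).smul_const (EuclideanSpace.single i₀ (1 : ℝ))).const_add β₀
  have hd' : HasFDerivAt (fun β => Real.log (p β x))
      (fderiv ℝ (fun β => Real.log (p β x)) β₀)
      (β₀ + (0 : ℝ) • EuclideanSpace.single i₀ (1 : ℝ)) := by simpa using hd
  have h1 := hd'.comp_hasDerivAt (0 : ℝ) hline
  have h2 : HasDerivAt (fun t : ℝ => Real.log (p β₀ x) - t) (-1) 0 := by
    simpa using (hasDerivAt_id (0 : ℝ)).const_sub (Real.log (p β₀ x))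
  have heq : (fun t : ℝ => Real.log (p β₀ x) - t) =ᶠ[𝓝 0]
      (fun β => Real.log (p β x)) ∘ fun t : ℝ => β₀ + t • EuclideanSpace.single i₀ (1 : ℝ) := by
    have hc : ∀ᶠ t : ℝ in 𝓝 0, β₀ + t • EuclideanSpace.single i₀ (1 : ℝ) ∈ Metric.ball β₀ r := by
      refine hline.continuousAt.eventually_mem ?_
      simpa using Metric.ball_mem_nhds β₀ hr
    filter_upwards [hc] with t ht
    have e1 := hq _ (hsub ht) x
    have e0 := hq _ hreg.mem_parameter x
    have e2 : (fun i : {i : ι // i ≠ i₀} =>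
        (β₀ + t • EuclideanSpace.single i₀ (1 : ℝ)) i) = fun i : {i : ι // i ≠ i₀} => β₀ i := by
      ext i
      simp [i.2]
    have e3 : p (β₀ + t • EuclideanSpace.single i₀ (1 : ℝ)) x = p β₀ x * Real.exp (-t) := by
      rw [e1, e2, e0, mul_assoc, ← Real.exp_add]
      congr 2
      simp
      ring
    simp only [Function.comp_apply, e3]
    rw [Real.log_mul hx (Real.exp_ne_zero _), Real.log_exp]
    ring
  have h3 := (h2.congr_of_eventuallyEq heq.symm).unique h1
  rw [← h3]
  simp

/-- On the support `g = g ⟨g, v⟩`; averaging with the weight `u` turns the mean into a column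
combination of the second moment. -/
theorem scoreMean_eq_mulVec (hreg : RegularModel μ p Θ β₀) {v : EuclideanSpace ℝ ι}
    (hv : ∀ x, p β₀ x ≠ 0 → inner ℝ (score p β₀ x) v = 1) {u : X → ℝ} {C : ℝ} (hu : Measurable u)
    (hb : ∀ x, |u x| ≤ C) : scoreMean μ p β₀ u = scoreCov μ p β₀ u *ᵥ fun i => v i := by
  ext i
  have h1 : (scoreCov μ p β₀ u *ᵥ fun i => v i) i =
      ∫ x, ∑ j, (u x * (score p β₀ x i * score p β₀ x j) * p β₀ x) * v j ∂μ := by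
    refine Eq.symm ((integral_finsetSum _ fun j _ =>
      (hreg.integrable_score_mul_score hu hb i j).mul_const _).trans ?_)
    exact Finset.sum_congr rfl fun j _ => integral_mul_const _ _
  rw [h1]
  refine integral_congr_ae (Eventually.of_forall fun x => ?_)
  by_cases hx : p β₀ x = 0
  · simp [hx]
  · have := hv x hx
    rw [PiLp.inner_apply] at this
    have h2 : ∀ j, (u x * (score p β₀ x i * score p β₀ x j) * p β₀ x) * v j =
        (u x * score p β₀ x i * p β₀ x) * inner ℝ (score p β₀ x j) (v j) := fun j => by
      simp; ring
    simp only [h2]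
    rw [← Finset.mul_sum, this, mul_one]

/-! ### Limits of reweighted moments -/

variable {pn : X → ℝ}

theorem tendsto_misclass {pd pn : X → ℝ} {x : X} (hn : 0 < pn x) :
    Tendsto (fun ν : ℝ => misclass pd pn ν x) atTop (𝓝 1) := by
  have h1 : Tendsto (fun ν : ℝ => pd x + ν * pn x) atTop atTop :=
    tendsto_atTop_add_const_left _ _ (tendsto_id.atTop_mul_const hn)
  have h2 : Tendsto (fun ν : ℝ => 1 - pd x / (pd x + ν * pn x)) atTop (𝓝 (1 - 0)) :=
    tendsto_const_nhds.sub (tendsto_const_nhds.div_atTop h1)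
  rw [sub_zero] at h2
  refine h2.congr' ?_
  filter_upwards [h1.eventually_gt_atTop 0] with ν hν
  unfold misclass
  field_simp
  ring

/-- Dominated convergence, as `w ≤ 1` and `w → 1` wherever the noise is positive; elsewhere, up to a
null set, the integrand is zero by admissibility. -/
theorem tendsto_scoreCov_misclass (hreg : RegularModel μ p Θ β₀) (hn : IsNoise μ p β₀ pn) :
    Tendsto (fun ν : ℝ => scoreCov μ p β₀ (misclass (p β₀) pn ν)) atTop (𝓝 (fisher μ p β₀)) := by
  refine tendsto_pi_nhds.2 fun i => tendsto_pi_nhds.2 fun j => ?_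
  refine tendsto_integral_filter_of_dominated_convergence
    (fun x => |score p β₀ x i * score p β₀ x j| * p β₀ x) ?_ ?_ ?_ ?_
  · refine Eventually.of_forall fun ν => Measurable.aestronglyMeasurable ?_
    exact ((measurable_misclass (hreg.measurable_apply β₀) hn.measurable ν).mul
      ((hreg.measurable_score_apply i).mul (hreg.measurable_score_apply j))).mul
        (hreg.measurable_apply β₀)
  · filter_upwards [eventually_gt_atTop 0] with ν hν
    refine Eventually.of_forall fun x => ?_
    rw [norm_mul, norm_mul, Real.norm_of_nonneg (hreg.data_nonneg x)]
    refine mul_le_mul_of_nonneg_right ?_ (hreg.data_nonneg x)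
    exact mul_le_of_le_one_left (norm_nonneg _)
      (abs_misclass_le (hreg.data_nonneg x) (hn.nonneg x) hν)
  · have := (hreg.integrable_score_mul_score (u := fun _ => 1) measurable_const
      (C := 1) (by simp) i j).abs
    refine this.congr (Eventually.of_forall fun x => ?_)
    simp only [one_mul, abs_mul, abs_of_nonneg (hreg.data_nonneg x)]
  · filter_upwards [hn.pos] with x hx
    by_cases hp : p β₀ x = 0
    · simp [hp]
    by_cases hs : score p β₀ x = 0
    · simp [hs]
    exact ((tendsto_misclass (hx hp hs)).mul_const _).mul_const _

theorem scoreCov_misclass_posDef (hreg : RegularModel μ p Θ β₀) (hn : IsNoise μ p β₀ pn) {ν : ℝ}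
    (hν : 0 < ν) : (scoreCov μ p β₀ (misclass (p β₀) pn ν)).PosDef := by
  refine hreg.scoreCov_posDef (measurable_misclass (hreg.measurable_apply β₀) hn.measurable ν)
    (C := 1) (fun x => abs_misclass_le (hreg.data_nonneg x) (hn.nonneg x) hν)
    (fun x => (misclass_mem (hreg.data_nonneg x) (hn.nonneg x) hν).1) ?_
  filter_upwards [hn.pos] with x hx hp hs
  exact misclass_pos (hreg.data_nonneg x) (hx hp hs) hν

/-- The weight `ν (1 - w)`, which increases to `p_d / pₙ` with `ν`. -/
def _root_.NCE.dataWeight (pd pn : X → ℝ) (ν : ℝ) (x : X) : ℝ :=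
  ν * (1 - misclass pd pn ν x)

theorem dataWeight_nonneg (hreg : RegularModel μ p Θ β₀) (hn : IsNoise μ p β₀ pn) {ν : ℝ}
    (hν : 0 < ν) (x : X) : 0 ≤ dataWeight (p β₀) pn ν x :=
  mul_nonneg hν.le (sub_nonneg.2 (misclass_mem (hreg.data_nonneg x) (hn.nonneg x) hν).2)

theorem abs_dataWeight_le (hreg : RegularModel μ p Θ β₀) (hn : IsNoise μ p β₀ pn) {ν : ℝ}
    (hν : 0 < ν) (x : X) : |dataWeight (p β₀) pn ν x| ≤ ν := by
  rw [abs_of_nonneg (hreg.dataWeight_nonneg hn hν x)]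
  have := (misclass_mem (hreg.data_nonneg x) (hn.nonneg x) hν).1
  unfold dataWeight
  nlinarith

theorem measurable_dataWeight (hreg : RegularModel μ p Θ β₀) (hn : IsNoise μ p β₀ pn) (ν : ℝ) :
    Measurable (dataWeight (p β₀) pn ν) :=
  ((measurable_misclass (hreg.measurable_apply β₀) hn.measurable ν).const_sub 1).const_mul ν

theorem scoreCov_dataWeight (hreg : RegularModel μ p Θ β₀) (hn : IsNoise μ p β₀ pn) {ν : ℝ}
    (hν : 0 < ν) : scoreCov μ p β₀ (dataWeight (p β₀) pn ν) =
      ν • (fisher μ p β₀ - scoreCov μ p β₀ (misclass (p β₀) pn ν)) := by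
  ext i j
  have h1 := hreg.integrable_score_mul_score (u := fun _ => 1) measurable_const (C := 1)
    (by simp) i j
  have h2 := hreg.integrable_score_mul_score
    (measurable_misclass (hreg.measurable_apply β₀) hn.measurable ν) (C := 1)
    (fun x => abs_misclass_le (hreg.data_nonneg x) (hn.nonneg x) hν) i j
  simp only [Matrix.smul_apply, Matrix.sub_apply, fisher, scoreCov, of_apply, smul_eq_mul]
  rw [← integral_sub h1 h2, ← integral_const_mul]
  refine integral_congr_ae (Eventually.of_forall fun x => ?_)
  simp only [dataWeight]
  ring

theorem scoreMean_dataWeight (hreg : RegularModel μ p Θ β₀) (hn : IsNoise μ p β₀ pn) {ν : ℝ}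
    (hν : 0 < ν) : scoreMean μ p β₀ (dataWeight (p β₀) pn ν) =
      ν • (scoreMean μ p β₀ (fun _ => 1) - scoreMean μ p β₀ (misclass (p β₀) pn ν)) := by
  ext i
  have h1 := hreg.integrable_score_apply (u := fun _ => 1) measurable_const (C := 1) (by simp) i
  have h2 := hreg.integrable_score_apply
    (measurable_misclass (hreg.measurable_apply β₀) hn.measurable ν) (C := 1)
    (fun x => abs_misclass_le (hreg.data_nonneg x) (hn.nonneg x) hν) i
  simp only [Pi.smul_apply, Pi.sub_apply, scoreMean, smul_eq_mul]
  rw [← integral_sub h1 h2, ← integral_const_mul]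
  refine integral_congr_ae (Eventually.of_forall fun x => ?_)
  simp only [dataWeight]
  ring

/-- The trace of `I⁻¹ E_d[ν (1 - w) g gᵀ]`. -/
def _root_.NCE.weightTrace (μ : Measure X) (p : EuclideanSpace ℝ ι → X → ℝ)
    (β₀ : EuclideanSpace ℝ ι) (pn : X → ℝ) (ν : ℝ) : ℝ :=
  ∫ x, dataWeight (p β₀) pn ν x * quadForm (fisher μ p β₀)⁻¹ (score p β₀ x) * p β₀ x ∂μ

theorem weightTrace_nonneg (hreg : RegularModel μ p Θ β₀) (hn : IsNoise μ p β₀ pn) {ν : ℝ}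
    (hν : 0 < ν) : 0 ≤ weightTrace μ p β₀ pn ν :=
  integral_nonneg fun x => mul_nonneg (mul_nonneg (hreg.dataWeight_nonneg hn hν x)
    (quadForm_nonneg hreg.fisher_posDef.inv.posSemidef _)) (hreg.data_nonneg x)

theorem exists_norm_sq_le_quadForm (hreg : RegularModel μ p Θ β₀) :
    ∃ c > 0, ∀ u, ‖u‖ ^ 2 ≤ c * quadForm (fisher μ p β₀)⁻¹ u := by
  obtain ⟨c, hc, h⟩ := exists_pos_le_quadForm hreg.fisher_posDef.inv
  refine ⟨c⁻¹, inv_pos.2 hc, fun u => ?_⟩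
  rw [← div_eq_inv_mul, le_div_iff₀ hc, mul_comm]
  exact h u

/-- Cauchy-Schwarz for the mean score. -/
theorem scoreMean_sq_le (hreg : RegularModel μ p Θ β₀) {u : X → ℝ} {C : ℝ} (hu : Measurable u)
    (hb : ∀ x, |u x| ≤ C) (h0 : ∀ x, 0 ≤ u x) (i : ι) :
    scoreMean μ p β₀ u i ^ 2 ≤
      (∫ x, ({x | score p β₀ x ≠ 0}.indicator u x) * p β₀ x ∂μ) * scoreCov μ p β₀ u i i := by
  have hset : MeasurableSet {x | score p β₀ x ≠ 0} :=
    (hreg.measurable_score (measurableSet_singleton 0)).compl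
  have ha := hreg.integrable_mul_data (hu.indicator hset) (C := C) fun x => by
    by_cases h : x ∈ {x | score p β₀ x ≠ 0}
    · rw [Set.indicator_of_mem h]; exact hb x
    · rw [Set.indicator_of_notMem h]; simpa using (abs_nonneg _).trans (hb x)
  have hn := hreg.integrable_score_apply hu hb i
  have hc := hreg.integrable_score_mul_score hu hb i i
  -- The quadratic in `t` is the integral of `u p_d (t - g_i)²` over `{g ≠ 0}`; its discriminant is
  -- the claim. Restricting to `{g ≠ 0}` matters later: the noise is known to be positive only
  -- there.
  have hquad : ∀ t : ℝ, 0 ≤ (∫ x, ({x | score p β₀ x ≠ 0}.indicator u x) * p β₀ x ∂μ) * (t * t) +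
      (-2 * scoreMean μ p β₀ u i) * t + scoreCov μ p β₀ u i i := by
    intro t
    have : (∫ x, ({x | score p β₀ x ≠ 0}.indicator u x) * p β₀ x ∂μ) * (t * t) +
      (-2 * scoreMean μ p β₀ u i) * t + scoreCov μ p β₀ u i i =
      ∫ x, (({x | score p β₀ x ≠ 0}.indicator u x * p β₀ x * (t * t) +
        -2 * t * (u x * score p β₀ x i * p β₀ x)) +
          u x * (score p β₀ x i * score p β₀ x i) * p β₀ x) ∂μ := by
      refine Eq.symm ((integral_add ((ha.mul_const _).add (hn.const_mul _)) hc).trans ?_)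
      congr 1
      refine (integral_add (ha.mul_const _) (hn.const_mul _)).trans ?_
      rw [integral_mul_const, integral_const_mul]
      congr 1
      simp only [scoreMean]
      ring
    rw [this]
    refine integral_nonneg fun x => ?_
    by_cases h : x ∈ {x | score p β₀ x ≠ 0}
    · simp only [Set.indicator_of_mem h, Pi.zero_apply]
      have : u x * p β₀ x * (t * t) + -2 * t * (u x * score p β₀ x i * p β₀ x) +
          u x * (score p β₀ x i * score p β₀ x i) * p β₀ x =
          u x * p β₀ x * (t - score p β₀ x i) ^ 2 := by ring
      rw [this]
      exact mul_nonneg (mul_nonneg (h0 x) (hreg.data_nonneg x)) (sq_nonneg _)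
    · have hs : score p β₀ x = 0 := by simpa using h
      simp [hs]
  have := discrim_le_zero hquad
  simp only [discrim] at this
  nlinarith

/-- The quotient is `E_d[(1 - w) 1_{g ≠ 0}]`, and `w → 1` almost everywhere on the part of the
support where `g ≠ 0`. Without the indicator, data points out of reach of the noise could keep it
away from zero. -/
theorem tendsto_integral_dataWeight_div (hreg : RegularModel μ p Θ β₀) (hn : IsNoise μ p β₀ pn) :
    Tendsto (fun ν : ℝ => (∫ x, ({x | score p β₀ x ≠ 0}.indicator
      (dataWeight (p β₀) pn ν) x) * p β₀ x ∂μ) / ν) atTop (𝓝 0) := by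
  have hset : MeasurableSet {x | score p β₀ x ≠ 0} :=
    (hreg.measurable_score (measurableSet_singleton 0)).compl
  have h1 : Tendsto (fun ν : ℝ => ∫ x, ({x | score p β₀ x ≠ 0}.indicator
      (fun x => 1 - misclass (p β₀) pn ν x) x) * p β₀ x ∂μ) atTop (𝓝 (∫ x, (0 : ℝ) ∂μ)) := by
    refine tendsto_integral_filter_of_dominated_convergence (p β₀) ?_ ?_ hreg.integrable_data ?_
    · refine Eventually.of_forall fun ν => Measurable.aestronglyMeasurable ?_
      exact (((measurable_misclass (hreg.measurable_apply β₀) hn.measurable ν).const_sub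
        1).indicator hset).mul (hreg.measurable_apply β₀)
    · filter_upwards [eventually_gt_atTop 0] with ν hν
      refine Eventually.of_forall fun x => ?_
      rw [norm_mul, Real.norm_of_nonneg (hreg.data_nonneg x)]
      refine mul_le_of_le_one_left (hreg.data_nonneg x) ?_
      have := misclass_mem (hreg.data_nonneg x) (hn.nonneg x) hν
      by_cases h : x ∈ {x | score p β₀ x ≠ 0}
      · rw [Set.indicator_of_mem h, Real.norm_eq_abs, abs_le]; constructor <;> linarith
      · rw [Set.indicator_of_notMem h]; simp
    · filter_upwards [hn.pos] with x hx
      by_cases hp : p β₀ x = 0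
      · simp [hp]
      by_cases h : x ∈ {x | score p β₀ x ≠ 0}
      · simp only [Set.indicator_of_mem h]
        have := ((tendsto_const_nhds (x := (1 : ℝ))).sub
          (tendsto_misclass (pd := p β₀) (hx hp h))).mul_const (p β₀ x)
        simpa using this
      · simp [Set.indicator_of_notMem h]
  rw [integral_zero] at h1
  refine h1.congr' ?_
  filter_upwards [eventually_gt_atTop 0] with ν hν
  rw [eq_div_iff hν.ne', ← integral_mul_const]
  refine integral_congr_ae (Eventually.of_forall fun x => ?_)
  by_cases h : x ∈ {x | score p β₀ x ≠ 0}
  · simp only [Set.indicator_of_mem h, dataWeight]; ring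
  · simp [Set.indicator_of_notMem h]

end RegularModel

/-! ### Separating the noise-dependent part of the error -/

namespace RegularModel

variable {X : Type*} [MeasurableSpace X] {μ : Measure X}
  {ι : Type*} [Fintype ι] [DecidableEq ι]
  {p : EuclideanSpace ℝ ι → X → ℝ} {Θ : Set (EuclideanSpace ℝ ι)} {β₀ : EuclideanSpace ℝ ι}
  {pn : X → ℝ}

/-- `m_wᵀ I_w⁻¹ I I_w⁻¹ m_w`. -/
def _root_.NCE.meanTerm (μ : Measure X) (p : EuclideanSpace ℝ ι → X → ℝ)
    (β₀ : EuclideanSpace ℝ ι) (pn : X → ℝ) (ν : ℝ) : ℝ :=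
  let W := scoreCov μ p β₀ (misclass (p β₀) pn ν)
  quadForm (W⁻¹ * fisher μ p β₀ * W⁻¹)
    (WithLp.toLp 2 (scoreMean μ p β₀ (misclass (p β₀) pn ν)))

/-- `mᵀ I⁻¹ m`. -/
def _root_.NCE.meanQuad (μ : Measure X) (p : EuclideanSpace ℝ ι → X → ℝ)
    (β₀ : EuclideanSpace ℝ ι) : ℝ :=
  scoreMean μ p β₀ (fun _ => 1) ⬝ᵥ ((fisher μ p β₀)⁻¹ *ᵥ scoreMean μ p β₀ fun _ => 1)

/-- The noise-dependent part of `(ν + 1) tr (Σ I)`. -/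
def _root_.NCE.noisePart (μ : Measure X) (p : EuclideanSpace ℝ ι → X → ℝ)
    (β₀ : EuclideanSpace ℝ ι) (pn : X → ℝ) (ν : ℝ) : ℝ :=
  (1 + 1 / ν) * ((scoreCov μ p β₀ (misclass (p β₀) pn ν))⁻¹ *
      scoreCov μ p β₀ (dataWeight (p β₀) pn ν)).trace +
    ((ν + 2) * meanQuad μ p β₀ - (ν + 2 + 1 / ν) * meanTerm μ p β₀ pn ν)

/-- Substituting `I = I_w + J / ν`, with `J` the second moment for the weight `ν (1 - w)`, extracts
`d` from `tr (I_w⁻¹ I)`; the rank-one part gives the factor `(ν + 1) (1 + 1/ν) = ν + 2 + 1/ν`. -/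
theorem trace_asympCov_mul_fisher (hreg : RegularModel μ p Θ β₀) (hn : IsNoise μ p β₀ pn) {ν : ℝ}
    (hν : 0 < ν) :
    (ν + 1) * (asympCov μ p β₀ pn ν * fisher μ p β₀).trace =
      (ν + 1) * Fintype.card ι + (1 + 1 / ν) * ((scoreCov μ p β₀ (misclass (p β₀) pn ν))⁻¹ *
      scoreCov μ p β₀ (dataWeight (p β₀) pn ν)).trace -
      (ν + 2 + 1 / ν) * meanTerm μ p β₀ pn ν := by
  have hW := hreg.scoreCov_misclass_posDef hn hν
  have hJ := hreg.scoreCov_dataWeight hn hν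
  simp only [asympCov, meanTerm]
  set W := scoreCov μ p β₀ (misclass (p β₀) pn ν)
  set v := scoreMean μ p β₀ (misclass (p β₀) pn ν)
  set A := fisher μ p β₀
  have hdet : IsUnit W.det := (Matrix.isUnit_iff_isUnit_det W).1 hW.isUnit
  have hsymm : v ᵥ* W⁻¹ = W⁻¹ *ᵥ v := by
    have h1 : (W⁻¹)ᵀ = W⁻¹ := by simpa using hW.inv.isHermitian.eq
    rw [← Matrix.vecMul_transpose, h1]
  have e1 : (W⁻¹ * scoreCov μ p β₀ (dataWeight (p β₀) pn ν)).trace =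
      ν * ((W⁻¹ * A).trace - Fintype.card ι) := by
    rw [hJ, Matrix.mul_smul, Matrix.trace_smul, Matrix.mul_sub, Matrix.nonsing_inv_mul W hdet,
      Matrix.trace_sub, Matrix.trace_one, smul_eq_mul]
  have e2 : (W⁻¹ * vecMulVec v v * W⁻¹ * A).trace = quadForm (W⁻¹ * A * W⁻¹) (WithLp.toLp 2 v) := by
    rw [Matrix.mul_vecMulVec, Matrix.mul_assoc, Matrix.vecMulVec_mul, Matrix.trace_vecMulVec,
      ← Matrix.vecMul_vecMul, hsymm, quadForm, ← Matrix.mulVec_mulVec, dotProduct_mulVec,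
      ← Matrix.vecMul_vecMul, dotProduct_comm]
    simp only [hsymm]
  rw [e1, Matrix.sub_mul, Matrix.trace_sub, Matrix.smul_mul, Matrix.trace_smul, e2, smul_eq_mul]
  field_simp
  ring

theorem klError_sub_noiseFreePart (hreg : RegularModel μ p Θ β₀) (hn : IsNoise μ p β₀ pn)
    {T ν : ℝ} (hν : 0 < ν) :
    klError μ p β₀ T ν pn - noiseFreePart μ p β₀ T ν =
      1 / (2 * T) * (noisePart μ p β₀ pn ν - (∫ x, p β₀ x * w₃ μ p β₀ x ∂μ) ^ 2) := by
  have h := hreg.trace_asympCov_mul_fisher hn hν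
  simp only [klError, noiseFreePart, noisePart]
  have e : (ν + 1) / (2 * T) * (asympCov μ p β₀ pn ν * fisher μ p β₀).trace =
      1 / (2 * T) * ((ν + 1) * (asympCov μ p β₀ pn ν * fisher μ p β₀).trace) := by ring
  rw [e, h]
  simp only [meanQuad]
  ring

/-- The difference integrates the quadratic form of `I_w⁻¹ - I⁻¹` at the score. Its entries tend to
zero, so it is pointwise at most `ε` times the form of `I⁻¹`, and the positive weight preserves
this. The bound is relative, hence valid even if `weightTrace` is unbounded. -/
theorem trace_sub_weightTrace_isLittleO (hreg : RegularModel μ p Θ β₀) (hn : IsNoise μ p β₀ pn) :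
    (fun ν => ((scoreCov μ p β₀ (misclass (p β₀) pn ν))⁻¹ *
      scoreCov μ p β₀ (dataWeight (p β₀) pn ν)).trace - weightTrace μ p β₀ pn ν)
      =o[atTop] weightTrace μ p β₀ pn := by
  obtain ⟨c, hc, hcu⟩ := hreg.exists_norm_sq_le_quadForm
  have hinv := tendsto_matrix_inv (hreg.tendsto_scoreCov_misclass hn) hreg.fisher_det
  have hδ : Tendsto (fun ν : ℝ => (∑ i, ∑ j, |((scoreCov μ p β₀ (misclass (p β₀) pn ν))⁻¹ -
      (fisher μ p β₀)⁻¹) i j|) * c) atTop (𝓝 0) := by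
    have h1 : Tendsto (fun ν : ℝ => (∑ i, ∑ j, |((scoreCov μ p β₀ (misclass (p β₀) pn ν))⁻¹ -
      (fisher μ p β₀)⁻¹) i j|) * c) atTop (𝓝 ((∑ i : ι, ∑ j : ι, |(0 : ℝ)|) * c)) := by
      refine Tendsto.mul_const _ (tendsto_finsetSum _ fun i _ => tendsto_finsetSum _ fun j _ => ?_)
      refine Tendsto.abs ?_
      have h2 := tendsto_pi_nhds.1 (tendsto_pi_nhds.1 hinv i) j
      simpa using h2.sub_const ((fisher μ p β₀)⁻¹ i j)
    simpa using h1
  refine Asymptotics.isLittleO_iff.2 fun ε hε => ?_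
  filter_upwards [eventually_gt_atTop 0, hδ.eventually (gt_mem_nhds hε)] with ν hν hδν
  have hm := hreg.measurable_dataWeight hn ν
  have hb := hreg.abs_dataWeight_le hn hν
  rw [hreg.trace_mul_scoreCov _ hm hb]
  have hI1 := hreg.integrable_quadForm_score (scoreCov μ p β₀ (misclass (p β₀) pn ν))⁻¹ hm hb
  have hI2 := hreg.integrable_quadForm_score (fisher μ p β₀)⁻¹ hm hb
  rw [Real.norm_of_nonneg (hreg.weightTrace_nonneg hn hν), weightTrace, ← integral_sub hI1 hI2,
    ← integral_const_mul]
  refine (norm_integral_le_integral_norm _).trans (integral_mono (hI1.sub hI2).norm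
    (hI2.const_mul ε) fun x => ?_)
  have h0 := mul_nonneg (hreg.dataWeight_nonneg hn hν x) (hreg.data_nonneg x)
  have e : dataWeight (p β₀) pn ν x *
        quadForm (scoreCov μ p β₀ (misclass (p β₀) pn ν))⁻¹ (score p β₀ x) * p β₀ x -
      dataWeight (p β₀) pn ν x * quadForm (fisher μ p β₀)⁻¹ (score p β₀ x) * p β₀ x =
      (dataWeight (p β₀) pn ν x * p β₀ x) *
        quadForm ((scoreCov μ p β₀ (misclass (p β₀) pn ν))⁻¹ - (fisher μ p β₀)⁻¹)
          (score p β₀ x) := by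
    rw [quadForm_sub]; ring
  simp only [e, norm_mul (_ * _), Real.norm_of_nonneg h0]
  have h1 := abs_quadForm_le ((scoreCov μ p β₀ (misclass (p β₀) pn ν))⁻¹ - (fisher μ p β₀)⁻¹)
    (score p β₀ x)
  have h2 : |quadForm ((scoreCov μ p β₀ (misclass (p β₀) pn ν))⁻¹ - (fisher μ p β₀)⁻¹)
      (score p β₀ x)| ≤ ε * quadForm (fisher μ p β₀)⁻¹ (score p β₀ x) := by
    refine h1.trans ((mul_le_mul_of_nonneg_left (hcu _) ?_).trans ?_)
    · exact Finset.sum_nonneg fun i _ => Finset.sum_nonneg fun j _ => abs_nonneg _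
    · rw [← mul_assoc]
      exact mul_le_mul_of_nonneg_right hδν.le
        (quadForm_nonneg hreg.fisher_posDef.inv.posSemidef _)
  rw [Real.norm_eq_abs]
  nlinarith [mul_le_mul_of_nonneg_left h2 h0]

theorem scoreCov_dataWeight_apply_self_le (hreg : RegularModel μ p Θ β₀)
    (hn : IsNoise μ p β₀ pn) {c ν : ℝ} (hν : 0 < ν)
    (hcu : ∀ u, ‖u‖ ^ 2 ≤ c * quadForm (fisher μ p β₀)⁻¹ u) (i : ι) :
    scoreCov μ p β₀ (dataWeight (p β₀) pn ν) i i ≤ c * weightTrace μ p β₀ pn ν := by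
  have hm := hreg.measurable_dataWeight hn ν
  have hb := hreg.abs_dataWeight_le hn hν
  rw [weightTrace, ← integral_const_mul]
  refine integral_mono (hreg.integrable_score_mul_score hm hb i i)
    ((hreg.integrable_quadForm_score _ hm hb).const_mul c) fun x => ?_
  have h0 := mul_nonneg (hreg.dataWeight_nonneg hn hν x) (hreg.data_nonneg x)
  have h1 := (sq_le_sq' (neg_le_of_abs_le (abs_apply_le_norm (score p β₀ x) i))
    (le_of_abs_le (abs_apply_le_norm (score p β₀ x) i))).trans (hcu (score p β₀ x))
  simp only
  nlinarith [mul_le_mul_of_nonneg_left h1 h0]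

/-- With `m = 0`, `m_w` is `-1/ν` times the mean score for the weight `ν (1 - w)`. Cauchy-Schwarz
bounds its square by `E_d[ν (1 - w) 1_{g ≠ 0}] / ν²`, which is `o(1/ν)`, times a multiple of
`weightTrace`. This beats the factor of order `ν` in front. -/
theorem meanTerm_isLittleO (hreg : RegularModel μ p Θ β₀) (hn : IsNoise μ p β₀ pn)
    (hm0 : scoreMean μ p β₀ (fun _ => 1) = 0) :
    (fun ν => (ν + 2 + 1 / ν) * meanTerm μ p β₀ pn ν) =o[atTop] weightTrace μ p β₀ pn := by
  obtain ⟨c, hc, hcu⟩ := hreg.exists_norm_sq_le_quadForm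
  have hinv := tendsto_matrix_inv (hreg.tendsto_scoreCov_misclass hn) hreg.fisher_det
  set B : ℝ → ℝ := fun ν => ∑ i, ∑ j, |((scoreCov μ p β₀ (misclass (p β₀) pn ν))⁻¹ *
    fisher μ p β₀ * (scoreCov μ p β₀ (misclass (p β₀) pn ν))⁻¹) i j| with hBdef
  have hB : Tendsto B atTop (𝓝 (∑ i, ∑ j, |((fisher μ p β₀)⁻¹ *
      fisher μ p β₀ * (fisher μ p β₀)⁻¹) i j|)) := by
    refine tendsto_finsetSum _ fun i _ => tendsto_finsetSum _ fun j _ => Tendsto.abs ?_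
    exact tendsto_pi_nhds.1 (tendsto_pi_nhds.1
      ((hinv.mul tendsto_const_nhds).mul hinv) i) j
  set a : ℝ → ℝ := fun ν => (∫ x, ({x | score p β₀ x ≠ 0}.indicator
      (dataWeight (p β₀) pn ν) x) * p β₀ x ∂μ) / ν with ha
  have hlim : Tendsto (fun ν => 4 * B ν * Fintype.card ι * c * a ν) atTop (𝓝 0) := by
    simpa using (((hB.const_mul 4).mul_const (Fintype.card ι : ℝ)).mul_const c).mul
      (hreg.tendsto_integral_dataWeight_div hn)
  refine Asymptotics.isLittleO_iff.2 fun ε hε => ?_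
  filter_upwards [eventually_ge_atTop 1, hlim.eventually (gt_mem_nhds hε)] with ν hν1 hsmall
  have hν : 0 < ν := by linarith
  have hτ := hreg.weightTrace_nonneg hn hν
  have hB0 : 0 ≤ B ν := Finset.sum_nonneg fun i _ => Finset.sum_nonneg fun j _ => abs_nonneg _
  have ha0 : 0 ≤ a ν := div_nonneg (integral_nonneg fun x => mul_nonneg
    (Set.indicator_nonneg (fun x _ => hreg.dataWeight_nonneg hn hν x) x) (hreg.data_nonneg x)) hν.le
  have hmean : ∀ i, scoreMean μ p β₀ (misclass (p β₀) pn ν) i ^ 2 ≤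
      (a ν / ν) * (c * weightTrace μ p β₀ pn ν) := fun i => by
    have h1 := congrFun (hreg.scoreMean_dataWeight hn hν) i
    rw [hm0] at h1
    simp only [zero_sub, Pi.smul_apply, Pi.neg_apply, smul_eq_mul] at h1
    have h2 := hreg.scoreMean_sq_le (hreg.measurable_dataWeight hn ν)
      (hreg.abs_dataWeight_le hn hν) (hreg.dataWeight_nonneg hn hν) i
    rw [h1] at h2
    have h3 := hreg.scoreCov_dataWeight_apply_self_le hn hν hcu i
    have h4 : ∫ x, ({x | score p β₀ x ≠ 0}.indicator
      (dataWeight (p β₀) pn ν) x) * p β₀ x ∂μ = a ν * ν := by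
      rw [ha]; field_simp
    rw [h4] at h2
    have h5 := h2.trans (mul_le_mul_of_nonneg_left h3 (mul_nonneg ha0 hν.le))
    have h6 : a ν / ν * (c * weightTrace μ p β₀ pn ν) =
      (a ν * ν * (c * weightTrace μ p β₀ pn ν)) / ν ^ 2 := by field_simp
    rw [h6, le_div_iff₀ (by positivity)]
    linarith
  have hnorm : ‖(WithLp.toLp 2 (scoreMean μ p β₀ (misclass (p β₀) pn ν)) :
      EuclideanSpace ℝ ι)‖ ^ 2 ≤ Fintype.card ι * ((a ν / ν) * (c * weightTrace μ p β₀ pn ν)) := by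
    rw [EuclideanSpace.norm_sq_eq]
    refine (Finset.sum_le_sum fun i _ => ?_ : _ ≤ ∑ _i : ι, (a ν / ν) *
      (c * weightTrace μ p β₀ pn ν)).trans_eq (by simp)
    simpa using hmean i
  have hM : |meanTerm μ p β₀ pn ν| ≤
      B ν * (Fintype.card ι * ((a ν / ν) * (c * weightTrace μ p β₀ pn ν))) :=
    (abs_quadForm_le _ _).trans (mul_le_mul_of_nonneg_left hnorm hB0)
  -- For `ν ≥ 1`, both `2` and `1 / ν` are absorbed by `3 ν`; this is the origin of the factor `4`
  -- in `hlim`.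
  have hcoef : ν + 2 + 1 / ν ≤ 4 * ν := by
    have : 1 / ν ≤ 1 := by rw [div_le_one hν]; exact hν1
    linarith
  rw [Real.norm_of_nonneg hτ, norm_mul, Real.norm_of_nonneg (by positivity), Real.norm_eq_abs]
  calc (ν + 2 + 1 / ν) * |meanTerm μ p β₀ pn ν| ≤
      (4 * ν) * (B ν * (Fintype.card ι * ((a ν / ν) * (c * weightTrace μ p β₀ pn ν)))) :=
        mul_le_mul hcoef hM (abs_nonneg _) (by positivity)
    _ = (4 * B ν * Fintype.card ι * c * a ν) * weightTrace μ p β₀ pn ν := by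
        field_simp
    _ ≤ ε * weightTrace μ p β₀ pn ν := mul_le_mul_of_nonneg_right hsmall.le hτ

/-- For every weight with invertible second moment, `I_u⁻¹ m_u = v`. Both quantities thus reduce to
`vᵀ I v = E_d[⟨g, v⟩²] = 1`. -/
theorem inner_eq_one_identities (hreg : RegularModel μ p Θ β₀) (hn : IsNoise μ p β₀ pn)
    {v : EuclideanSpace ℝ ι} (hv : ∀ x, p β₀ x ≠ 0 → inner ℝ (score p β₀ x) v = 1) :
    meanQuad μ p β₀ = 1 ∧ ∀ ν : ℝ, 0 < ν → meanTerm μ p β₀ pn ν = 1 := by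
  have hquad : quadForm (fisher μ p β₀) v = 1 := by
    rw [fisher, hreg.quadForm_scoreCov measurable_const (C := 1) (by simp)]
    refine (integral_congr_ae (Eventually.of_forall fun x => ?_)).trans hreg.integral_data
    by_cases hx : p β₀ x = 0
    · simp [hx]
    · simp [hv x hx]
  have hgen : ∀ {u : X → ℝ}, Measurable u → (∀ x, |u x| ≤ 1) →
      IsUnit (scoreCov μ p β₀ u).det →
      (scoreCov μ p β₀ u)⁻¹ *ᵥ scoreMean μ p β₀ u = fun i => v i := fun hu hb hdet => by
    rw [hreg.scoreMean_eq_mulVec hv hu hb, mulVec_mulVec, nonsing_inv_mul _ hdet, one_mulVec]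
  refine ⟨?_, fun ν hν => ?_⟩
  · have h1 := hgen (u := fun _ => 1) measurable_const (by simp)
      hreg.fisher_det.isUnit
    have h2 := hreg.scoreMean_eq_mulVec hv (u := fun _ => 1) measurable_const (C := 1) (by simp)
    rw [meanQuad, fisher, h1, h2, dotProduct_comm]
    exact hquad
  · have hW := hreg.scoreCov_misclass_posDef hn hν
    have hdet := (Matrix.isUnit_iff_isUnit_det _).1 hW.isUnit
    have h1 := hgen (measurable_misclass (hreg.measurable_apply β₀) hn.measurable ν)
      (fun x => abs_misclass_le (hreg.data_nonneg x) (hn.nonneg x) hν) hdet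
    have hsymm : ((scoreCov μ p β₀ (misclass (p β₀) pn ν))⁻¹)ᵀ =
        (scoreCov μ p β₀ (misclass (p β₀) pn ν))⁻¹ := by simpa using hW.inv.isHermitian.eq
    rw [meanTerm, quadForm, ← mulVec_mulVec, dotProduct_mulVec, ← vecMul_vecMul,
      ← dotProduct_mulVec]
    simp only [h1]
    rw [← mulVec_transpose, hsymm, h1]
    exact hquad

/-- The comparison function `1 + weightTrace` absorbs both kinds of error: relative ones, and the
additive `-1 / ν` left by the mean term of an unnormalized model. -/
theorem noisePart_sub_isLittleO (hreg : RegularModel μ p Θ β₀)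
    (hmodel : IsNormalized μ p Θ ∨ IsUnnormalized p Θ) (hn : IsNoise μ p β₀ pn) :
    (fun ν => noisePart μ p β₀ pn ν - weightTrace μ p β₀ pn ν) =o[atTop]
      fun ν => 1 + weightTrace μ p β₀ pn ν := by
  have hτle : weightTrace μ p β₀ pn =O[atTop] fun ν => 1 + weightTrace μ p β₀ pn ν := by
    refine Asymptotics.IsBigO.of_bound 1 ?_
    filter_upwards [eventually_gt_atTop 0] with ν hν
    have := hreg.weightTrace_nonneg hn hν
    rw [Real.norm_of_nonneg this, Real.norm_of_nonneg (by linarith)]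
    linarith
  have h1le : (fun _ => (1 : ℝ)) =O[atTop] fun ν => 1 + weightTrace μ p β₀ pn ν := by
    refine Asymptotics.IsBigO.of_bound 1 ?_
    filter_upwards [eventually_gt_atTop 0] with ν hν
    have := hreg.weightTrace_nonneg hn hν
    rw [Real.norm_of_nonneg zero_le_one, Real.norm_of_nonneg (by linarith)]
    linarith
  have hinv0 : (fun ν : ℝ => 1 / ν) =o[atTop] fun _ => (1 : ℝ) :=
    (Asymptotics.isLittleO_one_iff ℝ).2 (tendsto_const_nhds.div_atTop tendsto_id)
  have hA := hreg.trace_sub_weightTrace_isLittleO hn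
  have hB : (fun ν => (1 / ν) * ((scoreCov μ p β₀ (misclass (p β₀) pn ν))⁻¹ *
      scoreCov μ p β₀ (dataWeight (p β₀) pn ν)).trace) =o[atTop] weightTrace μ p β₀ pn := by
    have h1 : (fun ν => ((scoreCov μ p β₀ (misclass (p β₀) pn ν))⁻¹ *
      scoreCov μ p β₀ (dataWeight (p β₀) pn ν)).trace) =O[atTop] weightTrace μ p β₀ pn := by
      simpa using hA.isBigO.add (Asymptotics.isBigO_refl (weightTrace μ p β₀ pn) atTop)
    simpa using hinv0.mul_isBigO h1
  have hC : (fun ν => (ν + 2) * meanQuad μ p β₀ - (ν + 2 + 1 / ν) * meanTerm μ p β₀ pn ν)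
      =o[atTop] fun ν => 1 + weightTrace μ p β₀ pn ν := by
    rcases hmodel with hN | hU
    · have hm0 := hreg.scoreMean_one_eq_zero hN
      have := (hreg.meanTerm_isLittleO hn hm0).trans_isBigO hτle
      have hq : meanQuad μ p β₀ = 0 := by simp [meanQuad, hm0]
      simpa [hq] using this
    · obtain ⟨v, hv⟩ := hreg.exists_inner_score_eq_one hU
      obtain ⟨hq, hM⟩ := hreg.inner_eq_one_identities hn hv
      refine Asymptotics.IsLittleO.trans_isBigO ?_ h1le
      refine hinv0.neg_left.congr' ?_ EventuallyEq.rfl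
      filter_upwards [eventually_gt_atTop 0] with ν hν
      rw [hq, hM ν hν]
      ring
  refine (((hA.add hB).trans_isBigO hτle).add hC).congr_left fun ν => ?_
  simp only [noisePart]
  ring

end RegularModel

/-! ### The chi-squared divergence -/

section ChiSq

variable {X : Type*} [MeasurableSpace X] {μ : Measure X} {f h : X → ℝ}

/-- For `b > 0` the gap is `(a - b)² / b`. For `b = 0` the quotient is `∞`, unless `a = 0` as well,
where `0 / 0 = 0` gives equality. -/
theorem two_mul_ofReal_le (a b : ℝ≥0∞) (ha : a ≠ ⊤) (hb : b ≠ ⊤) :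
    2 * a ≤ a ^ 2 / b + b ∧ (2 * a = a ^ 2 / b + b → b = a) := by
  rcases eq_or_ne b 0 with rfl | hb0
  · rcases eq_or_ne a 0 with rfl | ha0
    · simp
    · have : a ^ 2 / 0 = ⊤ := ENNReal.div_zero (pow_ne_zero 2 ha0)
      rw [this, top_add]
      refine ⟨le_top, fun h => absurd h (ENNReal.mul_ne_top (by simp) ha)⟩
  · lift a to ℝ≥0 using ha
    lift b to ℝ≥0 using hb
    have hb0' : b ≠ 0 := by simpa using hb0
    have hpos : (0 : ℝ) < b := lt_of_le_of_ne b.2 (fun h => hb0' (NNReal.eq h.symm))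
    have hident : (a : ℝ) ^ 2 / b + b - 2 * a = (a - b) ^ 2 / b := by field_simp; ring
    norm_cast
    rw [← NNReal.coe_le_coe, ← NNReal.coe_inj, ← NNReal.coe_inj]
    push_cast
    refine ⟨?_, fun he => ?_⟩
    · have : 0 ≤ ((a : ℝ) - b) ^ 2 / b := by positivity
      linarith
    · have h0 : ((a : ℝ) - b) ^ 2 / b = 0 := by linarith
      rw [div_eq_zero_iff, or_iff_left hpos.ne'] at h0
      have := pow_eq_zero_iff (two_ne_zero) |>.1 h0
      linarith

/-- Integration of `2 a ≤ a² / b + b`. It shows that the truncated subtraction in `chiSq` discards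
nothing. -/
theorem one_le_lintegral_sq_div (hf : Measurable f) (hh : Measurable h)
    (hf1 : ∫⁻ x, ENNReal.ofReal (f x) ∂μ = 1) (hh1 : ∫⁻ x, ENNReal.ofReal (h x) ∂μ = 1) :
    1 ≤ ∫⁻ x, ENNReal.ofReal (f x) ^ 2 / ENNReal.ofReal (h x) ∂μ := by
  have h1 : ∫⁻ x, 2 * ENNReal.ofReal (f x) ∂μ ≤
      ∫⁻ x, (ENNReal.ofReal (f x) ^ 2 / ENNReal.ofReal (h x) + ENNReal.ofReal (h x)) ∂μ :=
    lintegral_mono fun x => (two_mul_ofReal_le _ _ ENNReal.ofReal_ne_top ENNReal.ofReal_ne_top).1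
  rw [lintegral_add_right _ hh.ennreal_ofReal, lintegral_const_mul _ hf.ennreal_ofReal, hf1, hh1,
    mul_one, ← one_add_one_eq_two] at h1
  exact (ENNReal.add_le_add_iff_right ENNReal.one_ne_top).1 h1

/-- If the divergence vanishes, the integrated inequality `2 a ≤ a² / b + b` is an equality of
finite integrals, so it is an equality almost everywhere, which forces `a = b`. -/
theorem chiSq_eq_zero_iff (hf : Measurable f) (hh : Measurable h) (hf0 : ∀ x, 0 ≤ f x)
    (hh0 : ∀ x, 0 ≤ h x)
    (hf1 : ∫⁻ x, ENNReal.ofReal (f x) ∂μ = 1) (hh1 : ∫⁻ x, ENNReal.ofReal (h x) ∂μ = 1) :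
    chiSq μ f h = 0 ↔ h =ᵐ[μ] f := by
  rw [chiSq, tsub_eq_zero_iff_le]
  constructor
  · intro hle
    have h2 : ∫⁻ x, 2 * ENNReal.ofReal (f x) ∂μ = 2 := by
      rw [lintegral_const_mul _ hf.ennreal_ofReal, hf1, mul_one]
    have hae := ae_eq_of_ae_le_of_lintegral_le (μ := μ)
      (f := fun x => 2 * ENNReal.ofReal (f x))
      (g := fun x => ENNReal.ofReal (f x) ^ 2 / ENNReal.ofReal (h x) + ENNReal.ofReal (h x))
      (Eventually.of_forall fun x =>
        (two_mul_ofReal_le _ _ ENNReal.ofReal_ne_top ENNReal.ofReal_ne_top).1)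
      (by rw [h2]; simp)
      (((hf.ennreal_ofReal.pow_const 2).div hh.ennreal_ofReal).add hh.ennreal_ofReal).aemeasurable
      (by
        rw [h2, lintegral_add_right _ hh.ennreal_ofReal, hh1]
        exact (add_le_add_left hle 1).trans_eq one_add_one_eq_two)
    filter_upwards [hae] with x hx
    have := (two_mul_ofReal_le _ _ ENNReal.ofReal_ne_top ENNReal.ofReal_ne_top).2 hx
    exact (ENNReal.ofReal_eq_ofReal_iff (hh0 x) (hf0 x)).1 this
  · intro hae
    have : ∫⁻ x, ENNReal.ofReal (f x) ^ 2 / ENNReal.ofReal (h x) ∂μ ≤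
        ∫⁻ x, ENNReal.ofReal (f x) ∂μ := by
      refine lintegral_mono_ae ?_
      filter_upwards [hae] with x hx
      rw [hx]
      refine ENNReal.div_le_of_le_mul ?_
      rw [pow_two]
    exact this.trans hf1.le

end ChiSq

/-! ### The all-noise limit and the optimal noise -/

namespace RegularModel

variable {X : Type*} [MeasurableSpace X] {μ : Measure X}
  {ι : Type*} [Fintype ι] [DecidableEq ι]
  {p : EuclideanSpace ℝ ι → X → ℝ} {Θ : Set (EuclideanSpace ℝ ι)} {β₀ : EuclideanSpace ℝ ι}
  {pn : X → ℝ}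

theorem w₃_sq (hreg : RegularModel μ p Θ β₀) (x : X) :
    w₃ μ p β₀ x ^ 2 = quadForm (fisher μ p β₀)⁻¹ (score p β₀ x) :=
  Real.sq_sqrt (quadForm_nonneg hreg.fisher_posDef.inv.posSemidef _)

theorem w₃_nonneg (x : X) : 0 ≤ w₃ μ p β₀ x := Real.sqrt_nonneg _

theorem measurable_w₃ (hreg : RegularModel μ p Θ β₀) : Measurable (w₃ μ p β₀) :=
  ((continuous_quadForm _).measurable.comp hreg.measurable_score).sqrt

theorem w₃_pos (hreg : RegularModel μ p Θ β₀) {x : X} (hx : score p β₀ x ≠ 0) :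
    0 < w₃ μ p β₀ x :=
  Real.sqrt_pos.2 (quadForm_pos hreg.fisher_posDef.inv hx)

theorem integrable_data_mul_w₃ (hreg : RegularModel μ p Θ β₀) :
    Integrable (fun x => p β₀ x * w₃ μ p β₀ x) μ := by
  have := hreg.integrable_of_le_score_sq
    (C := 1 + ∑ i, ∑ j, |(fisher μ p β₀)⁻¹ i j|) hreg.measurable_w₃ fun x => ?_
  · exact this.congr (Eventually.of_forall fun x => mul_comm _ _)
  · rw [abs_of_nonneg (w₃_nonneg x)]
    have h1 := hreg.w₃_sq x
    have h2 := (le_abs_self _).trans (abs_quadForm_le (fisher μ p β₀)⁻¹ (score p β₀ x))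
    have h3 : 0 ≤ ∑ i, ∑ j, |(fisher μ p β₀)⁻¹ i j| :=
      Finset.sum_nonneg fun i _ => Finset.sum_nonneg fun j _ => abs_nonneg _
    nlinarith [sq_nonneg (w₃ μ p β₀ x - 1), sq_nonneg ‖score p β₀ x‖, w₃_nonneg (μ := μ) (p := p) (β₀ := β₀) x]

/-- If `Z` were zero, the score would vanish almost everywhere on the support, and so would the
Fisher form at a basis vector; one exists because there is at least one parameter. -/
theorem integral_data_mul_w₃_pos [Nonempty ι] (hreg : RegularModel μ p Θ β₀) :
    0 < ∫ x, p β₀ x * w₃ μ p β₀ x ∂μ := by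
  have h0 : ∀ x, 0 ≤ p β₀ x * w₃ μ p β₀ x := fun x => mul_nonneg (hreg.data_nonneg x) (w₃_nonneg x)
  refine lt_of_le_of_ne (integral_nonneg h0) fun heq => ?_
  rw [eq_comm, integral_eq_zero_iff_of_nonneg h0 hreg.integrable_data_mul_w₃] at heq
  let i : ι := Classical.arbitrary ι
  have h3 := quadForm_pos hreg.fisher_posDef (u := EuclideanSpace.single i (1 : ℝ)) (by simp)
  rw [fisher, hreg.quadForm_scoreCov measurable_const (C := 1) (by simp)] at h3
  refine h3.ne' (integral_eq_zero_of_ae ?_)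
  filter_upwards [heq] with x hx
  simp only [Pi.zero_apply, mul_eq_zero, one_mul] at hx ⊢
  rcases hx with hx | hx
  · exact Or.inr hx
  · have : score p β₀ x = 0 := by
      by_contra h
      exact (hreg.w₃_pos h).ne' hx
    simp [this]

theorem isNoise_optNoise [Nonempty ι] (hreg : RegularModel μ p Θ β₀) :
    IsNoise μ p β₀ (optNoise μ p β₀) where
  measurable := ((hreg.measurable_apply β₀).mul hreg.measurable_w₃).div_const _
  nonneg x := div_nonneg (mul_nonneg (hreg.data_nonneg x) (w₃_nonneg x))
    hreg.integral_data_mul_w₃_pos.le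
  prob := by
    have hZ := hreg.integral_data_mul_w₃_pos
    have h0 : ∀ x, 0 ≤ optNoise μ p β₀ x := fun x =>
      div_nonneg (mul_nonneg (hreg.data_nonneg x) (w₃_nonneg x)) hZ.le
    have hI : Integrable (optNoise μ p β₀) μ := hreg.integrable_data_mul_w₃.div_const _
    rw [← ofReal_integral_eq_lintegral_ofReal hI (Eventually.of_forall h0)]
    have : ∫ x, optNoise μ p β₀ x ∂μ = 1 :=
      (integral_div _ _).trans (div_self hZ.ne')
    rw [this, ENNReal.ofReal_one]
  pos := Eventually.of_forall fun x hp hs =>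
    div_pos (mul_pos (lt_of_le_of_ne (hreg.data_nonneg x) (Ne.symm hp)) (hreg.w₃_pos hs))
      hreg.integral_data_mul_w₃_pos

theorem dataWeight_eq {pd : X → ℝ} {ν : ℝ} {x : X} (hd : 0 ≤ pd x) (hn : 0 < pn x)
    (hν : 0 < ν) : dataWeight pd pn ν x = pd x / (pd x / ν + pn x) := by
  have : 0 < pd x + ν * pn x := by positivity
  have : 0 < pd x / ν + pn x := by positivity
  unfold dataWeight misclass
  field_simp
  ring

/-- The integrands converge to `p_d² w₃² / pₙ` and stay below it. The limit may have infinite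
integral, so dominated convergence is unavailable: Fatou's lemma bounds the lower limit and the
pointwise bound the upper one, along each sequence of ratios. -/
theorem tendsto_ofReal_weightTrace [Nonempty ι] (hreg : RegularModel μ p Θ β₀)
    (hn : IsNoise μ p β₀ pn) :
    Tendsto (fun ν => ENNReal.ofReal (weightTrace μ p β₀ pn ν)) atTop
      (𝓝 (ENNReal.ofReal ((∫ x, p β₀ x * w₃ μ p β₀ x ∂μ) ^ 2) *
        ∫⁻ x, ENNReal.ofReal (optNoise μ p β₀ x) ^ 2 / ENNReal.ofReal (pn x) ∂μ)) := by
  have hopt := hreg.isNoise_optNoise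
  have hZ := hreg.integral_data_mul_w₃_pos
  set Z := ∫ x, p β₀ x * w₃ μ p β₀ x ∂μ with hZdef
  set F : X → ℝ≥0∞ := fun x => ENNReal.ofReal (Z ^ 2) *
    (ENNReal.ofReal (optNoise μ p β₀ x) ^ 2 / ENNReal.ofReal (pn x)) with hF
  have hmeasF : Measurable fun x => ENNReal.ofReal (optNoise μ p β₀ x) ^ 2 / ENNReal.ofReal (pn x) :=
    (hopt.measurable.ennreal_ofReal.pow_const 2).div hn.measurable.ennreal_ofReal
  rw [← lintegral_const_mul _ hmeasF]
  set Φ : ℝ → X → ℝ := fun ν x => dataWeight (p β₀) pn ν x *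
    quadForm (fisher μ p β₀)⁻¹ (score p β₀ x) * p β₀ x with hΦ
  have hFeq : ∀ x, 0 < pn x → F x = ENNReal.ofReal
      (quadForm (fisher μ p β₀)⁻¹ (score p β₀ x) * p β₀ x ^ 2 / pn x) := fun x hx => by
    rw [hF]
    simp only
    rw [← ENNReal.ofReal_pow (hopt.nonneg x), ← ENNReal.ofReal_div_of_pos hx,
      ← ENNReal.ofReal_mul (by positivity), ← hreg.w₃_sq]
    congr 1
    have : optNoise μ p β₀ x = p β₀ x * w₃ μ p β₀ x / Z := rfl
    rw [this]
    field_simp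
  have hzero : ∀ x, (p β₀ x = 0 ∨ score p β₀ x = 0) → F x = 0 ∧ ∀ ν, Φ ν x = 0 := by
    intro x hx
    have h1 : optNoise μ p β₀ x = 0 := by
      change p β₀ x * w₃ μ p β₀ x / Z = 0
      rcases hx with h | h
      · simp [h]
      · have : w₃ μ p β₀ x = 0 := by
          rw [← sq_eq_zero_iff, hreg.w₃_sq, h, quadForm_eq_sum]; simp
        simp [this]
    refine ⟨by simp [hF, h1], fun ν => ?_⟩
    rcases hx with h | h
    · simp [hΦ, h]
    · simp [hΦ, h, quadForm_eq_sum]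
  have hle : ∀ ν : ℝ, 0 < ν → ∀ᵐ x ∂μ, ENNReal.ofReal (Φ ν x) ≤ F x := by
    intro ν hν
    filter_upwards [hn.pos] with x hx
    by_cases hx0 : p β₀ x = 0 ∨ score p β₀ x = 0
    · simp [(hzero x hx0).2 ν]
    · rw [not_or] at hx0
      have hpn := hx hx0.1 hx0.2
      rw [hFeq x hpn]
      refine ENNReal.ofReal_le_ofReal ?_
      have hQ := quadForm_nonneg hreg.fisher_posDef.inv.posSemidef (score p β₀ x)
      have hd := hreg.data_nonneg x
      have hk : dataWeight (p β₀) pn ν x ≤ p β₀ x / pn x := by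
        rw [dataWeight_eq hd hpn hν]
        refine div_le_div_of_nonneg_left hd hpn ?_
        have : 0 ≤ p β₀ x / ν := by positivity
        linarith
      calc Φ ν x = dataWeight (p β₀) pn ν x *
            (quadForm (fisher μ p β₀)⁻¹ (score p β₀ x) * p β₀ x) := by simp only [hΦ]; ring
        _ ≤ p β₀ x / pn x * (quadForm (fisher μ p β₀)⁻¹ (score p β₀ x) * p β₀ x) :=
            mul_le_mul_of_nonneg_right hk (mul_nonneg hQ hd)
        _ = _ := by ring
  have hlim : ∀ᵐ x ∂μ, Tendsto (fun ν => ENNReal.ofReal (Φ ν x)) atTop (𝓝 (F x)) := by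
    filter_upwards [hn.pos] with x hx
    by_cases hx0 : p β₀ x = 0 ∨ score p β₀ x = 0
    · simp [(hzero x hx0).2, (hzero x hx0).1]
    · rw [not_or] at hx0
      have hpn := hx hx0.1 hx0.2
      rw [hFeq x hpn]
      refine ENNReal.tendsto_ofReal ?_
      have h1 : Tendsto (fun ν : ℝ => p β₀ x / (p β₀ x / ν + pn x)) atTop
          (𝓝 (p β₀ x / (0 + pn x))) :=
        tendsto_const_nhds.div ((tendsto_const_nhds.div_atTop tendsto_id).add_const _)
          (by simpa using hpn.ne')
      have h2 := (h1.mul_const (quadForm (fisher μ p β₀)⁻¹ (score p β₀ x))).mul_const (p β₀ x)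
      have e : p β₀ x / (0 + pn x) * quadForm (fisher μ p β₀)⁻¹ (score p β₀ x) * p β₀ x =
          quadForm (fisher μ p β₀)⁻¹ (score p β₀ x) * p β₀ x ^ 2 / pn x := by
        rw [zero_add]; ring
      rw [e] at h2
      refine h2.congr' ?_
      filter_upwards [eventually_gt_atTop 0] with ν hν
      simp only [hΦ, dataWeight_eq (hreg.data_nonneg x) hpn hν]
  have hmeas : ∀ ν, Measurable fun x => ENNReal.ofReal (Φ ν x) := fun ν =>
    (((hreg.measurable_dataWeight hn ν).mul ((continuous_quadForm _).measurable.comp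
      hreg.measurable_score)).mul (hreg.measurable_apply β₀)).ennreal_ofReal
  have hmain : Tendsto (fun ν => ∫⁻ x, ENNReal.ofReal (Φ ν x) ∂μ) atTop (𝓝 (∫⁻ x, F x ∂μ)) := by
    refine tendsto_of_seq_tendsto fun s hs => ?_
    refine tendsto_of_le_liminf_of_limsup_le ?_ ?_
    · calc ∫⁻ x, F x ∂μ = ∫⁻ x, liminf (fun n => ENNReal.ofReal (Φ (s n) x)) atTop ∂μ := by
            refine lintegral_congr_ae ?_
            filter_upwards [hlim] with x hx
            exact ((hx.comp hs).liminf_eq).symm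
        _ ≤ _ := lintegral_liminf_le fun n => hmeas (s n)
    · refine limsup_le_of_le (by isBoundedDefault) ?_
      filter_upwards [hs.eventually_gt_atTop 0] with n hn0
      exact lintegral_mono_ae (hle _ hn0)
  refine hmain.congr' ?_
  filter_upwards [eventually_gt_atTop 0] with ν hν
  rw [weightTrace, ofReal_integral_eq_lintegral_ofReal
    (hreg.integrable_quadForm_score _ (hreg.measurable_dataWeight hn ν)
      (hreg.abs_dataWeight_le hn hν))
    (Eventually.of_forall fun x => mul_nonneg (mul_nonneg (hreg.dataWeight_nonneg hn hν x)
      (quadForm_nonneg hreg.fisher_posDef.inv.posSemidef _)) (hreg.data_nonneg x))]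

theorem one_add_noisePart_isEquivalent (hreg : RegularModel μ p Θ β₀)
    (hmodel : IsNormalized μ p Θ ∨ IsUnnormalized p Θ) (hn : IsNoise μ p β₀ pn) :
    Asymptotics.IsEquivalent atTop (fun ν => 1 + noisePart μ p β₀ pn ν)
      fun ν => 1 + weightTrace μ p β₀ pn ν := by
  refine (hreg.noisePart_sub_isLittleO hmodel hn).congr_left fun ν => ?_
  simp

/-- `1 + noisePart` and `1 + weightTrace` are equivalent, so they share finite and infinite limits
alike; the limit of `weightTrace` is `Z²` times one plus the divergence, and `Z²` is then
subtracted. -/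
theorem tendsto_klError_sub [Nonempty ι] (hreg : RegularModel μ p Θ β₀)
    (hmodel : IsNormalized μ p Θ ∨ IsUnnormalized p Θ) (hn : IsNoise μ p β₀ pn)
    {T : ℝ} (hT : 0 < T) :
    Tendsto
        (fun ν : ℝ =>
          ((klError μ p β₀ T ν pn - noiseFreePart μ p β₀ T ν : ℝ) : EReal))
        atTop
        (𝓝 ((((∫ x, p β₀ x * w₃ μ p β₀ x ∂μ) ^ 2 / (2 * T) : ℝ) : EReal) *
          ((chiSq μ (optNoise μ p β₀) pn : ℝ≥0∞) : EReal))) := by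
  have hopt := hreg.isNoise_optNoise
  have hZ := hreg.integral_data_mul_w₃_pos
  have hτ := hreg.tendsto_ofReal_weightTrace hn
  have hA := hreg.one_add_noisePart_isEquivalent hmodel hn
  have hone := one_le_lintegral_sq_div hopt.measurable hn.measurable hopt.prob hn.prob
  set Z := ∫ x, p β₀ x * w₃ μ p β₀ x ∂μ with hZdef
  have hcongr : (fun ν : ℝ => ((1 / (2 * T) * (noisePart μ p β₀ pn ν - Z ^ 2) : ℝ) : EReal))
      =ᶠ[atTop] fun ν : ℝ =>
        ((klError μ p β₀ T ν pn - noiseFreePart μ p β₀ T ν : ℝ) : EReal) := by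
    filter_upwards [eventually_gt_atTop 0] with ν hν
    rw [hreg.klError_sub_noiseFreePart hn hν]
  refine Tendsto.congr' hcongr ?_
  rw [chiSq]
  set L := ∫⁻ x, ENNReal.ofReal (optNoise μ p β₀ x) ^ 2 / ENNReal.ofReal (pn x) ∂μ with hL
  have hτ0 : ∀ᶠ ν in atTop, 0 ≤ weightTrace μ p β₀ pn ν := by
    filter_upwards [eventually_gt_atTop 0] with ν hν using hreg.weightTrace_nonneg hn hν
  by_cases hLtop : L = ⊤
  · rw [hLtop, ENNReal.top_sub ENNReal.one_ne_top, EReal.coe_ennreal_top,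
      EReal.coe_mul_top_of_pos (by positivity), EReal.tendsto_coe_nhds_top_iff]
    rw [hLtop, ENNReal.mul_top (by simpa using hZ.ne')] at hτ
    have hτtop : Tendsto (weightTrace μ p β₀ pn) atTop atTop := by
      refine tendsto_atTop.2 fun b => ?_
      filter_upwards [hτ.eventually (lt_mem_nhds (ENNReal.ofReal_lt_top (r := b)))] with ν hν
      by_contra! h
      exact hν.not_ge (ENNReal.ofReal_le_ofReal h.le)
    have h1 : Tendsto (fun ν => 1 + noisePart μ p β₀ pn ν) atTop atTop :=
      hA.symm.tendsto_atTop (tendsto_atTop_add_const_left _ _ hτtop)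
    have h2 := (tendsto_atTop_add_const_left _ (-1 - Z ^ 2) h1).const_mul_atTop
      (show 0 < 1 / (2 * T) by positivity)
    refine h2.congr fun ν => ?_
    ring
  · have h1 : Tendsto (weightTrace μ p β₀ pn) atTop (𝓝 (Z ^ 2 * L.toReal)) := by
      have h := (ENNReal.tendsto_toReal (ENNReal.mul_ne_top ENNReal.ofReal_ne_top hLtop)).comp hτ
      rw [ENNReal.toReal_mul, ENNReal.toReal_ofReal (by positivity)] at h
      refine h.congr' ?_
      filter_upwards [hτ0] with ν hν
      simp [ENNReal.toReal_ofReal hν]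
    have h2 : Tendsto (fun ν => 1 + noisePart μ p β₀ pn ν) atTop (𝓝 (1 + Z ^ 2 * L.toReal)) :=
      hA.symm.tendsto_nhds (h1.const_add 1)
    have h3 := (h2.sub_const (1 + Z ^ 2)).const_mul (1 / (2 * T))
    have hchi : ((L - 1 : ℝ≥0∞) : EReal) = ((L.toReal - 1 : ℝ) : EReal) := by
      have hne : L - 1 ≠ ⊤ := ENNReal.sub_ne_top hLtop
      rw [← EReal.coe_ennreal_toReal hne, ENNReal.toReal_sub_of_le hone hLtop]
      simp
    rw [hchi, ← EReal.coe_mul, EReal.tendsto_coe]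
    have e : Z ^ 2 / (2 * T) * (L.toReal - 1) =
        1 / (2 * T) * (1 + Z ^ 2 * L.toReal - (1 + Z ^ 2)) := by ring
    rw [e]
    refine h3.congr fun ν => ?_
    ring

theorem klError_eq (T ν : ℝ) :
    klError μ p β₀ T ν pn = 1 / T * klError μ p β₀ 1 ν pn := by
  simp only [klError]
  ring

/-- The noise-free part cancels in the comparison, and the limit is zero for the optimal noise,
positive for the other. The budget only scales the error by `1 / T`, so the threshold on `ν` found
for `T = 1` serves every `T`. -/
theorem eventually_klError_lt [Nonempty ι] (hreg : RegularModel μ p Θ β₀)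
    (hmodel : IsNormalized μ p Θ ∨ IsUnnormalized p Θ) (hn : IsNoise μ p β₀ pn)
    (hne : ¬ pn =ᵐ[μ] optNoise μ p β₀) :
    ∀ᶠ ν : ℝ in atTop, ∀ T : ℝ, 0 < T →
        klError μ p β₀ T ν (optNoise μ p β₀) < klError μ p β₀ T ν pn := by
  have hopt := hreg.isNoise_optNoise
  have hZ := hreg.integral_data_mul_w₃_pos
  have h1 := hreg.tendsto_klError_sub hmodel hopt one_pos
  have h2 := hreg.tendsto_klError_sub hmodel hn one_pos
  have hchi0 : chiSq μ (optNoise μ p β₀) (optNoise μ p β₀) = 0 :=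
    (chiSq_eq_zero_iff hopt.measurable hopt.measurable hopt.nonneg hopt.nonneg hopt.prob
      hopt.prob).2 EventuallyEq.rfl
  have hchi : chiSq μ (optNoise μ p β₀) pn ≠ 0 := fun h => hne
    ((chiSq_eq_zero_iff hopt.measurable hn.measurable hopt.nonneg hn.nonneg hopt.prob
      hn.prob).1 h)
  rw [hchi0, EReal.coe_ennreal_zero, mul_zero] at h1
  have hpos : (0 : EReal) < (((∫ x, p β₀ x * w₃ μ p β₀ x ∂μ) ^ 2 / (2 * 1) : ℝ) : EReal) *
          ((chiSq μ (optNoise μ p β₀) pn : ℝ≥0∞) : EReal) := by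
    refine EReal.mul_pos ?_ ?_
    · exact_mod_cast (by positivity : (0 : ℝ) < (∫ x, p β₀ x * w₃ μ p β₀ x ∂μ) ^ 2 / (2 * 1))
    · exact EReal.coe_ennreal_pos.2 (pos_iff_ne_zero.2 hchi)
  filter_upwards [h1.eventually_lt h2 hpos] with ν hν T hT
  rw [klError_eq T ν, klError_eq (pn := pn) T ν]
  have := EReal.coe_lt_coe_iff.1 hν
  exact mul_lt_mul_of_pos_left (by linarith) (by positivity)

end RegularModel

/-! ### Events of probability tending to one, as a filter -/

section Whp

variable {Ω : Type*} [MeasurableSpace Ω]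

/-- The filter on `ℕ × Ω` of the events that hold with probability tending to one. -/
def whp (P : Measure Ω) : Filter (ℕ × Ω) where
  sets := {s | Tendsto (fun k => P {ω | (k, ω) ∉ s}) atTop (𝓝 0)}
  univ_sets := by simp
  sets_of_superset {s t} hs hst := by
    refine tendsto_of_tendsto_of_tendsto_of_le_of_le tendsto_const_nhds hs
      (fun _ => zero_le) fun k => measure_mono fun ω hω h => hω (hst h)
  inter_sets {s t} hs ht := by
    have := Tendsto.add (Set.mem_ofPred.1 hs) (Set.mem_ofPred.1 ht)
    rw [add_zero] at this
    refine tendsto_of_tendsto_of_tendsto_of_le_of_le tendsto_const_nhds this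
      (fun _ => zero_le) fun k => ?_
    refine (measure_mono fun ω hω => ?_).trans (measure_union_le _ _)
    by_contra h
    simp only [Set.mem_union, Set.mem_ofPred_eq, not_or, not_not] at h
    exact hω h

variable {P : Measure Ω}

theorem eventually_whp {s : ℕ × Ω → Prop} :
    (∀ᶠ q in whp P, s q) ↔ Tendsto (fun k => P {ω | ¬ s (k, ω)}) atTop (𝓝 0) := Iff.rfl

theorem eventually_whp_of_forall_le {s : ℕ × Ω → Prop}
    (h : ∀ δ : ℝ≥0∞, 0 < δ → δ ≤ 1 → ∀ᶠ k in atTop, P {ω | ¬ s (k, ω)} ≤ δ) :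
    ∀ᶠ q in whp P, s q := by
  rw [eventually_whp, ENNReal.tendsto_nhds_zero]
  intro δ hδ
  filter_upwards [h (min δ 1) (lt_min hδ one_pos) (min_le_right _ _)] with k hk
  exact hk.trans (min_le_left _ _)

theorem eventually_whp_of_ae {s : ℕ × Ω → Prop} (h : ∀ᶠ k in atTop, ∀ᵐ ω ∂P, s (k, ω)) :
    ∀ᶠ q in whp P, s q := by
  rw [eventually_whp]
  refine tendsto_const_nhds.congr' ?_
  filter_upwards [h] with k hk
  exact (ae_iff.1 hk).symm

theorem tendsto_fst_whp : Tendsto Prod.fst (whp P) atTop := by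
  intro s hs
  exact eventually_whp_of_ae (s := fun q => q.1 ∈ s)
    ((show ∀ᶠ k in atTop, k ∈ s from hs).mono fun k hk => Eventually.of_forall fun _ => hk)

/-- Makes the ordinary `=o` and `=O` calculus along `whp P` play the role of stochastic order
symbols. -/
theorem tendstoInMeasure_iff_whp {E : Type*} [PseudoEMetricSpace E] {f : ℕ → Ω → E} {c : E} :
    TendstoInMeasure P f atTop (fun _ => c) ↔
      Tendsto (fun q : ℕ × Ω => f q.1 q.2) (whp P) (𝓝 c) := by
  rw [EMetric.tendsto_nhds, TendstoInMeasure]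
  refine forall₂_congr fun ε _ => ?_
  rw [eventually_whp]
  simp only [not_lt]

theorem tendsto_whp_of_ae_tendsto [IsFiniteMeasure P] {E : Type*} [PseudoEMetricSpace E]
    {f : ℕ → Ω → E} {c : E} (hf : ∀ n, AEStronglyMeasurable (f n) P)
    (h : ∀ᵐ ω ∂P, Tendsto (fun n => f n ω) atTop (𝓝 c)) :
    Tendsto (fun q : ℕ × Ω => f q.1 q.2) (whp P) (𝓝 c) :=
  tendstoInMeasure_iff_whp.1 (tendstoInMeasure_of_tendsto_ae hf h)

end Whp

/-! ### Empirical means: law of large numbers and quadratic expansions -/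

section Sample

variable {Ω : Type*} [MeasurableSpace Ω] {P : Measure Ω} [IsProbabilityMeasure P]
  {X : Type*} [MeasurableSpace X] {m : Measure X} {ζ : ℕ → Ω → X}

/-- The empirical mean of `f` over the first `n` points of a sample. -/
def empMean (n : ℕ) (x : ℕ → X) {V : Type*} [AddCommGroup V] [Module ℝ V] (f : X → V) : V :=
  (1 / (n : ℝ)) • ∑ i ∈ Finset.range n, f (x i)

theorem tendsto_empMean (hζ : ∀ i, HasLaw (ζ i) m P)
    (hind : Pairwise fun i j => ζ i ⟂ᵢ[P] ζ j) {f : X → ℝ} (hf : Measurable f)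
    (hfi : Integrable f m) {n : ℕ → ℕ} (hn : Tendsto n atTop atTop) :
    Tendsto (fun q : ℕ × Ω => empMean (n q.1) (fun i => ζ i q.2) f) (whp P) (𝓝 (∫ x, f x ∂m)) := by
  have hint : Integrable (fun ω => f (ζ 0 ω)) P := by
    have := (hζ 0).map_eq ▸ hfi
    exact this.comp_aemeasurable (hζ 0).aemeasurable
  have hlaw := strong_law_ae_real (fun i ω => f (ζ i ω)) hint
    (fun i j hij => (hind hij).comp hf hf)
    (fun i => (((hζ i).identDistrib (hζ 0)).comp hf))
  have hmean : ∫ ω, f (ζ 0 ω) ∂P = ∫ x, f x ∂m :=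
    (hζ 0).integral_comp hf.aestronglyMeasurable
  rw [hmean] at hlaw
  refine tendsto_whp_of_ae_tendsto (f := fun k ω => empMean (n k) (fun i => ζ i ω) f)
    (fun k => ?_) ?_
  · refine AEMeasurable.aestronglyMeasurable ?_
    exact (Finset.aemeasurable_fun_sum _ fun i _ =>
      hf.comp_aemeasurable (hζ i).aemeasurable).const_smul (1 / (n k : ℝ))
  · filter_upwards [hlaw] with ω hω
    refine (hω.comp hn).congr fun k => ?_
    simp [empMean, div_eq_inv_mul]

/-- The majorant `S` does not depend on `h`, so Markov's inequality for its empirical mean applies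
even though `h` depends on the sample. -/
theorem empMean_remainder_isLittleO {E : Type*} [NormedAddCommGroup E]
    [SecondCountableTopology E] (hζ : ∀ i, HasLaw (ζ i) m P)
    {R : E → X → ℝ} {K : X → ℝ} {r : ℝ}
    (hr : 0 < r) (hK : Integrable K m) (hRm : ∀ h ∈ Metric.ball (0 : E) r, Measurable (R h))
    (hRc : ∀ x, ContinuousOn (fun h => R h x) (Metric.ball 0 r))
    (hRK : ∀ h x, ‖h‖ < r → |R h x| ≤ K x * ‖h‖ ^ 2)
    (hRo : ∀ x, (fun h => R h x) =o[𝓝 0] fun h => ‖h‖ ^ 2) (n : ℕ → ℕ) {h : ℕ × Ω → E}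
    (hh : Tendsto h (whp P) (𝓝 0)) :
    (fun q : ℕ × Ω => empMean (n q.1) (fun i => ζ i q.2) (R (h q))) =o[whp P]
      fun q => ‖h q‖ ^ 2 := by
  refine Asymptotics.isLittleO_iff.2 fun ε hε => eventually_whp_of_forall_le fun δ hδ hδ1 => ?_
  have hδ2 : 0 < δ / 2 := ENNReal.half_pos hδ.ne'
  have hε' : 0 < ENNReal.ofReal ε := ENNReal.ofReal_pos.2 hε
  -- The integral of `S` is made at most `ε δ / 2`, so that Markov's inequality at level `ε` costs
  -- `δ / 2`; the other half pays for `‖h‖ > ρ`.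
  obtain ⟨ρ, hρ, -, S, hSm, hS0, -, hSint, hS⟩ := exists_small_quadratic_bound m hr hK hRm hRc hRK
    hRo (ε := ENNReal.ofReal ε * (δ / 2)) (ENNReal.mul_pos hε'.ne' hδ2.ne')
  have hsmall : ∀ᶠ q in whp P, ‖h q‖ ≤ ρ := by
    have := hh.norm
    rw [norm_zero] at this
    exact this.eventually (Iic_mem_nhds hρ)
  filter_upwards [(ENNReal.tendsto_nhds_zero.1 (eventually_whp.1 hsmall)) _ hδ2] with k hk
  set A : Ω → ℝ := fun ω => empMean (n k) (fun i => ζ i ω) S with hA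
  have hAm : AEMeasurable A P := (Finset.aemeasurable_fun_sum _ fun i _ =>
      hSm.comp_aemeasurable (hζ i).aemeasurable).const_smul (1 / (n k : ℝ))
  have hAint : ∫⁻ ω, ENNReal.ofReal (A ω) ∂P ≤ ENNReal.ofReal ε * (δ / 2) := by
    have h1 : ∀ ω, ENNReal.ofReal (A ω) = ENNReal.ofReal (1 / (n k : ℝ)) *
        ∑ i ∈ Finset.range (n k), ENNReal.ofReal (S (ζ i ω)) := fun ω => by
      rw [hA]
      simp only [empMean, smul_eq_mul]
      rw [ENNReal.ofReal_mul (by positivity), ENNReal.ofReal_sum_of_nonneg fun i _ => hS0 _]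
    have h2 : ∀ i, ∫⁻ ω, ENNReal.ofReal (S (ζ i ω)) ∂P = ∫⁻ x, ENNReal.ofReal (S x) ∂m := fun i => by
      rw [← (hζ i).map_eq, lintegral_map' hSm.ennreal_ofReal.aemeasurable (hζ i).aemeasurable]
    simp only [h1]
    have hSi : ∀ i, AEMeasurable (fun ω => ENNReal.ofReal (S (ζ i ω))) P := fun i =>
      hSm.ennreal_ofReal.comp_aemeasurable (hζ i).aemeasurable
    rw [lintegral_const_mul'' _ (Finset.aemeasurable_fun_sum _ fun i _ => hSi i),
      lintegral_finsetSum' _ fun i _ => hSi i]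
    simp only [h2, Finset.sum_const, Finset.card_range, nsmul_eq_mul]
    rw [← mul_assoc]
    refine le_trans ?_ hSint
    refine mul_le_of_le_one_left (zero_le) ?_
    -- An empty sample has empirical mean zero, since `1 / 0 = 0`.
    rcases Nat.eq_zero_or_pos (n k) with h0 | h0
    · simp [h0]
    · rw [← ENNReal.ofReal_natCast, ← ENNReal.ofReal_mul (by positivity), one_div,
        inv_mul_cancel₀ (by positivity), ENNReal.ofReal_one]
  have hAP : P {ω | ENNReal.ofReal ε ≤ ENNReal.ofReal (A ω)} ≤ δ / 2 := by
    have h3 := (mul_meas_ge_le_lintegral₀ hAm.ennreal_ofReal (ENNReal.ofReal ε)).trans hAint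
    exact (ENNReal.mul_le_mul_iff_right hε'.ne' ENNReal.ofReal_ne_top).1 h3
  have hsub : {ω | ¬ ‖empMean (n k) (fun i => ζ i ω) (R (h (k, ω)))‖ ≤ ε * ‖‖h (k, ω)‖ ^ 2‖} ⊆
      {ω | ¬ ‖h (k, ω)‖ ≤ ρ} ∪ {ω | ENNReal.ofReal ε ≤ ENNReal.ofReal (A ω)} := by
    intro ω hω
    by_contra hcon
    simp only [Set.mem_union, Set.mem_ofPred_eq, not_or, not_le] at hcon hω
    have hAε : A ω < ε := (ENNReal.ofReal_lt_ofReal_iff hε).1 hcon.2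
    refine hω.not_ge ?_
    have h4 : ‖empMean (n k) (fun i => ζ i ω) (R (h (k, ω)))‖ ≤ A ω * ‖h (k, ω)‖ ^ 2 := by
      simp only [hA, empMean, smul_eq_mul, norm_mul]
      rw [Real.norm_of_nonneg (by positivity), mul_assoc, Finset.sum_mul]
      refine mul_le_mul_of_nonneg_left ((norm_sum_le _ _).trans
        (Finset.sum_le_sum fun i _ => ?_)) (by positivity)
      exact hS _ _ (not_lt.1 hcon.1)
    refine h4.trans ?_
    rw [norm_pow, norm_norm]
    exact mul_le_mul_of_nonneg_right hAε.le (by positivity)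
  calc _ ≤ _ := measure_mono hsub
    _ ≤ _ := measure_union_le _ _
    _ ≤ δ / 2 + δ / 2 := add_le_add hk hAP
    _ = δ := ENNReal.add_halves δ

variable {ι : Type*} [Fintype ι]

/-- A second order expansion at `0`, in an integrated sense, of random functions of `h`. -/
structure QuadExpansion (m : Measure X) (r : ℝ) (φ : EuclideanSpace ℝ ι → X → ℝ)
    (u : X → EuclideanSpace ℝ ι) (Q : X → Matrix ι ι ℝ) : Prop where
  measurable : ∀ h ∈ Metric.ball (0 : EuclideanSpace ℝ ι) r, Measurable (φ h)
  continuousOn : ∀ x, ContinuousOn (fun h => φ h x) (Metric.ball 0 r)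
  measurable_grad : Measurable u
  measurable_hess : ∀ i j, Measurable fun x => Q x i j
  integrable_hess : ∀ i j, Integrable (fun x => Q x i j) m
  bound : ∃ K : X → ℝ, Integrable K m ∧ ∀ h x, ‖h‖ < r →
    |φ h x - φ 0 x - inner ℝ (u x) h| ≤ K x * ‖h‖ ^ 2
  expansion : ∀ x, (fun h => φ h x - φ 0 x - inner ℝ (u x) h - quadForm (Q x) h / 2)
    =o[𝓝 0] fun h => ‖h‖ ^ 2

theorem inner_empMean (n : ℕ) (x : ℕ → X) (u : X → EuclideanSpace ℝ ι) (h : EuclideanSpace ℝ ι) :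
    inner ℝ (empMean n x u) h = empMean n x fun y => inner ℝ (u y) h := by
  simp only [empMean, real_inner_smul_left, sum_inner, smul_eq_mul]

theorem quadForm_eq_empMean (n : ℕ) (x : ℕ → X) (Q : X → Matrix ι ι ℝ)
    (h : EuclideanSpace ℝ ι) :
    quadForm (Matrix.of fun i j => empMean n x fun y => Q y i j) h =
      empMean n x fun y => quadForm (Q y) h := by
  simp only [quadForm_eq_sum, empMean, smul_eq_mul, of_apply]
  conv_rhs => rw [Finset.sum_comm, Finset.mul_sum]
  refine Finset.sum_congr rfl fun i _ => ?_
  conv_rhs => rw [Finset.sum_comm, Finset.mul_sum]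
  refine Finset.sum_congr rfl fun j _ => ?_
  rw [mul_assoc, Finset.sum_mul]

/-- Two errors of order `o(‖h‖²)`: the averaged Taylor remainder, and the replacement of the
empirical Hessian by its expectation through the law of large numbers. -/
theorem QuadExpansion.empMean_isLittleO {r : ℝ} (hr : 0 < r) {φ : EuclideanSpace ℝ ι → X → ℝ}
    {u : X → EuclideanSpace ℝ ι} {Q : X → Matrix ι ι ℝ} (hφ : QuadExpansion m r φ u Q)
    (hζ : ∀ i, HasLaw (ζ i) m P) (hind : Pairwise fun i j => ζ i ⟂ᵢ[P] ζ j)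
    {n : ℕ → ℕ} (hn : Tendsto n atTop atTop) {h : ℕ × Ω → EuclideanSpace ℝ ι}
    (hh : Tendsto h (whp P) (𝓝 0)) :
    (fun q : ℕ × Ω => empMean (n q.1) (fun i => ζ i q.2) (φ (h q))
      - empMean (n q.1) (fun i => ζ i q.2) (φ 0)
      - inner ℝ (empMean (n q.1) (fun i => ζ i q.2) u) (h q)
      - quadForm (Matrix.of fun i j => ∫ x, Q x i j ∂m) (h q) / 2) =o[whp P]
      fun q => ‖h q‖ ^ 2 := by
  obtain ⟨K, hK, hb⟩ := hφ.bound
  have hinner : ∀ h : EuclideanSpace ℝ ι, Measurable fun x => inner ℝ (u x) h := fun h =>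
    hφ.measurable_grad.inner measurable_const
  have hq : ∀ h : EuclideanSpace ℝ ι, Measurable fun x => quadForm (Q x) h := fun h => by
    simp only [quadForm_eq_sum]
    exact Finset.measurable_fun_sum _ fun i _ => Finset.measurable_fun_sum _ fun j _ =>
      (hφ.measurable_hess i j).mul_const _
  have h1 := empMean_remainder_isLittleO (P := P) hζ
    (R := fun h x => φ h x - φ 0 x - inner ℝ (u x) h - quadForm (Q x) h / 2)
    (K := fun x => K x + ∑ i, ∑ j, |Q x i j|) hr
    (hK.add (integrable_finsetSum _ fun i _ => integrable_finsetSum _ fun j _ =>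
      (hφ.integrable_hess i j).abs))
    (fun h hh => (((hφ.measurable h hh).sub (hφ.measurable 0 (Metric.mem_ball_self hr))).sub
      (hinner h)).sub ((hq h).div_const 2))
    (fun x => (((hφ.continuousOn x).sub continuousOn_const).sub (by fun_prop)).sub
      (by fun_prop))
    (fun h x hh => by
      have e1 := hb h x hh
      have e2 := abs_quadForm_le (Q x) h
      have e3 := abs_sub (φ h x - φ 0 x - inner ℝ (u x) h) (quadForm (Q x) h / 2)
      rw [abs_div, abs_two] at e3
      have e4 := abs_nonneg (quadForm (Q x) h)
      rw [add_mul]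
      linarith)
    hφ.expansion n hh
  have h2 : (fun q : ℕ × Ω => quadForm ((Matrix.of fun i j =>
      empMean (n q.1) (fun i => ζ i q.2) fun y => Q y i j) -
        Matrix.of fun i j => ∫ x, Q x i j ∂m) (h q) / 2) =o[whp P] fun q => ‖h q‖ ^ 2 := by
    have hδ : Tendsto (fun q : ℕ × Ω => ∑ i, ∑ j, |(empMean (n q.1) (fun i => ζ i q.2)
        fun y => Q y i j) - ∫ x, Q x i j ∂m|) (whp P) (𝓝 0) := by
      have : Tendsto (fun q : ℕ × Ω => ∑ i, ∑ j, |(empMean (n q.1) (fun i => ζ i q.2)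
        fun y => Q y i j) - ∫ x, Q x i j ∂m|) (whp P) (𝓝 (∑ _i : ι, ∑ _j : ι, |(0 : ℝ)|)) := by
        refine tendsto_finsetSum _ fun i _ => tendsto_finsetSum _ fun j _ => Tendsto.abs ?_
        have := tendsto_empMean hζ hind (hφ.measurable_hess i j) (hφ.integrable_hess i j) hn
        simpa using this.sub_const (∫ x, Q x i j ∂m)
      simpa using this
    refine Asymptotics.isLittleO_iff.2 fun ε hε => ?_
    filter_upwards [hδ.eventually (gt_mem_nhds hε)] with q hq
    have e2 := abs_quadForm_le ((Matrix.of fun i j =>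
      empMean (n q.1) (fun i => ζ i q.2) fun y => Q y i j) -
        Matrix.of fun i j => ∫ x, Q x i j ∂m) (h q)
    simp only [Matrix.sub_apply, of_apply] at e2
    rw [norm_div, norm_pow, norm_norm, Real.norm_eq_abs, Real.norm_two]
    have e3 := mul_le_mul_of_nonneg_right hq.le (sq_nonneg ‖h q‖)
    have e4 := abs_nonneg (quadForm ((Matrix.of fun i j =>
      empMean (n q.1) (fun i => ζ i q.2) fun y => Q y i j) -
        Matrix.of fun i j => ∫ x, Q x i j ∂m) (h q))
    linarith
  refine (h1.add h2).congr_left fun q => ?_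
  rw [quadForm_sub, quadForm_eq_empMean, inner_empMean]
  simp only [empMean, smul_eq_mul, Finset.sum_sub_distrib, ← Finset.sum_div]
  ring

end Sample

/-! ### A two-sample central limit theorem -/

section CLT

variable {Ω : Type*} [MeasurableSpace Ω] {P : Measure Ω} [IsProbabilityMeasure P]
  {X : Type*} [MeasurableSpace X] {m m' : Measure X} {ζ ξ η : ℕ → Ω → X}

theorem aemeasurable_empMean {V : Type*} [NormedAddCommGroup V] [NormedSpace ℝ V]
    [MeasurableSpace V] [BorelSpace V] [SecondCountableTopology V]
    (hζ : ∀ i, HasLaw (ζ i) m P) {f : X → V} (hf : Measurable f) (n : ℕ) :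
    AEMeasurable (fun ω => empMean n (fun i => ζ i ω) f) P :=
  (Finset.aemeasurable_fun_sum _ fun i _ =>
    hf.comp_aemeasurable (hζ i).aemeasurable).const_smul (1 / (n : ℝ))

theorem tendsto_charFun_normalized_sum (hζ : ∀ i, HasLaw (ζ i) m P) (hind : iIndepFun ζ P)
    {f : X → ℝ} (hf : Measurable f) (hf2 : MemLp f 2 m) {n : ℕ → ℕ} (hn : Tendsto n atTop atTop)
    {c : ℕ → ℝ} {c₀ : ℝ} (hc : Tendsto c atTop (𝓝 c₀)) (t : ℝ) :
    Tendsto (fun k => charFun (P.map fun ω =>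
      c k * ((√(n k : ℝ))⁻¹ * (∑ i ∈ Finset.range (n k), f (ζ i ω) - n k * ∫ x, f x ∂m))) t) atTop
      (𝓝 (Complex.exp (-((Var[f; m] * c₀ ^ 2 * t ^ 2 / 2 : ℝ) : ℂ)))) := by
  have hf2' : MemLp (fun ω => f (ζ 0 ω)) 2 P := by
    have := (hζ 0).map_eq ▸ hf2
    exact this.comp_of_map (hζ 0).aemeasurable
  have hmean : ∫ ω, f (ζ 0 ω) ∂P = ∫ x, f x ∂m :=
    (hζ 0).integral_comp hf.aestronglyMeasurable
  have hvar : Var[fun ω => f (ζ 0 ω); P] = Var[f; m] := by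
    rw [← (hζ 0).map_eq, variance_map hf.aemeasurable (hζ 0).aemeasurable]
    rfl
  have hclt := tendstoInDistribution_inv_sqrt_mul_sum_sub (P := P) (X := fun i ω => f (ζ i ω))
    (Y := id) (P' := gaussianReal 0 Var[fun ω => f (ζ 0 ω); P].toNNReal) HasLaw.id hf2'
    (hind.comp (fun _ => f) fun _ => hf) fun i => ((hζ i).identDistrib (hζ 0)).comp hf
  rw [hmean] at hclt
  have hclt' : TendstoInDistribution
      (fun k ω => (√(n k : ℝ))⁻¹ * (∑ i ∈ Finset.range (n k), f (ζ i ω) - n k * ∫ x, f x ∂m))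
      atTop id (fun _ => P) (gaussianReal 0 Var[fun ω => f (ζ 0 ω); P].toNNReal) :=
    ⟨fun k => hclt.forall_aemeasurable (n k), hclt.aemeasurable_limit, hclt.tendsto.comp hn⟩
  -- The deterministic factors `c k` are treated as random variables converging in measure, for
  -- Slutsky's theorem.
  have hcm : TendstoInMeasure P (fun k (_ : Ω) => c k) atTop fun _ => c₀ :=
    tendstoInMeasure_of_tendsto_ae (fun _ => aestronglyMeasurable_const)
      (Eventually.of_forall fun _ => hc)
  have hprod := hclt'.continuous_comp_prodMk_of_tendstoInMeasure_const
    (g := fun x : ℝ × ℝ => x.2 * x.1) (by fun_prop) hcm (fun _ => aemeasurable_const)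
  have := ProbabilityMeasure.tendsto_iff_tendsto_charFun.1 hprod.tendsto t
  simp only [ProbabilityMeasure.coe_mk] at this
  convert this using 2
  rw [charFun_map_mul_comp (by fun_prop), Measure.map_id, charFun_gaussianReal, hvar,
    Real.coe_toNNReal _ (variance_nonneg _ _)]
  congr 1
  push_cast
  ring

theorem indepFun_sample_sums (hξ : ∀ i, HasLaw (ξ i) m P) (hη : ∀ i, HasLaw (η i) m' P)
    (hind : iIndepFun (fun s : ℕ ⊕ ℕ => Sum.elim ξ η s) P) {f g : X → ℝ} (hf : Measurable f)
    (hg : Measurable g) (n n' : ℕ) :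
    (fun ω => ∑ i ∈ Finset.range n, f (ξ i ω)) ⟂ᵢ[P] fun ω => ∑ i ∈ Finset.range n', g (η i ω) := by
  have hcomp := hind.comp (fun s => Sum.elim (fun _ : ℕ => f) (fun _ : ℕ => g) s)
    (by rintro (i | i) <;> assumption)
  have hmeas : ∀ s : ℕ ⊕ ℕ, AEMeasurable (Sum.elim (fun _ : ℕ => f) (fun _ : ℕ => g) s ∘
      Sum.elim ξ η s) P := by
    rintro (i | i)
    · exact hf.comp_aemeasurable (hξ i).aemeasurable
    · exact hg.comp_aemeasurable (hη i).aemeasurable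
  have hdisj : Disjoint ((Finset.range n).map (Function.Embedding.inl : ℕ ↪ ℕ ⊕ ℕ))
      ((Finset.range n').map (Function.Embedding.inr : ℕ ↪ ℕ ⊕ ℕ)) := by
    rw [Finset.disjoint_left]
    simp
  have h := (hcomp.indepFun_finset₀ _ _ hdisj hmeas).comp
    (φ := fun y => ∑ s, y s) (ψ := fun y => ∑ s, y s) (by fun_prop) (by fun_prop)
  convert h using 1
  · ext ω
    simp only [Function.comp_apply]
    rw [Finset.sum_coe_sort ((Finset.range n).map (Function.Embedding.inl : ℕ ↪ ℕ ⊕ ℕ))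
      (fun s => Sum.elim (fun _ : ℕ => f) (fun _ : ℕ => g) s (Sum.elim ξ η s ω))]
    simp
  · ext ω
    simp only [Function.comp_apply]
    rw [Finset.sum_coe_sort ((Finset.range n').map (Function.Embedding.inr : ℕ ↪ ℕ ⊕ ℕ))
      (fun s => Sum.elim (fun _ : ℕ => f) (fun _ : ℕ => g) s (Sum.elim ξ η s ω))]
    simp

/-- As the means agree, the statistic is the independent sum of the normalized noise sum, times
`√(T_d / T_n)`, and minus the normalized data sum, so characteristic functions multiply. Argument
`1` suffices, since a direction `t` can be put into `f` and `g`. -/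
theorem tendsto_charFun_two_sample (hξ : ∀ i, HasLaw (ξ i) m P) (hη : ∀ i, HasLaw (η i) m' P)
    (hind : iIndepFun (fun s : ℕ ⊕ ℕ => Sum.elim ξ η s) P) {f g : X → ℝ} (hf : Measurable f)
    (hg : Measurable g) (hf2 : MemLp f 2 m) (hg2 : MemLp g 2 m')
    (hmean : ∫ x, g x ∂m' = ∫ x, f x ∂m) {Td Tn : ℕ → ℕ} (hTd : Tendsto Td atTop atTop)
    (hTn : Tendsto Tn atTop atTop) {ν : ℝ} (hν : 0 < ν)
    (hratio : Tendsto (fun k => (Tn k : ℝ) / (Td k : ℝ)) atTop (𝓝 ν)) :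
    Tendsto (fun k => charFun (P.map fun ω => √(Td k : ℝ) *
      (empMean (Tn k) (fun i => η i ω) g - empMean (Td k) (fun i => ξ i ω) f)) 1) atTop
      (𝓝 (Complex.exp (-(((Var[f; m] + Var[g; m'] / ν) / 2 : ℝ) : ℂ)))) := by
  have hindξ : iIndepFun ξ P := hind.precomp (g := Sum.inl) Sum.inl_injective
  have hindη : iIndepFun η P := hind.precomp (g := Sum.inr) Sum.inr_injective
  have hc : Tendsto (fun k => √((Td k : ℝ) / (Tn k : ℝ))) atTop (𝓝 √(ν⁻¹)) := by
    refine (Real.continuous_sqrt.tendsto _).comp ((hratio.inv₀ hν.ne').congr fun k => ?_)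
    rw [inv_div]
  have h1 := tendsto_charFun_normalized_sum hξ hindξ hf hf2 hTd
    (tendsto_const_nhds (x := (-1 : ℝ))) 1
  have h2 := tendsto_charFun_normalized_sum hη hindη hg hg2 hTn hc 1
  have h3 := h2.mul h1
  rw [← Complex.exp_add] at h3
  have e : (-((Var[g; m'] * √(ν⁻¹) ^ 2 * 1 ^ 2 / 2 : ℝ) : ℂ)) +
      (-((Var[f; m] * (-1) ^ 2 * 1 ^ 2 / 2 : ℝ) : ℂ)) =
      -(((Var[f; m] + Var[g; m'] / ν) / 2 : ℝ) : ℂ) := by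
    rw [Real.sq_sqrt (inv_nonneg.2 hν.le), ← Complex.ofReal_neg, ← Complex.ofReal_neg,
      ← Complex.ofReal_neg, ← Complex.ofReal_add]
    congr 1
    ring
  rw [e] at h3
  refine h3.congr' ?_
  filter_upwards [hTd.eventually_gt_atTop 0, hTn.eventually_gt_atTop 0] with k hk hk'
  have hsξ : AEMeasurable (fun ω => ∑ i ∈ Finset.range (Td k), f (ξ i ω)) P :=
    Finset.aemeasurable_fun_sum _ fun i _ => hf.comp_aemeasurable (hξ i).aemeasurable
  have hsη : AEMeasurable (fun ω => ∑ i ∈ Finset.range (Tn k), g (η i ω)) P :=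
    Finset.aemeasurable_fun_sum _ fun i _ => hg.comp_aemeasurable (hη i).aemeasurable
  have hI := (indepFun_sample_sums hξ hη hind hf hg (Td k) (Tn k)).symm.comp
    (φ := fun y => √((Td k : ℝ) / (Tn k : ℝ)) *
      ((√(Tn k : ℝ))⁻¹ * (y - Tn k * ∫ x, g x ∂m')))
    (ψ := fun y => (-1) * ((√(Td k : ℝ))⁻¹ * (y - Td k * ∫ x, f x ∂m)))
    (by fun_prop) (by fun_prop)
  have h4 := congrFun (hI.charFun_map_fun_add_eq_mul (by
    exact ((hsη.sub_const _).const_mul _).const_mul _) (by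
    exact ((hsξ.sub_const _).const_mul _).const_mul _)) 1
  simp only [Pi.mul_apply] at h4
  refine h4.symm.trans ?_
  congr 2
  ext ω
  have hTd0 : (0 : ℝ) < Td k := by exact_mod_cast hk
  have hTn0 : (0 : ℝ) < Tn k := by exact_mod_cast hk'
  simp only [Function.comp_apply, empMean, smul_eq_mul, hmean]
  rw [Real.sqrt_div hTd0.le]
  have s1 := Real.sq_sqrt hTd0.le
  have s2 := Real.sq_sqrt hTn0.le
  have p1 := Real.sqrt_pos.2 hTd0
  have p2 := Real.sqrt_pos.2 hTn0
  set a := √(Td k : ℝ)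
  set b := √(Tn k : ℝ)
  rw [← s1, ← s2]
  field_simp
  ring

variable {ι : Type*} [Fintype ι] [DecidableEq ι]

/-- Cramér-Wold: the characteristic function at `t` is the scalar one at `1` for the projections on
`t`, and pointwise convergence of characteristic functions gives convergence in distribution. -/
theorem tendstoInDistribution_two_sample (hξ : ∀ i, HasLaw (ξ i) m P)
    (hη : ∀ i, HasLaw (η i) m' P)
    (hind : iIndepFun (fun s : ℕ ⊕ ℕ => Sum.elim ξ η s) P) {a b : X → EuclideanSpace ℝ ι}
    (ha : Measurable a) (hb : Measurable b)
    (ha2 : ∀ t, MemLp (fun x => inner ℝ (a x) t) 2 m)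
    (hb2 : ∀ t, MemLp (fun x => inner ℝ (b x) t) 2 m')
    (hmean : ∀ t, ∫ x, inner ℝ (b x) t ∂m' = ∫ x, inner ℝ (a x) t ∂m) {Td Tn : ℕ → ℕ}
    (hTd : Tendsto Td atTop atTop)
    (hTn : Tendsto Tn atTop atTop) {ν : ℝ} (hν : 0 < ν)
    (hratio : Tendsto (fun k => (Tn k : ℝ) / (Td k : ℝ)) atTop (𝓝 ν))
    {V : Matrix ι ι ℝ} (hV : V.PosSemidef)
    (hVar : ∀ t, quadForm V t =
      Var[fun x => inner ℝ (a x) t; m] + Var[fun x => inner ℝ (b x) t; m'] / ν) :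
    TendstoInDistribution (fun k ω => √(Td k : ℝ) •
      (empMean (Tn k) (fun i => η i ω) b - empMean (Td k) (fun i => ξ i ω) a)) atTop
      id (fun _ => P) (multivariateGaussian 0 V) where
  forall_aemeasurable k :=
    ((aemeasurable_empMean hη hb (Tn k)).sub
      (aemeasurable_empMean hξ ha (Td k))).const_smul √(Td k : ℝ)
  tendsto := by
    refine ProbabilityMeasure.tendsto_iff_tendsto_charFun.2 fun t => ?_
    have h := tendsto_charFun_two_sample hξ hη hind (f := fun x => inner ℝ (a x) t)
      (g := fun x => inner ℝ (b x) t) (ha.inner measurable_const) (hb.inner measurable_const)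
      (ha2 t) (hb2 t) (hmean t) hTd hTn hν hratio
    simp only [ProbabilityMeasure.coe_mk, Measure.map_id]
    rw [charFun_multivariateGaussian hV]
    have e : Complex.exp (((inner ℝ t (0 : EuclideanSpace ℝ ι) : ℝ) : ℂ) * Complex.I -
        ((t ⬝ᵥ V *ᵥ t : ℝ) : ℂ) / 2) = Complex.exp (-(((Var[fun x => inner ℝ (a x) t; m] +
          Var[fun x => inner ℝ (b x) t; m'] / ν) / 2 : ℝ) : ℂ)) := by
      rw [← hVar t]
      simp [quadForm]
    rw [e]
    refine h.congr fun k => ?_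
    have hm : AEMeasurable (fun ω => √(Td k : ℝ) •
      (empMean (Tn k) (fun i => η i ω) b - empMean (Td k) (fun i => ξ i ω) a)) P :=
      ((aemeasurable_empMean hη hb (Tn k)).sub
      (aemeasurable_empMean hξ ha (Td k))).const_smul √(Td k : ℝ)
    have hm' : AEMeasurable (fun ω => √(Td k : ℝ) *
      (empMean (Tn k) (fun i => η i ω) (fun x => inner ℝ (b x) t) -
        empMean (Td k) (fun i => ξ i ω) fun x => inner ℝ (a x) t)) P :=
      ((aemeasurable_empMean hη (hb.inner measurable_const) _).sub
        (aemeasurable_empMean hξ (ha.inner measurable_const) _)).const_mul _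
    rw [charFun_apply, charFun_apply, integral_map hm' (by fun_prop),
      integral_map hm (by fun_prop)]
    refine integral_congr_ae (Eventually.of_forall fun ω => ?_)
    simp only [real_inner_smul_left, inner_sub_left, inner_empMean]
    simp

end CLT

/-! ### Integration against a density, and derivatives of the logistic loss -/

section Density

variable {X : Type*} [MeasurableSpace X] {μ : Measure X} {f : X → ℝ}

theorem integrable_withDensity_ofReal_iff (hf : Measurable f) (hf0 : ∀ x, 0 ≤ f x) {φ : X → ℝ} :
    Integrable φ (μ.withDensity fun x => ENNReal.ofReal (f x)) ↔
      Integrable (fun x => φ x * f x) μ := by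
  rw [integrable_withDensity_iff hf.ennreal_ofReal
    (Eventually.of_forall fun _ => ENNReal.ofReal_lt_top)]
  simp only [ENNReal.toReal_ofReal (hf0 _)]

theorem integral_withDensity_ofReal (hf : Measurable f) (hf0 : ∀ x, 0 ≤ f x) (φ : X → ℝ) :
    ∫ x, φ x ∂(μ.withDensity fun x => ENNReal.ofReal (f x)) = ∫ x, φ x * f x ∂μ := by
  rw [integral_withDensity_eq_integral_toReal_smul hf.ennreal_ofReal
    (Eventually.of_forall fun _ => ENNReal.ofReal_lt_top)]
  simp only [ENNReal.toReal_ofReal (hf0 _), smul_eq_mul, mul_comm]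

end Density

section Sigmoid

theorem hasDerivAt_neg_log_sigmoid (t : ℝ) :
    HasDerivAt (fun t => -Real.log (Real.sigmoid t)) (-(1 - Real.sigmoid t)) t := by
  have h := ((Real.hasDerivAt_sigmoid t).log (Real.sigmoid_pos t).ne').neg
  refine h.congr_deriv ?_
  rw [mul_div_cancel_left₀ _ (Real.sigmoid_pos t).ne']

theorem hasDerivAt_neg_log_sigmoid_sub (c t : ℝ) :
    HasDerivAt (fun t => -Real.log (Real.sigmoid (t - c))) (-(1 - Real.sigmoid (t - c))) t := by
  simpa using (hasDerivAt_neg_log_sigmoid (t - c)).comp_sub_const t c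

theorem hasDerivAt_sigmoid_sub (c t : ℝ) :
    HasDerivAt (fun t => Real.sigmoid (t - c))
      (Real.sigmoid (t - c) * (1 - Real.sigmoid (t - c))) t := by
  simpa using (Real.hasDerivAt_sigmoid (t - c)).comp_sub_const t c

theorem hasDerivAt_neg_one_sub_sigmoid_sub (c t : ℝ) :
    HasDerivAt (fun t => -(1 - Real.sigmoid (t - c)))
      (Real.sigmoid (t - c) * (1 - Real.sigmoid (t - c))) t :=
  ((hasDerivAt_sigmoid_sub c t).const_sub 1).neg.congr_deriv (neg_neg _)

theorem hasDerivAt_neg_log_sigmoid_neg_sub (c t : ℝ) :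
    HasDerivAt (fun t => -Real.log (Real.sigmoid (-(t - c)))) (Real.sigmoid (t - c)) t := by
  have h1 : HasDerivAt (fun t => -(t - c)) (-1) t := ((hasDerivAt_id t).sub_const c).neg
  refine ((hasDerivAt_neg_log_sigmoid (-(t - c))).comp t h1).congr_deriv ?_
  rw [Real.sigmoid_neg]
  ring

theorem sigmoid_log_sub_log {a b : ℝ} (ha : 0 < a) (hb : 0 < b) :
    Real.sigmoid (Real.log a - Real.log b) = a / (a + b) := by
  rw [Real.sigmoid_def, neg_sub, Real.exp_sub, Real.exp_log ha, Real.exp_log hb]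
  field_simp

end Sigmoid

/-- The weight `1 - w` at the points that noise can reach. -/
def noiseWeight {X : Type*} (pd pn : X → ℝ) (ν : ℝ) (x : X) : ℝ :=
  if pn x = 0 then 0 else 1 - misclass pd pn ν x

section NoiseWeight

variable {X : Type*} {pd pn : X → ℝ} {ν : ℝ} {x : X}

theorem noiseWeight_mem (hd : 0 ≤ pd x) (hn : 0 ≤ pn x) (hν : 0 < ν) :
    0 ≤ noiseWeight pd pn ν x ∧ noiseWeight pd pn ν x ≤ 1 := by
  have := misclass_mem hd hn hν
  unfold noiseWeight
  split_ifs
  · simp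
  · constructor <;> linarith

theorem noiseWeight_mul (hd : 0 ≤ pd x) (hn : 0 ≤ pn x) (hν : 0 < ν) :
    noiseWeight pd pn ν x * pn x = misclass pd pn ν x / ν * pd x := by
  have h := one_sub_misclass_mul hd hn hν
  unfold noiseWeight
  split_ifs with h0
  · simp [misclass, h0]
  · rw [div_mul_eq_mul_div, eq_div_iff hν.ne', ← h]
    ring

/-- The two weights add up to `1` except where `pₙ = 0`, and there `w = 0`. -/
theorem misclass_mul_noiseWeight_add :
    misclass pd pn ν x * (noiseWeight pd pn ν x + misclass pd pn ν x) = misclass pd pn ν x := by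
  unfold noiseWeight
  split_ifs with h0
  · simp [misclass, h0]
  · ring

theorem measurable_noiseWeight [MeasurableSpace X] (hd : Measurable pd) (hn : Measurable pn)
    (ν : ℝ) : Measurable (noiseWeight pd pn ν) :=
  Measurable.ite (hn (measurableSet_singleton 0)) measurable_const
    ((measurable_misclass hd hn ν).const_sub 1)

end NoiseWeight

/-- The Hessian of the log-density. -/
def hessLog {X ι : Type*} [Fintype ι] [DecidableEq ι] (p : EuclideanSpace ℝ ι → X → ℝ)
    (β₀ : EuclideanSpace ℝ ι) (x : X) : Matrix ι ι ℝ :=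
  Matrix.of fun i j => fderiv ℝ (fderiv ℝ fun β => Real.log (p β x)) β₀
    (EuclideanSpace.single i 1) (EuclideanSpace.single j 1)

/-- The ball on which the log-densities are smooth, with a dominating function. -/
structure IsSmoothOn {X ι : Type*} [MeasurableSpace X] [Fintype ι] (μ : Measure X)
    (p : EuclideanSpace ℝ ι → X → ℝ) (Θ : Set (EuclideanSpace ℝ ι)) (β₀ : EuclideanSpace ℝ ι)
    (r : ℝ) (G : X → ℝ) : Prop where
  pos : 0 < r
  subset : Metric.ball β₀ r ⊆ Θ
  contDiffOn : ∀ x, ContDiffOn ℝ 2 (fun β => Real.log (p β x)) (Metric.ball β₀ r)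
  integrable : Integrable G μ
  bound : ∀ β ∈ Metric.ball β₀ r, ∀ x,
    (p β₀ x + p β x) * (‖fderiv ℝ (fun b => Real.log (p b x)) β‖ ^ 2 +
      ‖fderiv ℝ (fderiv ℝ fun b => Real.log (p b x)) β‖) ≤ G x

/-! ### The Hessian of the log-density -/

namespace RegularModel

variable {X : Type*} [MeasurableSpace X] {μ : Measure X}
  {ι : Type*} [Fintype ι] [DecidableEq ι]
  {p : EuclideanSpace ℝ ι → X → ℝ} {Θ : Set (EuclideanSpace ℝ ι)} {β₀ : EuclideanSpace ℝ ι}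
  {pn : X → ℝ} {ν r : ℝ} {G : X → ℝ}

theorem exists_isSmoothOn (hreg : RegularModel μ p Θ β₀) : ∃ r G, IsSmoothOn μ p Θ β₀ r G := by
  obtain ⟨r, hr, hsub, hC, G, hG, hb⟩ := hreg.smooth
  exact ⟨r, G, hr, hsub, hC, hG, hb⟩

theorem quadForm_hessLog (x : X) (h : EuclideanSpace ℝ ι) :
    quadForm (hessLog p β₀ x) h =
      fderiv ℝ (fderiv ℝ fun β => Real.log (p β x)) β₀ h h := by
  set B := fderiv ℝ (fderiv ℝ fun β => Real.log (p β x)) β₀ with hB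
  have hsum : h = ∑ i, h i • EuclideanSpace.single i (1 : ℝ) := by
    ext j
    simp [Finset.sum_apply, Pi.single_apply]
  have h1 : ∀ v w : EuclideanSpace ℝ ι, B v w =
      ∑ i, ∑ j, v i * (w j * B (EuclideanSpace.single i 1) (EuclideanSpace.single j 1)) := by
    intro v w
    have hv : v = ∑ i, v i • EuclideanSpace.single i (1 : ℝ) := by
      ext j
      simp [Finset.sum_apply, Pi.single_apply]
    have hw : w = ∑ i, w i • EuclideanSpace.single i (1 : ℝ) := by
      ext j
      simp [Finset.sum_apply, Pi.single_apply]
    conv_lhs => rw [hv, hw]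
    simp only [map_sum, map_smul, _root_.sum_apply, _root_.smul_apply,
      smul_eq_mul, Finset.mul_sum]
    rw [Finset.sum_comm]
    refine Finset.sum_congr rfl fun i _ => Finset.sum_congr rfl fun j _ => ?_
    ring
  rw [h1, quadForm_eq_sum]
  refine Finset.sum_congr rfl fun i _ => Finset.sum_congr rfl fun j _ => ?_
  simp only [hessLog, of_apply, ← hB]
  ring

theorem abs_hessLog_le (x : X) (i j : ι) : |hessLog p β₀ x i j| ≤
    ‖fderiv ℝ (fderiv ℝ fun β => Real.log (p β x)) β₀‖ := by
  have := ContinuousLinearMap.le_opNorm₂ (fderiv ℝ (fderiv ℝ fun β => Real.log (p β x)) β₀)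
    (EuclideanSpace.single i 1) (EuclideanSpace.single j 1)
  simpa [hessLog] using this

theorem measurable_hessLog (hreg : RegularModel μ p Θ β₀) (i j : ι) :
    Measurable fun x => hessLog p β₀ x i j := by
  obtain ⟨r, G, hs⟩ := hreg.exists_isSmoothOn
  have hC : ∀ x, ∀ β ∈ Metric.ball β₀ r, ContDiffAt ℝ 2 (fun β => Real.log (p β x)) β :=
    fun x β hβ => (hs.contDiffOn x).contDiffAt (Metric.isOpen_ball.mem_nhds hβ)
  have hb := Metric.mem_ball_self (x := β₀) hs.pos
  have hd : ∀ x, DifferentiableAt ℝ (fderiv ℝ fun β => Real.log (p β x)) β₀ := fun x =>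
    ((hC x β₀ hb).fderiv_right (m := 1) (by norm_num)).differentiableAt (by norm_num)
  have h := measurable_fderiv_apply_of_measurable
    (F := fun β x => fderiv ℝ (fun β => Real.log (p β x)) β (EuclideanSpace.single j 1))
    (U := Metric.ball β₀ r) (b := β₀) Metric.isOpen_ball (fun β hβ =>
      measurable_fderiv_apply_of_measurable (F := fun β x => Real.log (p β x)) isOpen_univ
        (fun β _ => hreg.measurable_log β) (Set.mem_univ _)
        (fun x => (hC x β hβ).differentiableAt (by norm_num)) _) hb
    (fun x => (hd x).clm_apply (differentiableAt_const _)) (EuclideanSpace.single i 1)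
  convert h using 2 with x
  rw [fderiv_clm_apply (hd x) (differentiableAt_const _)]
  simp [hessLog]

theorem integrable_hess_mul_data (hreg : RegularModel μ p Θ β₀) {a c : X → ℝ} {C : ℝ}
    (ha : Measurable a) (hc : Measurable c)
    (ha1 : ∀ x, |a x| ≤ C) (hc1 : ∀ x, |c x| ≤ C) (i j : ι) :
    Integrable (fun x => (a x * (score p β₀ x i * score p β₀ x j) + c x * hessLog p β₀ x i j) *
      p β₀ x) μ := by
  obtain ⟨r, G, hs⟩ := hreg.exists_isSmoothOn
  simp only [add_mul]
  refine (hreg.integrable_score_mul_score ha ha1 i j).add ?_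
  refine (hs.integrable.const_mul C).mono' ((hc.mul (hreg.measurable_hessLog i j)).mul
    (hreg.measurable_apply β₀)).aestronglyMeasurable (Eventually.of_forall fun x => ?_)
  have h1 := hs.bound β₀ (Metric.mem_ball_self hs.pos) x
  have h2 := abs_hessLog_le (p := p) (β₀ := β₀) x i j
  have h0 := hreg.data_nonneg x
  rw [norm_mul, norm_mul, Real.norm_of_nonneg h0, mul_assoc, Real.norm_eq_abs, Real.norm_eq_abs]
  refine mul_le_mul (hc1 x) ?_ (by positivity) ((abs_nonneg _).trans (hc1 x))
  refine le_trans ?_ h1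
  nlinarith [mul_nonneg h0 (sq_nonneg ‖fderiv ℝ (fun b => Real.log (p b x)) β₀‖),
    mul_le_mul_of_nonneg_left h2 h0, mul_nonneg h0 (abs_nonneg (hessLog p β₀ x i j))]

end RegularModel

/-! ### Expansion of the logistic loss at a point -/

namespace IsSmoothOn

variable {X : Type*} [MeasurableSpace X] {μ : Measure X}
  {ι : Type*} [Fintype ι] [DecidableEq ι]
  {p : EuclideanSpace ℝ ι → X → ℝ} {Θ : Set (EuclideanSpace ℝ ι)} {β₀ : EuclideanSpace ℝ ι}
  {pn : X → ℝ} {ν r : ℝ} {G : X → ℝ}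

theorem mem_of_norm_lt (hs : IsSmoothOn μ p Θ β₀ r G) {h : EuclideanSpace ℝ ι} (hh : ‖h‖ < r) :
    β₀ + h ∈ Θ := hs.subset (by simpa using hh)

theorem bound_nonneg (hs : IsSmoothOn μ p Θ β₀ r G) (hreg : RegularModel μ p Θ β₀) (x : X) :
    0 ≤ G x :=
  (mul_nonneg (add_nonneg (hreg.data_nonneg x) (hreg.data_nonneg x))
    (add_nonneg (sq_nonneg _) (norm_nonneg
      (fderiv ℝ (fderiv ℝ fun b => Real.log (p b x)) β₀)))).trans
    (hs.bound β₀ (Metric.mem_ball_self hs.pos) x)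

theorem pos_of_ne (hs : IsSmoothOn μ p Θ β₀ r G) (hreg : RegularModel μ p Θ β₀) {x : X}
    (hx : p β₀ x ≠ 0) {β : EuclideanSpace ℝ ι} (hβ : β ∈ Metric.ball β₀ r) : 0 < p β x :=
  lt_of_le_of_ne (hreg.nonneg β (hs.subset hβ) x)
    (Ne.symm fun h => hx ((hreg.support β (hs.subset hβ) x).1 h))

/-- Expansions of a smooth function of the log-density. -/
theorem taylor (hs : IsSmoothOn μ p Θ β₀ r G) {x : X} {K : ℝ} {Ψ Ψ₁ Ψ₂ : ℝ → ℝ}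
    (hΨ : ∀ t, HasDerivAt Ψ (Ψ₁ t) t) (hΨ₁ : ∀ t, HasDerivAt Ψ₁ (Ψ₂ t) t) (hK : 0 ≤ K)
    (hK₁ : ∀ β ∈ Metric.ball β₀ r, |Ψ₁ (Real.log (p β x))| ≤ K * (p β₀ x + p β x))
    (hK₂ : ∀ β ∈ Metric.ball β₀ r, |Ψ₂ (Real.log (p β x))| ≤ K * (p β₀ x + p β x)) :
    (∀ h, ‖h‖ < r →
      |Ψ (Real.log (p (β₀ + h) x)) - Ψ (Real.log (p β₀ x)) -
        Ψ₁ (Real.log (p β₀ x)) * inner ℝ (score p β₀ x) h| ≤ (2 * (K * G x)) * ‖h‖ ^ 2) ∧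
    (fun h => Ψ (Real.log (p (β₀ + h) x)) - Ψ (Real.log (p β₀ x)) -
        Ψ₁ (Real.log (p β₀ x)) * inner ℝ (score p β₀ x) h
      - (Ψ₂ (Real.log (p β₀ x)) * (inner ℝ (score p β₀ x) h) ^ 2 +
          Ψ₁ (Real.log (p β₀ x)) * quadForm (hessLog p β₀ x) h) / 2)
      =o[𝓝 0] fun h => ‖h‖ ^ 2 := by
  have key : ∀ {s : ℝ} {β : EuclideanSpace ℝ ι}, β ∈ Metric.ball β₀ r →
      |s| ≤ K * (p β₀ x + p β x) →
      |s| * (‖fderiv ℝ (fun b => Real.log (p b x)) β‖ ^ 2 +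
        ‖fderiv ℝ (fderiv ℝ fun b => Real.log (p b x)) β‖) ≤ K * G x := fun {s β} hβ hle => by
    refine (mul_le_mul_of_nonneg_right hle (add_nonneg (sq_nonneg _) (norm_nonneg
      (fderiv ℝ (fderiv ℝ fun b => Real.log (p b x)) β)))).trans ?_
    rw [mul_assoc]
    exact mul_le_mul_of_nonneg_left (hs.bound β hβ x) hK
  have := taylor_comp hs.pos (hs.contDiffOn x) hΨ hΨ₁ (fun β hβ => key hβ (hK₁ β hβ))
    (fun β hβ => key hβ (hK₂ β hβ))
  simpa only [RegularModel.fderiv_apply, RegularModel.quadForm_hessLog] using this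

theorem log_eq_zero (hs : IsSmoothOn μ p Θ β₀ r G) (hreg : RegularModel μ p Θ β₀) {x : X}
    (hx : p β₀ x = 0) : (fun β => Real.log (p β x)) =ᶠ[𝓝 β₀] fun _ => 0 := by
  filter_upwards [Metric.ball_mem_nhds β₀ hs.pos] with β hβ
  rw [(hreg.support β (hs.subset hβ) x).2 hx, Real.log_zero]

theorem score_eq_zero (hs : IsSmoothOn μ p Θ β₀ r G) (hreg : RegularModel μ p Θ β₀) {x : X}
    (hx : p β₀ x = 0) : score p β₀ x = 0 := by
  rw [score, (hs.log_eq_zero hreg hx).gradient_eq]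
  simp

theorem hessLog_eq_zero (hs : IsSmoothOn μ p Θ β₀ r G) (hreg : RegularModel μ p Θ β₀) {x : X}
    (hx : p β₀ x = 0) : hessLog p β₀ x = 0 := by
  have h := (hs.log_eq_zero hreg hx).fderiv (𝕜 := ℝ)
  ext i j
  rw [hessLog, of_apply, h.fderiv_eq]
  simp

theorem classifier_eq (hs : IsSmoothOn μ p Θ β₀ r G) (hreg : RegularModel μ p Θ β₀) {x : X}
    (hx : p β₀ x ≠ 0) (hn : 0 < pn x) (hν : 0 < ν) {β : EuclideanSpace ℝ ι}
    (hβ : β ∈ Metric.ball β₀ r) :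
    classifier p pn ν β x = Real.log (p β x) - Real.log (ν * pn x) :=
  Real.log_div (hs.pos_of_ne hreg hx hβ).ne' (by positivity)

theorem sigmoid_eq (hs : IsSmoothOn μ p Θ β₀ r G) (hreg : RegularModel μ p Θ β₀) {x : X}
    (hx : p β₀ x ≠ 0) (hn : 0 < pn x) (hν : 0 < ν) {β : EuclideanSpace ℝ ι}
    (hβ : β ∈ Metric.ball β₀ r) :
    Real.sigmoid (Real.log (p β x) - Real.log (ν * pn x)) = p β x / (p β x + ν * pn x) :=
  sigmoid_log_sub_log (hs.pos_of_ne hreg hx hβ) (by positivity)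

theorem sigmoid_eq_noiseWeight (hs : IsSmoothOn μ p Θ β₀ r G) (hreg : RegularModel μ p Θ β₀)
    {x : X} (hx : p β₀ x ≠ 0) (hn : 0 < pn x) (hν : 0 < ν) :
    Real.sigmoid (Real.log (p β₀ x) - Real.log (ν * pn x)) = noiseWeight (p β₀) pn ν x ∧
    1 - Real.sigmoid (Real.log (p β₀ x) - Real.log (ν * pn x)) = misclass (p β₀) pn ν x := by
  have hb := Metric.mem_ball_self (x := β₀) hs.pos
  have hp := hs.pos_of_ne hreg hx hb
  rw [hs.sigmoid_eq hreg hx hn hν hb, noiseWeight, if_neg hn.ne', misclass]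
  have : 0 < p β₀ x + ν * pn x := by positivity
  constructor <;> · field_simp; ring

/-- With the conventions `x / 0 = 0` and `log 0 = 0`, the classifier does not depend on `β` at such
points. The loss is constant there, in accordance with a vanishing score or vanishing weights `w`
and `noiseWeight`. -/
theorem classifier_eq_zero (hs : IsSmoothOn μ p Θ β₀ r G) (hreg : RegularModel μ p Θ β₀) {x : X}
    (hx : p β₀ x = 0 ∨ pn x = 0) {β : EuclideanSpace ℝ ι} (hβ : β ∈ Metric.ball β₀ r) :
    classifier p pn ν β x = 0 := by
  rcases hx with hx | hx
  · simp [classifier, (hreg.support β (hs.subset hβ) x).2 hx]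
  · simp [classifier, hx]

theorem measurable_classifier (hreg : RegularModel μ p Θ β₀) (hn : IsNoise μ p β₀ pn)
    (β : EuclideanSpace ℝ ι) : Measurable (classifier p pn ν β) :=
  ((hreg.measurable_apply β).div (hn.measurable.const_mul ν)).log

theorem continuousOn_classifier (hs : IsSmoothOn μ p Θ β₀ r G) (hreg : RegularModel μ p Θ β₀)
    (hn : IsNoise μ p β₀ pn) (hν : 0 < ν) (x : X) :
    ContinuousOn (fun h => classifier p pn ν (β₀ + h) x) (Metric.ball 0 r) := by
  have hmem : Set.MapsTo (fun h => β₀ + h) (Metric.ball (0 : EuclideanSpace ℝ ι) r)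
      (Metric.ball β₀ r) := fun h hh => by simpa using hh
  by_cases hx : p β₀ x = 0 ∨ pn x = 0
  · exact (continuousOn_const (c := (0 : ℝ))).congr fun h hh =>
      hs.classifier_eq_zero hreg hx (hmem hh)
  · rw [not_or] at hx
    have hpn : 0 < pn x := lt_of_le_of_ne (hn.nonneg x) (Ne.symm hx.2)
    have h1 : ContinuousOn (fun h => Real.log (p (β₀ + h) x)) (Metric.ball 0 r) :=
      (hs.contDiffOn x).continuousOn.comp (by fun_prop) hmem
    exact (h1.sub continuousOn_const).congr fun h hh =>
      hs.classifier_eq hreg hx.1 hpn hν (hmem hh)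

/-- Second order expansion of the loss at a data point. -/
theorem quadExpansion_data (hs : IsSmoothOn μ p Θ β₀ r G) (hreg : RegularModel μ p Θ β₀)
    (hn : IsNoise μ p β₀ pn) (hν : 0 < ν) :
    QuadExpansion (μ.withDensity fun x => ENNReal.ofReal (p β₀ x)) r
      (fun h x => -Real.log (Real.sigmoid (classifier p pn ν (β₀ + h) x)))
      (fun x => -(misclass (p β₀) pn ν x • score p β₀ x))
      (fun x => Matrix.of fun i j =>
        misclass (p β₀) pn ν x * noiseWeight (p β₀) pn ν x * (score p β₀ x i * score p β₀ x j) +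
          -misclass (p β₀) pn ν x * hessLog p β₀ x i j) := by
  have hw := measurable_misclass (hreg.measurable_apply β₀) hn.measurable ν
  have hnw := measurable_noiseWeight (hreg.measurable_apply β₀) hn.measurable ν
  have hb := Metric.mem_ball_self (x := β₀) hs.pos
  have hquad : ∀ x h, quadForm (Matrix.of fun i j =>
        misclass (p β₀) pn ν x * noiseWeight (p β₀) pn ν x * (score p β₀ x i * score p β₀ x j) +
          -misclass (p β₀) pn ν x * hessLog p β₀ x i j) h =
      misclass (p β₀) pn ν x * noiseWeight (p β₀) pn ν x * inner ℝ (score p β₀ x) h ^ 2 +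
        -misclass (p β₀) pn ν x * quadForm (hessLog p β₀ x) h := fun x h => by
    rw [pow_two, PiLp.inner_apply, Finset.sum_mul_sum, quadForm_eq_sum, quadForm_eq_sum,
      Finset.mul_sum, Finset.mul_sum, ← Finset.sum_add_distrib]
    refine Finset.sum_congr rfl fun i _ => ?_
    rw [Finset.mul_sum, Finset.mul_sum, ← Finset.sum_add_distrib]
    refine Finset.sum_congr rfl fun j _ => ?_
    simp
    ring
  have hmain : ∀ x,
      (∀ h, ‖h‖ < r → |-Real.log (Real.sigmoid (classifier p pn ν (β₀ + h) x)) -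
        -Real.log (Real.sigmoid (classifier p pn ν (β₀ + 0) x)) -
        inner ℝ (-(misclass (p β₀) pn ν x • score p β₀ x)) h| ≤
          2 * ((p β₀ x)⁻¹ * G x) * ‖h‖ ^ 2) ∧
      (fun h => -Real.log (Real.sigmoid (classifier p pn ν (β₀ + h) x)) -
        -Real.log (Real.sigmoid (classifier p pn ν (β₀ + 0) x)) -
        inner ℝ (-(misclass (p β₀) pn ν x • score p β₀ x)) h -
        (misclass (p β₀) pn ν x * noiseWeight (p β₀) pn ν x * inner ℝ (score p β₀ x) h ^ 2 +
        -misclass (p β₀) pn ν x * quadForm (hessLog p β₀ x) h) / 2) =o[𝓝 0]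
          fun h => ‖h‖ ^ 2 := by
    intro x
    have hG0 := hs.bound_nonneg hreg x
    have hp0 := hreg.data_nonneg x
    by_cases hx : p β₀ x = 0 ∨ pn x = 0
    · have hz : ∀ h : EuclideanSpace ℝ ι,
          inner ℝ (-(misclass (p β₀) pn ν x • score p β₀ x)) h = 0 := fun h => by
        rcases hx with hx | hx
        · simp [hs.score_eq_zero hreg hx]
        · simp [misclass, hx]
      have hz2 : ∀ h : EuclideanSpace ℝ ι,
          (misclass (p β₀) pn ν x * noiseWeight (p β₀) pn ν x * inner ℝ (score p β₀ x) h ^ 2 +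
        -misclass (p β₀) pn ν x * quadForm (hessLog p β₀ x) h) / 2 = 0 := fun h => by
        rcases hx with hx | hx
        · simp [hs.score_eq_zero hreg hx, hs.hessLog_eq_zero hreg hx, quadForm_eq_sum]
        · simp [misclass, hx]
      have hc : ∀ h : EuclideanSpace ℝ ι, ‖h‖ < r →
          -Real.log (Real.sigmoid (classifier p pn ν (β₀ + h) x)) -
        -Real.log (Real.sigmoid (classifier p pn ν (β₀ + 0) x)) = 0 := fun h hh => by
        rw [hs.classifier_eq_zero hreg hx (by simpa using hh), add_zero,
          hs.classifier_eq_zero hreg hx hb, sub_self]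
      refine ⟨fun h hh => ?_, ?_⟩
      · rw [hc h hh, hz, sub_self, abs_zero]
        positivity
      · refine (Asymptotics.isLittleO_zero _ _).congr' ?_ EventuallyEq.rfl
        filter_upwards [Metric.ball_mem_nhds (0 : EuclideanSpace ℝ ι) hs.pos] with h hh
        rw [hc h (by simpa using hh), hz, hz2]
        simp
    · rw [not_or] at hx
      have hpn : 0 < pn x := lt_of_le_of_ne (hn.nonneg x) (Ne.symm hx.2)
      have hpd : 0 < p β₀ x := hs.pos_of_ne hreg hx.1 hb
      obtain ⟨e1, e2⟩ := hs.sigmoid_eq_noiseWeight hreg hx.1 hpn hν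
      -- The derivatives of the loss are bounded by `1`, and `1 ≤ (p_d + p_β) / p_d`. The factor `1
      -- / p_d` cancels on integration against the data density, leaving the dominating function
      -- `G`.
      have hK : ∀ β ∈ Metric.ball β₀ r, 1 ≤ (p β₀ x)⁻¹ * (p β₀ x + p β x) := fun β hβ => by
        have := hs.pos_of_ne hreg hx.1 hβ
        rw [← div_eq_inv_mul, le_div_iff₀ hpd]
        linarith
      have ht := hs.taylor (x := x) (K := (p β₀ x)⁻¹)
        (hasDerivAt_neg_log_sigmoid_sub (Real.log (ν * pn x)))
        (hasDerivAt_neg_one_sub_sigmoid_sub (Real.log (ν * pn x))) (by positivity)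
        (fun β hβ => (by
          have h1 := Real.sigmoid_pos (Real.log (p β x) - Real.log (ν * pn x))
          have h2 := Real.sigmoid_lt_one (Real.log (p β x) - Real.log (ν * pn x))
          rw [abs_neg, abs_of_pos (by linarith)]
          linarith [hK β hβ]))
        (fun β hβ => (by
          have h1 := Real.sigmoid_pos (Real.log (p β x) - Real.log (ν * pn x))
          have h2 := Real.sigmoid_lt_one (Real.log (p β x) - Real.log (ν * pn x))
          rw [abs_of_pos (mul_pos h1 (by linarith))]
          nlinarith [hK β hβ]))
      have hinner : ∀ h : EuclideanSpace ℝ ι,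
          inner ℝ (-(misclass (p β₀) pn ν x • score p β₀ x)) h =
            -misclass (p β₀) pn ν x * inner ℝ (score p β₀ x) h := fun h => by
        rw [inner_neg_left, real_inner_smul_left, neg_mul]
      have hcl : ∀ h : EuclideanSpace ℝ ι, ‖h‖ < r → classifier p pn ν (β₀ + h) x =
          Real.log (p (β₀ + h) x) - Real.log (ν * pn x) := fun h hh =>
        hs.classifier_eq hreg hx.1 hpn hν (by simpa using hh)
      have hcl0 : classifier p pn ν (β₀ + 0) x =
          Real.log (p β₀ x) - Real.log (ν * pn x) := by
        rw [hcl 0 (by simpa using hs.pos), add_zero]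
      refine ⟨fun h hh => ?_, ?_⟩
      · rw [hinner, hcl h hh, hcl0, ← e2]
        exact ht.1 h hh
      · refine ht.2.congr' ?_ EventuallyEq.rfl
        filter_upwards [Metric.ball_mem_nhds (0 : EuclideanSpace ℝ ι) hs.pos] with h hh
        rw [hinner, hcl h (by simpa using hh), hcl0, ← e1, ← e2]
        ring
  have hw1 : ∀ x, |misclass (p β₀) pn ν x| ≤ 1 := fun x =>
    abs_misclass_le (hreg.data_nonneg x) (hn.nonneg x) hν
  exact
    { measurable := fun h _ =>
        ((continuous_sigmoid.measurable.comp (measurable_classifier hreg hn _)).log).neg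
      continuousOn := fun x => ((continuous_sigmoid.comp_continuousOn
        (hs.continuousOn_classifier hreg hn hν x)).log fun h _ => (Real.sigmoid_pos _).ne').neg
      measurable_grad := (hw.smul hreg.measurable_score).neg
      measurable_hess := fun i j => ((hw.mul hnw).mul ((hreg.measurable_score_apply i).mul
        (hreg.measurable_score_apply j))).add (hw.neg.mul (hreg.measurable_hessLog i j))
      integrable_hess := fun i j => by
        rw [integrable_withDensity_ofReal_iff (hreg.measurable_apply β₀) hreg.data_nonneg]
        refine hreg.integrable_hess_mul_data (C := 1) (hw.mul hnw) hw.neg (fun x => ?_)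
          (fun x => by rw [Pi.neg_apply, abs_neg]; exact hw1 x) i j
        rw [Pi.mul_apply, abs_mul]
        have := noiseWeight_mem (hreg.data_nonneg x) (hn.nonneg x) hν
        refine mul_le_one₀ (hw1 x) (abs_nonneg _) ?_
        rw [abs_of_nonneg this.1]
        exact this.2
      bound := by
        refine ⟨fun x => 2 * ((p β₀ x)⁻¹ * G x), ?_, fun h x hh => (hmain x).1 h hh⟩
        rw [integrable_withDensity_ofReal_iff (hreg.measurable_apply β₀) hreg.data_nonneg]
        refine (hs.integrable.const_mul 2).mono' ?_ (Eventually.of_forall fun x => ?_)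
        · exact ((((hreg.measurable_apply β₀).inv.aemeasurable.mul
            hs.integrable.aemeasurable).const_mul 2).mul
              (hreg.measurable_apply β₀).aemeasurable).aestronglyMeasurable
        · have hG0 := hs.bound_nonneg hreg x
          have hp0 := hreg.data_nonneg x
          rw [Real.norm_of_nonneg (by positivity)]
          rcases eq_or_ne (p β₀ x) 0 with h | h
          · simp [h, hG0]
          · apply le_of_eq; field_simp
      expansion := fun x => (hmain x).2.congr_left fun h => by rw [hquad] }

/-- Second order expansion of the loss at a noise point. -/
theorem quadExpansion_noise (hs : IsSmoothOn μ p Θ β₀ r G) (hreg : RegularModel μ p Θ β₀)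
    (hn : IsNoise μ p β₀ pn) (hν : 0 < ν) :
    QuadExpansion (μ.withDensity fun x => ENNReal.ofReal (pn x)) r
      (fun h x => -Real.log (Real.sigmoid (-classifier p pn ν (β₀ + h) x)))
      (fun x => noiseWeight (p β₀) pn ν x • score p β₀ x)
      (fun x => Matrix.of fun i j =>
        misclass (p β₀) pn ν x * noiseWeight (p β₀) pn ν x * (score p β₀ x i * score p β₀ x j) +
          noiseWeight (p β₀) pn ν x * hessLog p β₀ x i j) := by
  have hw := measurable_misclass (hreg.measurable_apply β₀) hn.measurable ν
  have hnw := measurable_noiseWeight (hreg.measurable_apply β₀) hn.measurable ν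
  have hb := Metric.mem_ball_self (x := β₀) hs.pos
  have hquad : ∀ x h, quadForm (Matrix.of fun i j =>
        misclass (p β₀) pn ν x * noiseWeight (p β₀) pn ν x * (score p β₀ x i * score p β₀ x j) +
          noiseWeight (p β₀) pn ν x * hessLog p β₀ x i j) h =
      misclass (p β₀) pn ν x * noiseWeight (p β₀) pn ν x * inner ℝ (score p β₀ x) h ^ 2 +
        noiseWeight (p β₀) pn ν x * quadForm (hessLog p β₀ x) h := fun x h => by
    rw [pow_two, PiLp.inner_apply, Finset.sum_mul_sum, quadForm_eq_sum, quadForm_eq_sum,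
      Finset.mul_sum, Finset.mul_sum, ← Finset.sum_add_distrib]
    refine Finset.sum_congr rfl fun i _ => ?_
    rw [Finset.mul_sum, Finset.mul_sum, ← Finset.sum_add_distrib]
    refine Finset.sum_congr rfl fun j _ => ?_
    simp
    ring
  have hmain : ∀ x,
      (∀ h, ‖h‖ < r → |-Real.log (Real.sigmoid (-classifier p pn ν (β₀ + h) x)) -
        -Real.log (Real.sigmoid (-classifier p pn ν (β₀ + 0) x)) -
        inner ℝ (noiseWeight (p β₀) pn ν x • score p β₀ x) h| ≤
          2 * ((ν * pn x)⁻¹ * G x) * ‖h‖ ^ 2) ∧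
      (fun h => -Real.log (Real.sigmoid (-classifier p pn ν (β₀ + h) x)) -
        -Real.log (Real.sigmoid (-classifier p pn ν (β₀ + 0) x)) -
        inner ℝ (noiseWeight (p β₀) pn ν x • score p β₀ x) h -
        (misclass (p β₀) pn ν x * noiseWeight (p β₀) pn ν x * inner ℝ (score p β₀ x) h ^ 2 +
        noiseWeight (p β₀) pn ν x * quadForm (hessLog p β₀ x) h) / 2) =o[𝓝 0]
          fun h => ‖h‖ ^ 2 := by
    intro x
    have hG0 := hs.bound_nonneg hreg x
    have hp0 := hn.nonneg x
    by_cases hx : p β₀ x = 0 ∨ pn x = 0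
    · have hz : ∀ h : EuclideanSpace ℝ ι,
          inner ℝ (noiseWeight (p β₀) pn ν x • score p β₀ x) h = 0 := fun h => by
        rcases hx with hx | hx
        · simp [hs.score_eq_zero hreg hx]
        · simp [noiseWeight, hx]
      have hz2 : ∀ h : EuclideanSpace ℝ ι,
          (misclass (p β₀) pn ν x * noiseWeight (p β₀) pn ν x * inner ℝ (score p β₀ x) h ^ 2 +
        noiseWeight (p β₀) pn ν x * quadForm (hessLog p β₀ x) h) / 2 = 0 := fun h => by
        rcases hx with hx | hx
        · simp [hs.score_eq_zero hreg hx, hs.hessLog_eq_zero hreg hx, quadForm_eq_sum]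
        · simp [noiseWeight, hx]
      have hc : ∀ h : EuclideanSpace ℝ ι, ‖h‖ < r →
          -Real.log (Real.sigmoid (-classifier p pn ν (β₀ + h) x)) -
        -Real.log (Real.sigmoid (-classifier p pn ν (β₀ + 0) x)) = 0 := fun h hh => by
        rw [hs.classifier_eq_zero hreg hx (by simpa using hh), add_zero,
          hs.classifier_eq_zero hreg hx hb, sub_self]
      refine ⟨fun h hh => ?_, ?_⟩
      · rw [hc h hh, hz, sub_self, abs_zero]
        positivity
      · refine (Asymptotics.isLittleO_zero _ _).congr' ?_ EventuallyEq.rfl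
        filter_upwards [Metric.ball_mem_nhds (0 : EuclideanSpace ℝ ι) hs.pos] with h hh
        rw [hc h (by simpa using hh), hz, hz2]
        simp
    · rw [not_or] at hx
      have hpn : 0 < pn x := lt_of_le_of_ne (hn.nonneg x) (Ne.symm hx.2)
      have hνpn : 0 < ν * pn x := by positivity
      obtain ⟨e1, e2⟩ := hs.sigmoid_eq_noiseWeight hreg hx.1 hpn hν
      -- Under noise the factor must cancel against `pₙ` instead: the sigmoid `p_β / (p_β + ν pₙ)`
      -- is at most `(p_d + p_β) / (ν pₙ)`.
      have hK : ∀ β ∈ Metric.ball β₀ r,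
          Real.sigmoid (Real.log (p β x) - Real.log (ν * pn x)) ≤
            (ν * pn x)⁻¹ * (p β₀ x + p β x) := fun β hβ => by
        have h1 := hs.pos_of_ne hreg hx.1 hβ
        have h2 := hreg.data_nonneg x
        rw [hs.sigmoid_eq hreg hx.1 hpn hν hβ, ← div_eq_inv_mul]
        refine div_le_div₀ (by linarith) (by linarith) hνpn (by linarith)
      have ht := hs.taylor (x := x) (K := (ν * pn x)⁻¹)
        (hasDerivAt_neg_log_sigmoid_neg_sub (Real.log (ν * pn x)))
        (hasDerivAt_sigmoid_sub (Real.log (ν * pn x))) (by positivity)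
        (fun β hβ => (by
          rw [abs_of_pos (Real.sigmoid_pos _)]
          exact hK β hβ))
        (fun β hβ => (by
          have h1 := Real.sigmoid_pos (Real.log (p β x) - Real.log (ν * pn x))
          have h2 := Real.sigmoid_lt_one (Real.log (p β x) - Real.log (ν * pn x))
          rw [abs_of_pos (mul_pos h1 (by linarith))]
          nlinarith [hK β hβ]))
      have hinner : ∀ h : EuclideanSpace ℝ ι,
          inner ℝ (noiseWeight (p β₀) pn ν x • score p β₀ x) h =
            noiseWeight (p β₀) pn ν x * inner ℝ (score p β₀ x) h := fun h =>
        real_inner_smul_left _ _ _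
      have hcl : ∀ h : EuclideanSpace ℝ ι, ‖h‖ < r → classifier p pn ν (β₀ + h) x =
          Real.log (p (β₀ + h) x) - Real.log (ν * pn x) := fun h hh =>
        hs.classifier_eq hreg hx.1 hpn hν (by simpa using hh)
      have hcl0 : classifier p pn ν (β₀ + 0) x =
          Real.log (p β₀ x) - Real.log (ν * pn x) := by
        rw [hcl 0 (by simpa using hs.pos), add_zero]
      refine ⟨fun h hh => ?_, ?_⟩
      · rw [hinner, hcl h hh, hcl0, ← e1]
        exact ht.1 h hh
      · refine ht.2.congr' ?_ EventuallyEq.rfl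
        filter_upwards [Metric.ball_mem_nhds (0 : EuclideanSpace ℝ ι) hs.pos] with h hh
        rw [hinner, hcl h (by simpa using hh), hcl0, ← e1, ← e2]
        ring
  have hw1 : ∀ x, |misclass (p β₀) pn ν x| ≤ 1 := fun x =>
    abs_misclass_le (hreg.data_nonneg x) (hn.nonneg x) hν
  exact
    { measurable := fun h _ => ((continuous_sigmoid.measurable.comp
        (measurable_classifier hreg hn _).neg).log).neg
      continuousOn := fun x => ((continuous_sigmoid.comp_continuousOn
        (hs.continuousOn_classifier hreg hn hν x).neg).log fun h _ => (Real.sigmoid_pos _).ne').neg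
      measurable_grad := hnw.smul hreg.measurable_score
      measurable_hess := fun i j => ((hw.mul hnw).mul ((hreg.measurable_score_apply i).mul
        (hreg.measurable_score_apply j))).add (hnw.mul (hreg.measurable_hessLog i j))
      integrable_hess := fun i j => by
        rw [integrable_withDensity_ofReal_iff hn.measurable hn.nonneg]
        -- The identity `noiseWeight * pₙ = (w / ν) p_d` moves the integral to the data density,
        -- where the domination hypothesis applies.
        have := hreg.integrable_hess_mul_data (C := ν⁻¹) ((hw.mul hw).mul_const ν⁻¹)
          (hw.mul_const ν⁻¹) (fun x => by
            rw [abs_mul, Pi.mul_apply, abs_mul, abs_of_pos (inv_pos.2 hν)]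
            exact mul_le_of_le_one_left (inv_pos.2 hν).le
              (mul_le_one₀ (hw1 x) (abs_nonneg _) (hw1 x))) (fun x => by
            rw [abs_mul, abs_of_pos (inv_pos.2 hν)]
            exact mul_le_of_le_one_left (inv_pos.2 hν).le (hw1 x)) i j
        refine this.congr (Eventually.of_forall fun x => ?_)
        have h1 := noiseWeight_mul (hreg.data_nonneg x) (hn.nonneg x) hν
        simp only [of_apply, Pi.mul_apply]
        linear_combination (-(misclass (p β₀) pn ν x * (score p β₀ x i * score p β₀ x j) +
          hessLog p β₀ x i j)) * h1
      bound := by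
        refine ⟨fun x => 2 * ((ν * pn x)⁻¹ * G x), ?_, fun h x hh => (hmain x).1 h hh⟩
        rw [integrable_withDensity_ofReal_iff hn.measurable hn.nonneg]
        refine (hs.integrable.const_mul (2 * ν⁻¹)).mono' ?_ (Eventually.of_forall fun x => ?_)
        · exact ((((hn.measurable.const_mul ν).inv.aemeasurable.mul
            hs.integrable.aemeasurable).const_mul 2).mul
              hn.measurable.aemeasurable).aestronglyMeasurable
        · have hG0 := hs.bound_nonneg hreg x
          have hp0 := hn.nonneg x
          rw [Real.norm_of_nonneg (by positivity)]
          rcases eq_or_ne (pn x) 0 with h | h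
          · simp only [h, mul_zero]; positivity
          · apply le_of_eq; field_simp
      expansion := fun x => (hmain x).2.congr_left fun h => by rw [hquad] }

/-- The limiting Hessian of the logistic loss is `I_w`. -/
theorem integral_hess_add (hreg : RegularModel μ p Θ β₀) (hn : IsNoise μ p β₀ pn) (hν : 0 < ν)
    (i j : ι) :
    ∫ x, (misclass (p β₀) pn ν x * noiseWeight (p β₀) pn ν x *
        (score p β₀ x i * score p β₀ x j) + -misclass (p β₀) pn ν x * hessLog p β₀ x i j)
          ∂(μ.withDensity fun x => ENNReal.ofReal (p β₀ x)) +
      ν * ∫ x, (misclass (p β₀) pn ν x * noiseWeight (p β₀) pn ν x *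
        (score p β₀ x i * score p β₀ x j) + noiseWeight (p β₀) pn ν x * hessLog p β₀ x i j)
          ∂(μ.withDensity fun x => ENNReal.ofReal (pn x)) =
      scoreCov μ p β₀ (misclass (p β₀) pn ν) i j := by
  obtain ⟨r, G, hs⟩ := hreg.exists_isSmoothOn
  have h1 := (hs.quadExpansion_data hreg hn hν).integrable_hess i j
  have h2 := (hs.quadExpansion_noise hreg hn hν).integrable_hess i j
  rw [integrable_withDensity_ofReal_iff (hreg.measurable_apply β₀) hreg.data_nonneg] at h1
  rw [integrable_withDensity_ofReal_iff hn.measurable hn.nonneg] at h2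
  rw [integral_withDensity_ofReal (hreg.measurable_apply β₀) hreg.data_nonneg,
    integral_withDensity_ofReal hn.measurable hn.nonneg, ← integral_const_mul]
  refine (integral_add h1 (h2.const_mul ν)).symm.trans ?_
  refine integral_congr_ae (Eventually.of_forall fun x => ?_)
  have e1 := noiseWeight_mul (hreg.data_nonneg x) (hn.nonneg x) hν
  have e2 := misclass_mul_noiseWeight_add (pd := p β₀) (pn := pn) (ν := ν) (x := x)
  have e3 : ν * (noiseWeight (p β₀) pn ν x * pn x) = misclass (p β₀) pn ν x * p β₀ x := by
    rw [e1]; field_simp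
  simp only [of_apply]
  -- `e3` cancels the Hessians of `log p` and turns the noise term into `w² g gᵀ p_d`; by `e2` the
  -- weights add up to `w`.
  linear_combination (misclass (p β₀) pn ν x * (score p β₀ x i * score p β₀ x j) +
    hessLog p β₀ x i j) * e3 + (score p β₀ x i * score p β₀ x j) * p β₀ x * e2

end IsSmoothOn

/-! ### Minimizers of nearly quadratic functions -/

section QuadForm

variable {ι : Type*} [Fintype ι]

theorem quadForm_vecMulVec_self (m : ι → ℝ) (u : EuclideanSpace ℝ ι) :
    quadForm (vecMulVec m m) u = (m ⬝ᵥ fun i => u i) ^ 2 := by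
  rw [quadForm_eq_sum, dotProduct, pow_two, Finset.sum_mul_sum]
  refine Finset.sum_congr rfl fun i _ => Finset.sum_congr rfl fun j _ => ?_
  rw [vecMulVec_apply]
  ring

theorem quadForm_smul_left (c : ℝ) (A : Matrix ι ι ℝ) (u : EuclideanSpace ℝ ι) :
    quadForm (c • A) u = c * quadForm A u := by
  simp [quadForm, smul_mulVec]

/-- Completing the square. -/
theorem quadForm_sub_half_sub {A : Matrix ι ι ℝ} (hA : A.IsHermitian)
    {U g h : EuclideanSpace ℝ ι} (hg : ∀ i, U i = -(A *ᵥ fun j => g j) i) :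
    quadForm A (h - g) / 2 =
      (inner ℝ U h + quadForm A h / 2) - (inner ℝ U g + quadForm A g / 2) := by
  have hsymm : ∀ i j, A i j = A j i := fun i j => by simpa using (hA.apply i j).symm
  have hin : ∀ v : EuclideanSpace ℝ ι, inner ℝ U v = -∑ i, ∑ j, A i j * (v i * g j) := fun v => by
    rw [PiLp.inner_apply, ← Finset.sum_neg_distrib]
    refine Finset.sum_congr rfl fun i _ => ?_
    rw [hg i, mulVec, dotProduct]
    simp only [RCLike.inner_apply, conj_trivial, mul_neg, Finset.mul_sum]
    rw [neg_inj]
    refine Finset.sum_congr rfl fun j _ => by ring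
  have hcomm : ∑ i, ∑ j, A i j * (g i * h j) = ∑ i, ∑ j, A i j * (h i * g j) := by
    rw [Finset.sum_comm]
    refine Finset.sum_congr rfl fun i _ => Finset.sum_congr rfl fun j _ => ?_
    rw [hsymm]
    ring
  have hexp : quadForm A (h - g) = quadForm A h - ∑ i, ∑ j, A i j * (h i * g j) -
      ∑ i, ∑ j, A i j * (g i * h j) + quadForm A g := by
    simp only [quadForm_eq_sum, ← Finset.sum_sub_distrib, ← Finset.sum_add_distrib]
    refine Finset.sum_congr rfl fun i _ => Finset.sum_congr rfl fun j _ => ?_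
    simp only [PiLp.sub_apply]
    ring
  rw [hexp, hcomm, hin, hin, quadForm_eq_sum A g]
  ring

theorem abs_quadForm_sub_quadForm_le (A : Matrix ι ι ℝ) (g h : EuclideanSpace ℝ ι) :
    |quadForm A h - quadForm A g| ≤
      (∑ i, ∑ j, |A i j|) * (‖h - g‖ * (‖h‖ + ‖g‖)) := by
  simp only [quadForm_eq_sum, ← Finset.sum_sub_distrib, Finset.sum_mul]
  refine (Finset.abs_sum_le_sum_abs _ _).trans (Finset.sum_le_sum fun i _ =>
    (Finset.abs_sum_le_sum_abs _ _).trans (Finset.sum_le_sum fun j _ => ?_))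
  have e : A i j * (h i * h j) - A i j * (g i * g j) =
      A i j * ((h - g) i * h j + g i * (h - g) j) := by
    simp only [PiLp.sub_apply]
    ring
  rw [e, abs_mul]
  refine mul_le_mul_of_nonneg_left ((abs_add_le _ _).trans ?_) (abs_nonneg _)
  rw [abs_mul, abs_mul, mul_add]
  have h1 := abs_apply_le_norm (h - g) i
  have h2 := abs_apply_le_norm (h - g) j
  have h3 := abs_apply_le_norm h j
  have h4 := abs_apply_le_norm g i
  refine add_le_add (mul_le_mul h1 h3 (abs_nonneg _) (norm_nonneg _)) ?_
  rw [mul_comm]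
  exact mul_le_mul h2 h4 (abs_nonneg _) (norm_nonneg _)

/-- A minimizer of a nearly quadratic function is close to the vertex of the quadratic function. -/
theorem isLittleO_sub_of_le {α : Type*} {l : Filter α} {A : Matrix ι ι ℝ} (hA : A.PosDef)
    {L : α → EuclideanSpace ℝ ι → ℝ} {U g h : α → EuclideanSpace ℝ ι}
    (hmin : ∀ᶠ q in l, L q (h q) ≤ L q (g q))
    (hg : ∀ q i, U q i = -(A *ᵥ fun j => g q j) i)
    (eh : (fun q => L q (h q) - L q 0 - inner ℝ (U q) (h q) - quadForm A (h q) / 2)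
      =o[l] fun q => ‖h q‖ ^ 2)
    (eg : (fun q => L q (g q) - L q 0 - inner ℝ (U q) (g q) - quadForm A (g q) / 2)
      =o[l] fun q => ‖g q‖ ^ 2) :
    (fun q => h q - g q) =o[l] g := by
  obtain ⟨c, hc, hcA⟩ := exists_pos_le_quadForm hA
  have hsq : (fun q => ‖h q - g q‖ ^ 2) =o[l] fun q => ‖g q‖ ^ 2 := by
    rw [Asymptotics.isLittleO_iff]
    intro δ hδ
    -- With `a = ‖h - g‖²` and `b = ‖g‖²`, `hkey` reads `c a ≤ 4 ε a + 6 ε b`. The bound `c / 16`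
    -- lets the left side absorb the first term, and `δ c / 16` makes the rest at most `δ b`.
    set ε := min (c / 16) (δ * c / 16) with hε
    have hε0 : 0 < ε := by positivity
    have h1 : ε ≤ c / 16 := min_le_left _ _
    have h2 : ε ≤ δ * c / 16 := min_le_right _ _
    filter_upwards [hmin, eh.def hε0, eg.def hε0] with q hq e1 e2
    simp only [norm_pow, norm_norm] at e1 e2 ⊢
    rw [Real.norm_eq_abs, abs_le] at e1 e2
    have hsqr := quadForm_sub_half_sub hA.isHermitian (h := h q) (hg q)
    have hlow := hcA (h q - g q)
    have htri : ‖h q‖ ^ 2 ≤ 2 * ‖h q - g q‖ ^ 2 + 2 * ‖g q‖ ^ 2 := by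
      have := norm_add_le (h q - g q) (g q)
      rw [sub_add_cancel] at this
      nlinarith [sq_nonneg (‖h q - g q‖ - ‖g q‖), norm_nonneg (h q)]
    have ha := sq_nonneg ‖h q - g q‖
    have hb := sq_nonneg ‖g q‖
    have hkey : c * ‖h q - g q‖ ^ 2 ≤
        2 * (ε * (2 * ‖h q - g q‖ ^ 2 + 2 * ‖g q‖ ^ 2) + ε * ‖g q‖ ^ 2) := by
      have := mul_le_mul_of_nonneg_left htri hε0.le
      linarith [e1.1, e2.2]
    have h3 := mul_le_mul_of_nonneg_right h1 ha
    have h4 := mul_le_mul_of_nonneg_right h2 hb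
    have : c * ‖h q - g q‖ ^ 2 ≤ c * (δ * ‖g q‖ ^ 2) := by nlinarith
    exact le_of_mul_le_mul_left this hc
  exact (Asymptotics.IsLittleO.of_pow (hsq.congr_left fun q => rfl) two_ne_zero).of_norm_left.of_norm_right

end QuadForm

/-! ### Local expansion of the Kullback-Leibler divergence -/

section KullbackLeibler

variable {X : Type*} [MeasurableSpace X] {μ : Measure X}
  {ι : Type*} [Fintype ι] [DecidableEq ι]
  {p : EuclideanSpace ℝ ι → X → ℝ} {Θ : Set (EuclideanSpace ℝ ι)} {β₀ : EuclideanSpace ℝ ι}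
  {r : ℝ} {G : X → ℝ}

theorem klFun_nonneg {a b : ℝ} (ha : 0 < a) (hb : 0 < b) : 0 ≤ a * Real.log (a / b) - a + b := by
  have h := Real.log_le_sub_one_of_pos (div_pos hb ha)
  rw [← inv_div, Real.log_inv] at h
  have h2 := mul_le_mul_of_nonneg_left h ha.le
  have h3 : a * (a / b)⁻¹ = b := by field_simp
  nlinarith

namespace IsSmoothOn

/-- Second order expansion of the integrand of the Kullback-Leibler divergence. -/
theorem klFun_expansion (hs : IsSmoothOn μ p Θ β₀ r G) (hreg : RegularModel μ p Θ β₀) (x : X) :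
    (∀ h, ‖h‖ < r → 0 ≤ p β₀ x * Real.log (p β₀ x / p (β₀ + h) x) - p β₀ x + p (β₀ + h) x ∧
      p β₀ x * Real.log (p β₀ x / p (β₀ + h) x) - p β₀ x + p (β₀ + h) x ≤ 2 * G x * ‖h‖ ^ 2) ∧
    ContinuousOn (fun h => p β₀ x * Real.log (p β₀ x / p (β₀ + h) x) - p β₀ x + p (β₀ + h) x)
      (Metric.ball 0 r) ∧
    (fun h => p β₀ x * Real.log (p β₀ x / p (β₀ + h) x) - p β₀ x + p (β₀ + h) x -
      inner ℝ (score p β₀ x) h ^ 2 * p β₀ x / 2) =o[𝓝 0] fun h => ‖h‖ ^ 2 := by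
  have hmem : Set.MapsTo (fun h => β₀ + h) (Metric.ball (0 : EuclideanSpace ℝ ι) r)
      (Metric.ball β₀ r) := fun h hh => by simpa using hh
  have hG0 := hs.bound_nonneg hreg x
  by_cases hx : p β₀ x = 0
  · have hz : ∀ h ∈ Metric.ball (0 : EuclideanSpace ℝ ι) r,
        p β₀ x * Real.log (p β₀ x / p (β₀ + h) x) - p β₀ x + p (β₀ + h) x = 0 := fun h hh => by
      simp [hx, (hreg.support _ (hs.subset (hmem hh)) x).2 hx]
    refine ⟨fun h hh => ?_, (continuousOn_const (c := (0 : ℝ))).congr hz, ?_⟩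
    · rw [hz h (by simpa using hh)]
      exact ⟨le_rfl, by positivity⟩
    · refine (Asymptotics.isLittleO_zero _ _).congr' ?_ EventuallyEq.rfl
      filter_upwards [Metric.ball_mem_nhds (0 : EuclideanSpace ℝ ι) hs.pos] with h hh
      rw [hz h hh, hx]
      simp
  · have hpos := fun {β} (hβ : β ∈ Metric.ball β₀ r) => hs.pos_of_ne hreg hx hβ
    have hd := hpos (Metric.mem_ball_self hs.pos)
    -- The integrand as a function of `t = log p_β`. Its first derivative `exp t - p_d` vanishes at
    -- the truth, which removes both the linear term and the Hessian of `log p`; the second is `p_d`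
    -- there.
    have hΨ : ∀ t : ℝ, HasDerivAt (fun t => p β₀ x * (Real.log (p β₀ x) - t) - p β₀ x + Real.exp t)
        (Real.exp t - p β₀ x) t := fun t => by
      refine ((((hasDerivAt_id t).const_sub (Real.log (p β₀ x))).const_mul (p β₀ x)).sub_const
        (p β₀ x)).add (Real.hasDerivAt_exp t) |>.congr_deriv ?_
      ring
    have hΨ₁ : ∀ t : ℝ, HasDerivAt (fun t => Real.exp t - p β₀ x) (Real.exp t) t := fun t =>
      (Real.hasDerivAt_exp t).sub_const _
    have ht := hs.taylor (x := x) (K := 1) hΨ hΨ₁ zero_le_one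
      (fun β hβ => by
        rw [Real.exp_log (hpos hβ), abs_le]
        constructor <;> linarith [hpos hβ])
      (fun β hβ => by
        rw [Real.exp_log (hpos hβ), abs_of_pos (hpos hβ)]
        linarith)
    have heq : ∀ h ∈ Metric.ball (0 : EuclideanSpace ℝ ι) r,
        p β₀ x * Real.log (p β₀ x / p (β₀ + h) x) - p β₀ x + p (β₀ + h) x =
        p β₀ x * (Real.log (p β₀ x) - Real.log (p (β₀ + h) x)) - p β₀ x +
          Real.exp (Real.log (p (β₀ + h) x)) := fun h hh => by
      rw [Real.exp_log (hpos (hmem hh)), Real.log_div hd.ne' (hpos (hmem hh)).ne']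
    simp only [sub_self, Real.exp_log hd, mul_zero, zero_sub, neg_add_cancel, zero_mul, sub_zero,
      add_zero, one_mul] at ht
    refine ⟨fun h hh => ⟨klFun_nonneg hd (hpos (by simpa using hh)), ?_⟩, ?_, ?_⟩
    · rw [heq h (by simpa using hh)]
      exact (le_abs_self _).trans (ht.1 h hh)
    · have h1 : ContinuousOn (fun h => Real.log (p (β₀ + h) x)) (Metric.ball 0 r) :=
        (hs.contDiffOn x).continuousOn.comp (by fun_prop) hmem
      exact ((((continuousOn_const.sub h1).const_smul (p β₀ x)).sub continuousOn_const).add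
        h1.rexp).congr heq
    · refine ht.2.congr' ?_ EventuallyEq.rfl
      filter_upwards [Metric.ball_mem_nhds (0 : EuclideanSpace ℝ ι) hs.pos] with h hh
      rw [heq h hh, mul_comm (inner ℝ _ _ ^ 2)]

end IsSmoothOn

/-- The Kullback-Leibler divergence near the true parameter is half the Fisher information. -/
theorem RegularModel.genKL_expansion (hreg : RegularModel μ p Θ β₀) :
    (∀ᶠ h in 𝓝 (0 : EuclideanSpace ℝ ι), genKL μ (p β₀) (p (β₀ + h)) ≠ ∞) ∧
    (fun h => (genKL μ (p β₀) (p (β₀ + h))).toReal - quadForm (fisher μ p β₀) h / 2)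
      =o[𝓝 0] fun h => ‖h‖ ^ 2 := by
  obtain ⟨r, G, hs⟩ := hreg.exists_isSmoothOn
  set k : EuclideanSpace ℝ ι → X → ℝ := fun h x =>
    p β₀ x * Real.log (p β₀ x / p (β₀ + h) x) - p β₀ x + p (β₀ + h) x with hk
  have hkm : ∀ h, Measurable (k h) := fun h =>
    (((hreg.measurable_apply β₀).mul ((hreg.measurable_apply β₀).div
      (hreg.measurable_apply _)).log).sub (hreg.measurable_apply β₀)).add (hreg.measurable_apply _)
  have hin : ∀ h : EuclideanSpace ℝ ι, Measurable fun x => inner ℝ (score p β₀ x) h := fun h =>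
    hreg.measurable_score.inner measurable_const
  have hsc : ∀ (h : EuclideanSpace ℝ ι) x, 0 ≤ inner ℝ (score p β₀ x) h ^ 2 * p β₀ x / 2 ∧
      inner ℝ (score p β₀ x) h ^ 2 * p β₀ x / 2 ≤ 2 * G x * ‖h‖ ^ 2 := fun h x => by
    have h0 := hreg.data_nonneg x
    have hb := hs.bound β₀ (Metric.mem_ball_self hs.pos) x
    rw [RegularModel.norm_fderiv] at hb
    have hfn := norm_nonneg (fderiv ℝ (fderiv ℝ fun b => Real.log (p b x)) β₀)
    have hcs : inner ℝ (score p β₀ x) h ^ 2 ≤ ‖score p β₀ x‖ ^ 2 * ‖h‖ ^ 2 := by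
      rw [← mul_pow, ← sq_abs]
      exact pow_le_pow_left₀ (abs_nonneg _) (abs_real_inner_le_norm _ _) 2
    have hG0 := hs.bound_nonneg hreg x
    have h2 : ‖score p β₀ x‖ ^ 2 * p β₀ x ≤ G x := by
      nlinarith [mul_nonneg h0 hfn, mul_nonneg h0 (sq_nonneg ‖score p β₀ x‖)]
    refine ⟨by positivity, ?_⟩
    have h3 := mul_le_mul_of_nonneg_right hcs h0
    have h4 := mul_le_mul_of_nonneg_right h2 (sq_nonneg ‖h‖)
    nlinarith [mul_nonneg hG0 (sq_nonneg ‖h‖)]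
  have hint : ∀ h : EuclideanSpace ℝ ι, ‖h‖ < r → Integrable (k h) μ := fun h hh =>
    ((hs.integrable.const_mul 2).mul_const (‖h‖ ^ 2)).mono' (hkm h).aestronglyMeasurable
      (Eventually.of_forall fun x => by
        rw [Real.norm_of_nonneg ((hs.klFun_expansion hreg x).1 h hh).1]
        exact ((hs.klFun_expansion hreg x).1 h hh).2)
  have hball := Metric.ball_mem_nhds (0 : EuclideanSpace ℝ ι) hs.pos
  have hfin : ∀ h : EuclideanSpace ℝ ι, ‖h‖ < r → genKL μ (p β₀) (p (β₀ + h)) =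
      ENNReal.ofReal (∫ x, k h x ∂μ) := fun h hh => by
    rw [ofReal_integral_eq_lintegral_ofReal (hint h hh)
      (Eventually.of_forall fun x => ((hs.klFun_expansion hreg x).1 h hh).1)]
    rfl
  refine ⟨?_, ?_⟩
  · filter_upwards [hball] with h hh
    rw [hfin h (by simpa using hh)]
    exact ENNReal.ofReal_ne_top
  · rw [Asymptotics.isLittleO_iff]
    intro ε hε
    obtain ⟨ρ, hρ, hρr, S, hSm, hS0, hSK, hSε, hSb⟩ := exists_small_quadratic_bound μ
      (R := fun h x => k h x - inner ℝ (score p β₀ x) h ^ 2 * p β₀ x / 2)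
      (K := fun x => 2 * G x) hs.pos (hs.integrable.const_mul 2)
      (fun h _ => (hkm h).sub ((((hin h).pow_const 2).mul (hreg.measurable_apply β₀)).div_const 2))
      (fun x => (hs.klFun_expansion hreg x).2.1.sub (by fun_prop))
      (fun h x hh => by
        have h1 := (hs.klFun_expansion hreg x).1 h hh
        have h2 := hsc h x
        rw [abs_le]
        constructor <;> linarith [h1.1, h1.2, h2.1, h2.2])
      (fun x => (hs.klFun_expansion hreg x).2.2) (ENNReal.ofReal_pos.2 hε)
    filter_upwards [Metric.closedBall_mem_nhds (0 : EuclideanSpace ℝ ι) hρ] with h hh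
    rw [mem_closedBall_zero_iff] at hh
    have hhr := hh.trans_lt hρr
    have hk0 : 0 ≤ ∫ x, k h x ∂μ :=
      integral_nonneg fun x => ((hs.klFun_expansion hreg x).1 h hhr).1
    have hq : quadForm (fisher μ p β₀) h / 2 =
        ∫ x, inner ℝ (score p β₀ x) h ^ 2 * p β₀ x / 2 ∂μ := by
      rw [fisher, hreg.quadForm_scoreCov measurable_const (C := 1) (by simp), integral_div]
      simp
    have hqi : Integrable (fun x => inner ℝ (score p β₀ x) h ^ 2 * p β₀ x / 2) μ := by
      simpa using (hreg.integrable_inner_score_sq (u := fun _ => 1) measurable_const (C := 1)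
        (by simp) h).div_const 2
    have hSi : Integrable S μ := (hs.integrable.const_mul 2).abs.mono' hSm.aestronglyMeasurable
      (Eventually.of_forall fun x => by rw [Real.norm_of_nonneg (hS0 x)]; exact hSK x)
    have hSle : ∫ x, S x ∂μ ≤ ε := by
      rw [← ofReal_integral_eq_lintegral_ofReal hSi (Eventually.of_forall hS0)] at hSε
      exact (ENNReal.ofReal_le_ofReal_iff hε.le).1 hSε
    rw [hfin h hhr, ENNReal.toReal_ofReal hk0, hq, ← integral_sub (hint h hhr) hqi, norm_pow,
      norm_norm]
    refine (norm_integral_le_integral_norm _).trans ?_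
    refine (integral_mono ((hint h hhr).sub hqi).norm (hSi.mul_const _) fun x => hSb h x hh).trans ?_
    rw [integral_mul_const]
    exact mul_le_mul_of_nonneg_right hSle (sq_nonneg _)

end KullbackLeibler

/-! ### Mean and covariance of the gradient of the loss -/

section ScoreStatistics

variable {X : Type*} [MeasurableSpace X] {μ : Measure X}
  {ι : Type*} [Fintype ι] [DecidableEq ι]
  {p : EuclideanSpace ℝ ι → X → ℝ} {Θ : Set (EuclideanSpace ℝ ι)} {β₀ : EuclideanSpace ℝ ι}
  {pn : X → ℝ} {ν : ℝ}

theorem isProbabilityMeasure_withDensity_ofReal {f : X → ℝ}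
    (hf : ∫⁻ x, ENNReal.ofReal (f x) ∂μ = 1) :
    IsProbabilityMeasure (μ.withDensity fun x => ENNReal.ofReal (f x)) :=
  ⟨by rw [withDensity_apply _ MeasurableSet.univ, setLIntegral_univ, hf]⟩

/-- The covariance matrix of the gradient of the logistic loss, per data point. -/
def gradCov (μ : Measure X) (p : EuclideanSpace ℝ ι → X → ℝ) (β₀ : EuclideanSpace ℝ ι)
    (pn : X → ℝ) (ν : ℝ) : Matrix ι ι ℝ :=
  scoreCov μ p β₀ (misclass (p β₀) pn ν) - (1 + 1 / ν) •
    vecMulVec (scoreMean μ p β₀ (misclass (p β₀) pn ν)) (scoreMean μ p β₀ (misclass (p β₀) pn ν))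

namespace RegularModel

theorem integral_data_grad (hreg : RegularModel μ p Θ β₀) (hn : IsNoise μ p β₀ pn) (hν : 0 < ν)
    (t : EuclideanSpace ℝ ι) :
    ∫ x, inner ℝ (misclass (p β₀) pn ν x • score p β₀ x) t
      ∂(μ.withDensity fun x => ENNReal.ofReal (p β₀ x)) =
      scoreMean μ p β₀ (misclass (p β₀) pn ν) ⬝ᵥ fun i => t i := by
  rw [integral_withDensity_ofReal (hreg.measurable_apply β₀) hreg.data_nonneg,
    ← hreg.integral_inner_score
      (measurable_misclass (hreg.measurable_apply β₀) hn.measurable ν)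
      (fun x => abs_misclass_le (hreg.data_nonneg x) (hn.nonneg x) hν)]
  simp only [real_inner_smul_left]

/-- By `ν * noiseWeight * pₙ = w p_d` the noise gradient has the same mean as the data gradient, so
the gradient of the loss is centred. -/
theorem integral_noise_grad (hreg : RegularModel μ p Θ β₀) (hn : IsNoise μ p β₀ pn) (hν : 0 < ν)
    (t : EuclideanSpace ℝ ι) :
    ∫ x, inner ℝ ((ν * noiseWeight (p β₀) pn ν x) • score p β₀ x) t
      ∂(μ.withDensity fun x => ENNReal.ofReal (pn x)) =
      scoreMean μ p β₀ (misclass (p β₀) pn ν) ⬝ᵥ fun i => t i := by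
  rw [integral_withDensity_ofReal hn.measurable hn.nonneg,
    ← hreg.integral_inner_score
      (measurable_misclass (hreg.measurable_apply β₀) hn.measurable ν)
      (fun x => abs_misclass_le (hreg.data_nonneg x) (hn.nonneg x) hν)]
  congr with x
  have h1 := noiseWeight_mul (hreg.data_nonneg x) (hn.nonneg x) hν
  have h2 : ν * (noiseWeight (p β₀) pn ν x * pn x) = misclass (p β₀) pn ν x * p β₀ x := by
    rw [h1]; field_simp
  rw [real_inner_smul_left]
  linear_combination inner ℝ (score p β₀ x) t * h2

theorem data_grad_sq (hreg : RegularModel μ p Θ β₀) (hn : IsNoise μ p β₀ pn) (hν : 0 < ν)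
    (t : EuclideanSpace ℝ ι) :
    MemLp (fun x => inner ℝ (misclass (p β₀) pn ν x • score p β₀ x) t) 2
      (μ.withDensity fun x => ENNReal.ofReal (p β₀ x)) ∧
    Integrable (fun x => misclass (p β₀) pn ν x ^ 2 * inner ℝ (score p β₀ x) t ^ 2 * p β₀ x) μ ∧
    ∫ x, inner ℝ (misclass (p β₀) pn ν x • score p β₀ x) t ^ 2
      ∂(μ.withDensity fun x => ENNReal.ofReal (p β₀ x)) =
      ∫ x, misclass (p β₀) pn ν x ^ 2 * inner ℝ (score p β₀ x) t ^ 2 * p β₀ x ∂μ := by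
  have hw := measurable_misclass (hreg.measurable_apply β₀) hn.measurable ν
  have hi : Integrable (fun x => misclass (p β₀) pn ν x ^ 2 * inner ℝ (score p β₀ x) t ^ 2 *
      p β₀ x) μ := hreg.integrable_inner_score_sq (C := 1) (hw.pow_const 2) (fun x => by
        rw [abs_pow]
        exact pow_le_one₀ (abs_nonneg _)
          (abs_misclass_le (hreg.data_nonneg x) (hn.nonneg x) hν)) t
  refine ⟨?_, hi, ?_⟩
  · have hm : Measurable fun x => inner ℝ (misclass (p β₀) pn ν x • score p β₀ x) t :=
      (hw.smul hreg.measurable_score).inner measurable_const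
    rw [memLp_two_iff_integrable_sq hm.aestronglyMeasurable,
      integrable_withDensity_ofReal_iff (hreg.measurable_apply β₀) hreg.data_nonneg]
    simpa only [real_inner_smul_left, mul_pow] using hi
  · rw [integral_withDensity_ofReal (hreg.measurable_apply β₀) hreg.data_nonneg]
    simp only [real_inner_smul_left, mul_pow]

theorem noise_grad_sq (hreg : RegularModel μ p Θ β₀) (hn : IsNoise μ p β₀ pn) (hν : 0 < ν)
    (t : EuclideanSpace ℝ ι) :
    MemLp (fun x => inner ℝ ((ν * noiseWeight (p β₀) pn ν x) • score p β₀ x) t) 2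
      (μ.withDensity fun x => ENNReal.ofReal (pn x)) ∧
    Integrable (fun x => misclass (p β₀) pn ν x * noiseWeight (p β₀) pn ν x *
      inner ℝ (score p β₀ x) t ^ 2 * p β₀ x) μ ∧
    ∫ x, inner ℝ ((ν * noiseWeight (p β₀) pn ν x) • score p β₀ x) t ^ 2
      ∂(μ.withDensity fun x => ENNReal.ofReal (pn x)) =
      ν * ∫ x, misclass (p β₀) pn ν x * noiseWeight (p β₀) pn ν x *
        inner ℝ (score p β₀ x) t ^ 2 * p β₀ x ∂μ := by
  have hw := measurable_misclass (hreg.measurable_apply β₀) hn.measurable ν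
  have hnw := measurable_noiseWeight (hreg.measurable_apply β₀) hn.measurable ν
  have hi : Integrable (fun x => misclass (p β₀) pn ν x * noiseWeight (p β₀) pn ν x *
      inner ℝ (score p β₀ x) t ^ 2 * p β₀ x) μ :=
    hreg.integrable_inner_score_sq (C := 1) (hw.mul hnw) (fun x => by
      have := noiseWeight_mem (hreg.data_nonneg x) (hn.nonneg x) hν
      rw [Pi.mul_apply, abs_mul, abs_of_nonneg this.1]
      exact mul_le_one₀ (abs_misclass_le (hreg.data_nonneg x) (hn.nonneg x) hν) this.1 this.2) t
  have e : ∀ x, inner ℝ ((ν * noiseWeight (p β₀) pn ν x) • score p β₀ x) t ^ 2 * pn x =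
      ν * (misclass (p β₀) pn ν x * noiseWeight (p β₀) pn ν x *
        inner ℝ (score p β₀ x) t ^ 2 * p β₀ x) := fun x => by
    have h1 := noiseWeight_mul (hreg.data_nonneg x) (hn.nonneg x) hν
    have h2 : ν * (noiseWeight (p β₀) pn ν x * pn x) = misclass (p β₀) pn ν x * p β₀ x := by
      rw [h1]; field_simp
    rw [real_inner_smul_left]
    linear_combination ν * noiseWeight (p β₀) pn ν x * inner ℝ (score p β₀ x) t ^ 2 * h2
  refine ⟨?_, hi, ?_⟩
  · have hm : Measurable fun x => inner ℝ ((ν * noiseWeight (p β₀) pn ν x) • score p β₀ x) t :=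
      ((hnw.const_mul ν).smul hreg.measurable_score).inner measurable_const
    rw [memLp_two_iff_integrable_sq hm.aestronglyMeasurable,
      integrable_withDensity_ofReal_iff hn.measurable hn.nonneg]
    simpa only [e] using hi.const_mul ν
  · rw [integral_withDensity_ofReal hn.measurable hn.nonneg]
    simp only [e, integral_const_mul]

/-- The second moments carry the weights `w²` from the data and, after division by `ν`, `w *
noiseWeight` from the noise; these add up to `w`. The two squared means are equal and enter with
factors `1` and `1 / ν`. -/
theorem quadForm_gradCov (hreg : RegularModel μ p Θ β₀) (hn : IsNoise μ p β₀ pn) (hν : 0 < ν)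
    (t : EuclideanSpace ℝ ι) :
    quadForm (gradCov μ p β₀ pn ν) t =
      Var[fun x => inner ℝ (misclass (p β₀) pn ν x • score p β₀ x) t;
        μ.withDensity fun x => ENNReal.ofReal (p β₀ x)] +
      Var[fun x => inner ℝ ((ν * noiseWeight (p β₀) pn ν x) • score p β₀ x) t;
        μ.withDensity fun x => ENNReal.ofReal (pn x)] / ν := by
  have := isProbabilityMeasure_withDensity_ofReal hreg.data_prob
  have := isProbabilityMeasure_withDensity_ofReal hn.prob
  obtain ⟨ha, ha1, ha2⟩ := hreg.data_grad_sq hn hν t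
  obtain ⟨hb, hb1, hb2⟩ := hreg.noise_grad_sq hn hν t
  rw [variance_eq_sub ha, variance_eq_sub hb]
  simp only [Pi.pow_apply]
  rw [ha2, hb2, hreg.integral_data_grad hn hν, hreg.integral_noise_grad hn hν, gradCov,
    quadForm_sub, quadForm_smul_left, quadForm_vecMulVec_self, hreg.quadForm_scoreCov
      (measurable_misclass (hreg.measurable_apply β₀) hn.measurable ν)
      (fun x => abs_misclass_le (hreg.data_nonneg x) (hn.nonneg x) hν)]
  have h3 : ∫ x, misclass (p β₀) pn ν x * inner ℝ (score p β₀ x) t ^ 2 * p β₀ x ∂μ =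
      ∫ x, misclass (p β₀) pn ν x ^ 2 * inner ℝ (score p β₀ x) t ^ 2 * p β₀ x ∂μ +
      ∫ x, misclass (p β₀) pn ν x * noiseWeight (p β₀) pn ν x *
        inner ℝ (score p β₀ x) t ^ 2 * p β₀ x ∂μ := by
    rw [← integral_add ha1 hb1]
    congr with x
    have := misclass_mul_noiseWeight_add (pd := p β₀) (pn := pn) (ν := ν) (x := x)
    linear_combination -(inner ℝ (score p β₀ x) t ^ 2 * p β₀ x) * this
  rw [h3]
  field_simp
  ring

theorem gradCov_posSemidef (hreg : RegularModel μ p Θ β₀) (hn : IsNoise μ p β₀ pn) (hν : 0 < ν) :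
    (gradCov μ p β₀ pn ν).PosSemidef := by
  refine .of_dotProduct_mulVec_nonneg ?_ fun v => ?_
  · refine (scoreCov_isHermitian _).sub ?_
    ext i j
    simp [vecMulVec_apply, mul_comm]
  · have := hreg.quadForm_gradCov hn hν (WithLp.toLp 2 v)
    simp only [quadForm] at this
    simp only [star_trivial]
    rw [this]
    exact add_nonneg (variance_nonneg _ _) (div_nonneg (variance_nonneg _ _) hν.le)

end RegularModel

end ScoreStatistics

/-! ### Linearization of the estimator -/

section Estimator

variable {X : Type*} [MeasurableSpace X] {μ : Measure X}
  {ι : Type*} [Fintype ι] [DecidableEq ι]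
  {p : EuclideanSpace ℝ ι → X → ℝ} {Θ : Set (EuclideanSpace ℝ ι)} {β₀ : EuclideanSpace ℝ ι}
  {pn : X → ℝ} {ν : ℝ}
  {Ω : Type*} [MeasurableSpace Ω] {P : Measure Ω}
  {ξ η : ℕ → Ω → X} {Td Tn : ℕ → ℕ} {est : ℕ → Ω → EuclideanSpace ℝ ι}

theorem logisticLoss_eq (n m : ℕ) (xd xn : ℕ → X) (β : EuclideanSpace ℝ ι) :
    logisticLoss p pn ν n m xd xn β =
      empMean n xd (fun x => -Real.log (Real.sigmoid (classifier p pn ν β x))) +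
      ν * empMean m xn (fun x => -Real.log (Real.sigmoid (-classifier p pn ν β x))) := by
  simp only [logisticLoss, empMean, smul_eq_mul, Finset.sum_neg_distrib]
  ring

/-- The gradient of the logistic loss at the true parameter. -/
def lossGrad (p : EuclideanSpace ℝ ι → X → ℝ) (β₀ : EuclideanSpace ℝ ι) (pn : X → ℝ) (ν : ℝ)
    (n m : ℕ) (xd xn : ℕ → X) : EuclideanSpace ℝ ι :=
  empMean m xn (fun x => (ν * noiseWeight (p β₀) pn ν x) • score p β₀ x) -
    empMean n xd (fun x => misclass (p β₀) pn ν x • score p β₀ x)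

namespace IsNCEEstimator

theorem noise_size (he : IsNCEEstimator P μ p Θ β₀ pn ν ξ η Td Tn est) (hν : 0 < ν) :
    Tendsto Tn atTop atTop := by
  rw [← tendsto_natCast_atTop_iff (R := ℝ)]
  have h := he.ratio.pos_mul_atTop hν
    (tendsto_natCast_atTop_iff (R := ℝ) |>.2 he.data_size)
  refine h.congr' ?_
  filter_upwards [he.data_size.eventually_gt_atTop 0] with k hk
  have : (0 : ℝ) < Td k := by exact_mod_cast hk
  field_simp

theorem pairwise_data (he : IsNCEEstimator P μ p Θ β₀ pn ν ξ η Td Tn est) :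
    Pairwise fun i j => ξ i ⟂ᵢ[P] ξ j := fun i j hij => by
  simpa using he.indep.indepFun (i := Sum.inl i) (j := Sum.inl j) (by simpa using hij)

theorem pairwise_noise (he : IsNCEEstimator P μ p Θ β₀ pn ν ξ η Td Tn est) :
    Pairwise fun i j => η i ⟂ᵢ[P] η j := fun i j hij => by
  simpa using he.indep.indepFun (i := Sum.inr i) (j := Sum.inr j) (by simpa using hij)

theorem tendstoInDistribution_lossGrad [IsProbabilityMeasure P] (hreg : RegularModel μ p Θ β₀)
    (hn : IsNoise μ p β₀ pn) (hν : 0 < ν)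
    (he : IsNCEEstimator P μ p Θ β₀ pn ν ξ η Td Tn est) :
    TendstoInDistribution (fun k ω => √(Td k : ℝ) •
      lossGrad p β₀ pn ν (Td k) (Tn k) (fun i => ξ i ω) (fun j => η j ω)) atTop
      id (fun _ => P) (multivariateGaussian 0 (gradCov μ p β₀ pn ν)) :=
  have hw := measurable_misclass (hreg.measurable_apply β₀) hn.measurable ν
  have hnw := measurable_noiseWeight (hreg.measurable_apply β₀) hn.measurable ν
  tendstoInDistribution_two_sample he.data_law he.noise_law he.indep
    (hw.smul hreg.measurable_score) ((hnw.const_mul ν).smul hreg.measurable_score)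
    (fun t => (hreg.data_grad_sq hn hν t).1) (fun t => (hreg.noise_grad_sq hn hν t).1)
    (fun t => (hreg.integral_noise_grad hn hν t).trans (hreg.integral_data_grad hn hν t).symm)
    he.data_size (he.noise_size hν) hν he.ratio (hreg.gradCov_posSemidef hn hν)
    (hreg.quadForm_gradCov hn hν)

theorem tendsto_lossGrad [IsProbabilityMeasure P] (hreg : RegularModel μ p Θ β₀)
    (hn : IsNoise μ p β₀ pn) (hν : 0 < ν)
    (he : IsNCEEstimator P μ p Θ β₀ pn ν ξ η Td Tn est) :
    Tendsto (fun q : ℕ × Ω => lossGrad p β₀ pn ν (Td q.1) (Tn q.1) (fun i => ξ i q.2)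
      (fun j => η j q.2)) (whp P) (𝓝 0) := by
  have := isProbabilityMeasure_withDensity_ofReal hreg.data_prob
  have := isProbabilityMeasure_withDensity_ofReal hn.prob
  have hw := measurable_misclass (hreg.measurable_apply β₀) hn.measurable ν
  have hnw := measurable_noiseWeight (hreg.measurable_apply β₀) hn.measurable ν
  have key : ∀ i : ι, Tendsto (fun q : ℕ × Ω => inner ℝ (lossGrad p β₀ pn ν (Td q.1) (Tn q.1)
      (fun i => ξ i q.2) (fun j => η j q.2)) (EuclideanSpace.single i (1 : ℝ))) (whp P) (𝓝 0) := by
    intro i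
    set t : EuclideanSpace ℝ ι := EuclideanSpace.single i 1
    have h1 := tendsto_empMean he.data_law he.pairwise_data
      (((hw.smul hreg.measurable_score).inner (measurable_const (a := t))))
      ((hreg.data_grad_sq hn hν t).1.integrable one_le_two) he.data_size
    have h2 := tendsto_empMean he.noise_law he.pairwise_noise
      ((((hnw.const_mul ν).smul hreg.measurable_score).inner (measurable_const (a := t))))
      ((hreg.noise_grad_sq hn hν t).1.integrable one_le_two) (he.noise_size hν)
    have h3 := h2.sub h1
    simp only [Pi.smul_apply', hreg.integral_noise_grad hn hν, hreg.integral_data_grad hn hν,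
      sub_self] at h3
    simpa only [lossGrad, inner_sub_left, inner_empMean] using h3
  have h := (PiLp.continuous_toLp 2 (fun _ : ι => ℝ)).tendsto 0 |>.comp
    (tendsto_pi_nhds.2 fun i => key i)
  refine (h.congr fun q => ?_)
  ext i
  simp [EuclideanSpace.inner_single_right]

/-- The logistic loss is asymptotically quadratic along parameters converging to the truth. -/
theorem loss_expansion [IsProbabilityMeasure P] (hreg : RegularModel μ p Θ β₀)
    (hn : IsNoise μ p β₀ pn) (hν : 0 < ν)
    (he : IsNCEEstimator P μ p Θ β₀ pn ν ξ η Td Tn est)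
    {h : ℕ × Ω → EuclideanSpace ℝ ι} (hh : Tendsto h (whp P) (𝓝 0)) :
    (fun q : ℕ × Ω =>
      logisticLoss p pn ν (Td q.1) (Tn q.1) (fun i => ξ i q.2) (fun j => η j q.2) (β₀ + h q) -
      logisticLoss p pn ν (Td q.1) (Tn q.1) (fun i => ξ i q.2) (fun j => η j q.2) (β₀ + 0) -
      inner ℝ (lossGrad p β₀ pn ν (Td q.1) (Tn q.1) (fun i => ξ i q.2) (fun j => η j q.2)) (h q) -
      quadForm (scoreCov μ p β₀ (misclass (p β₀) pn ν)) (h q) / 2) =o[whp P]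
      fun q => ‖h q‖ ^ 2 := by
  obtain ⟨r, G, hs⟩ := hreg.exists_isSmoothOn
  have h1 := (hs.quadExpansion_data hreg hn hν).empMean_isLittleO hs.pos he.data_law
    he.pairwise_data he.data_size hh
  have h2 := (hs.quadExpansion_noise hreg hn hν).empMean_isLittleO hs.pos he.noise_law
    he.pairwise_noise (he.noise_size hν) hh
  refine (h1.add (h2.const_mul_left ν)).congr_left fun q => ?_
  have e : scoreCov μ p β₀ (misclass (p β₀) pn ν) = Matrix.of fun i j =>
      scoreCov μ p β₀ (misclass (p β₀) pn ν) i j := rfl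
  rw [e]
  simp only [← IsSmoothOn.integral_hess_add hreg hn hν, logisticLoss_eq]
  have e2 : ∀ (A B : Matrix ι ι ℝ) (c : ℝ) (v : EuclideanSpace ℝ ι),
      quadForm (Matrix.of fun i j => A i j + c * B i j) v = quadForm A v + c * quadForm B v := by
    intro A B c v
    simp only [quadForm_eq_sum, of_apply, Finset.mul_sum, ← Finset.sum_add_distrib]
    refine Finset.sum_congr rfl fun i _ => Finset.sum_congr rfl fun j _ => by ring
  have e3 := e2
    (Matrix.of fun i j => ∫ x, (misclass (p β₀) pn ν x * noiseWeight (p β₀) pn ν x *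
      (score p β₀ x i * score p β₀ x j) + -misclass (p β₀) pn ν x * hessLog p β₀ x i j)
        ∂(μ.withDensity fun x => ENNReal.ofReal (p β₀ x)))
    (Matrix.of fun i j => ∫ x, (misclass (p β₀) pn ν x * noiseWeight (p β₀) pn ν x *
      (score p β₀ x i * score p β₀ x j) + noiseWeight (p β₀) pn ν x * hessLog p β₀ x i j)
        ∂(μ.withDensity fun x => ENNReal.ofReal (pn x))) ν (h q)
  simp only [of_apply] at e3 ⊢
  rw [e3]
  have e4 : lossGrad p β₀ pn ν (Td q.1) (Tn q.1) (fun i => ξ i q.2) (fun j => η j q.2) =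
      empMean (Td q.1) (fun i => ξ i q.2) (fun x => -(misclass (p β₀) pn ν x • score p β₀ x)) +
      ν • empMean (Tn q.1) (fun j => η j q.2) (fun x => noiseWeight (p β₀) pn ν x • score p β₀ x)
      := by
    simp only [lossGrad, empMean, mul_smul, Finset.sum_neg_distrib, smul_neg, ← Finset.smul_sum]
    rw [smul_comm ν, sub_eq_neg_add]
  rw [e4, inner_add_left, real_inner_smul_left]
  ring

/-- The vertex of the quadratic approximation to the logistic loss. -/
theorem sub_isLittleO [IsProbabilityMeasure P] (hreg : RegularModel μ p Θ β₀)
    (hn : IsNoise μ p β₀ pn) (hν : 0 < ν)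
    (he : IsNCEEstimator P μ p Θ β₀ pn ν ξ η Td Tn est) {g : ℕ × Ω → EuclideanSpace ℝ ι}
    (hg : ∀ q, g q = WithLp.toLp 2 (-((scoreCov μ p β₀ (misclass (p β₀) pn ν))⁻¹ *ᵥ
      fun i => lossGrad p β₀ pn ν (Td q.1) (Tn q.1) (fun i => ξ i q.2) (fun j => η j q.2) i)) ) :
    Tendsto g (whp P) (𝓝 0) ∧ (fun q : ℕ × Ω => est q.1 q.2 - β₀ - g q) =o[whp P] g := by
  set A := scoreCov μ p β₀ (misclass (p β₀) pn ν) with hA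
  have hApos : A.PosDef := hreg.scoreCov_misclass_posDef hn hν
  have hdet : IsUnit A.det := (Matrix.isUnit_iff_isUnit_det _).1 hApos.isUnit
  have hg0 : Tendsto g (whp P) (𝓝 0) := by
    have hc : Continuous fun u : EuclideanSpace ℝ ι =>
        (WithLp.toLp 2 (-(A⁻¹ *ᵥ fun i => u i)) : EuclideanSpace ℝ ι) := by fun_prop
    have := (hc.tendsto 0).comp (he.tendsto_lossGrad hreg hn hν)
    have h0 : (WithLp.toLp 2 (-(A⁻¹ *ᵥ fun i => (0 : EuclideanSpace ℝ ι) i)) :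
        EuclideanSpace ℝ ι) = 0 := by
      ext i; simp [mulVec, dotProduct]
    rw [h0] at this
    exact this.congr fun q => (hg q).symm
  have hh0 : Tendsto (fun q : ℕ × Ω => est q.1 q.2 - β₀) (whp P) (𝓝 0) := by
    simpa using (tendstoInMeasure_iff_whp.1 he.consistent).sub_const β₀
  refine ⟨hg0, ?_⟩
  obtain ⟨r, G, hs⟩ := hreg.exists_isSmoothOn
  have hm : ∀ᶠ q in whp P, IsMinOn (logisticLoss p pn ν (Td q.1) (Tn q.1)
      (fun i => ξ i q.2) (fun j => η j q.2)) Θ (est q.1 q.2) := eventually_whp.2 he.minimizer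
  have hU : ∀ q i, lossGrad p β₀ pn ν (Td q.1) (Tn q.1) (fun i => ξ i q.2) (fun j => η j q.2) i =
      -(A *ᵥ fun j => g q j) i := fun q i => by
    rw [hg q]
    change _ = -(A *ᵥ -(A⁻¹ *ᵥ fun i => lossGrad p β₀ pn ν (Td q.1) (Tn q.1) (fun i => ξ i q.2)
      (fun j => η j q.2) i)) i
    rw [mulVec_neg, mulVec_mulVec, Matrix.mul_nonsing_inv A hdet, one_mulVec, Pi.neg_apply, neg_neg]
  set L : ℕ × Ω → EuclideanSpace ℝ ι → ℝ := fun q v => logisticLoss p pn ν (Td q.1) (Tn q.1)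
    (fun i => ξ i q.2) (fun j => η j q.2) (β₀ + v) with hL
  have hmin : ∀ᶠ q in whp P, L q (est q.1 q.2 - β₀) ≤ L q (g q) := by
    -- As `β₀` is interior and `g → 0`, the vertex lies in `Θ` with probability tending to one,
    -- hence may compete with the minimizer.
    filter_upwards [hm, hg0.eventually (Metric.ball_mem_nhds 0 hs.pos)] with q hq hgq
    have := hq (hs.mem_of_norm_lt (by simpa using hgq))
    simp only [hL, add_sub_cancel]
    exact this
  exact isLittleO_sub_of_le hApos hmin hU
    (he.loss_expansion hreg hn hν hh0) (he.loss_expansion hreg hn hν hg0)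

end IsNCEEstimator

end Estimator

/-! ### Limits of truncated means -/

section Truncation

variable {Ω : Type*} [MeasurableSpace Ω] {P : Measure Ω}

theorem min_le_min_add {a b : ℝ≥0∞} {ε M : ℝ≥0} (h : a ≤ b + ε * b) :
    min a M ≤ min b M + ε * M := by
  rcases le_total b M with hb | hb
  · rw [min_eq_left hb]
    refine (min_le_left _ _).trans (h.trans ?_)
    gcongr
  · rw [min_eq_right hb]
    exact (min_le_right _ _).trans le_self_add

theorem lintegral_min_le [IsProbabilityMeasure P] {f g : Ω → ℝ≥0∞} (ε M : ℝ≥0) :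
    ∫⁻ ω, min (f ω) M ∂P ≤ ∫⁻ ω, min (g ω) M ∂P + ε * M +
      M * P {ω | ¬ f ω ≤ g ω + ε * g ω} := by
  set s := {ω | ¬ f ω ≤ g ω + ε * g ω}
  calc ∫⁻ ω, min (f ω) M ∂P
      -- The exceptional event need not be measurable, so its measurable hull is used.
      ≤ ∫⁻ ω, (min (g ω) M + ε * M) + (toMeasurable P s).indicator (fun _ => (M : ℝ≥0∞)) ω ∂P := by
        refine lintegral_mono fun ω => ?_
        by_cases hω : f ω ≤ g ω + ε * g ω
        · exact (min_le_min_add hω).trans le_self_add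
        · rw [Set.indicator_of_mem (subset_toMeasurable P s hω)]
          exact (min_le_right _ _).trans le_add_self
    _ = _ := by
        rw [lintegral_add_right _ (measurable_const.indicator (measurableSet_toMeasurable P s)),
          lintegral_add_right _ measurable_const, lintegral_const, measure_univ, mul_one,
          lintegral_indicator_const (measurableSet_toMeasurable P s), measure_toMeasurable]

/-- Truncated means of asymptotically equivalent random variables have the same limit. -/
theorem tendsto_lintegral_min_congr [IsProbabilityMeasure P] {Y Z : ℕ → Ω → ℝ≥0∞}
    (hYZ : ∀ ε : ℝ≥0, 0 < ε → ∀ᶠ q in whp P, Y q.1 q.2 ≤ Z q.1 q.2 + ε * Z q.1 q.2)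
    (hZY : ∀ ε : ℝ≥0, 0 < ε → ∀ᶠ q in whp P, Z q.1 q.2 ≤ Y q.1 q.2 + ε * Y q.1 q.2)
    {M : ℝ≥0} {L : ℝ≥0∞}
    (hZ : Tendsto (fun k => ∫⁻ ω, min (Z k ω) M ∂P) atTop (𝓝 L)) :
    Tendsto (fun k => ∫⁻ ω, min (Y k ω) M ∂P) atTop (𝓝 L) := by
  have key : ∀ {F G : ℕ → Ω → ℝ≥0∞},
      (∀ ε : ℝ≥0, 0 < ε → ∀ᶠ q in whp P, F q.1 q.2 ≤ G q.1 q.2 + ε * G q.1 q.2) →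
      ∀ δ : ℝ≥0∞, 0 < δ → ∀ᶠ k in atTop,
        ∫⁻ ω, min (F k ω) M ∂P ≤ ∫⁻ ω, min (G k ω) M ∂P + δ := by
    intro F G h δ hδ
    obtain ⟨δ', hδ'0, hδ'⟩ := ENNReal.lt_iff_exists_nnreal_btwn.1 hδ
    have hpos : 0 < δ' := by exact_mod_cast hδ'0
    -- The total loss is `ε M` from the relative error plus at most `M ε` from the exceptional
    -- event, so `2 ε M ≤ δ'` is required; `M + 1` avoids division by zero.
    set ε : ℝ≥0 := δ' / (2 * (M + 1)) with hε
    have hε0 : 0 < ε := by positivity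
    have h1 : ε * M ≤ δ' / 2 := by
      rw [hε, div_mul_eq_mul_div, div_le_div_iff₀ (by positivity) two_pos]
      have : M ≤ M + 1 := le_self_add
      calc δ' * M * 2 ≤ δ' * (M + 1) * 2 := by gcongr
        _ = δ' * (2 * (M + 1)) := by ring
    have ht := eventually_whp.1 (h ε hε0)
    rw [ENNReal.tendsto_nhds_zero] at ht
    filter_upwards [ht ε (by exact_mod_cast hε0)] with k hk
    refine (lintegral_min_le (g := G k) ε M).trans ?_
    rw [add_assoc]
    refine add_le_add le_rfl (le_trans ?_ hδ'.le)
    calc (ε : ℝ≥0∞) * M + M * P {ω | ¬ F k ω ≤ G k ω + ε * G k ω}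
        ≤ ε * M + M * ε := by gcongr
      _ = ((ε * M + ε * M : ℝ≥0) : ℝ≥0∞) := by push_cast; ring
      _ ≤ δ' := by
        rw [ENNReal.coe_le_coe]
        calc ε * M + ε * M ≤ δ' / 2 + δ' / 2 := add_le_add h1 h1
          _ = δ' := add_halves _
  have hL : L ≠ ∞ := ne_top_of_le_ne_top (ENNReal.coe_ne_top (r := M))
    (le_of_tendsto' hZ fun k => (lintegral_mono fun ω => min_le_right _ _).trans (by simp))
  rw [ENNReal.tendsto_nhds hL] at hZ ⊢
  intro ε hε
  have hε2 : 0 < ε / 2 := ENNReal.half_pos hε.ne'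
  filter_upwards [hZ (ε / 2) hε2, key hYZ (ε / 2) hε2, key hZY (ε / 2) hε2] with k h1 h2 h3
  constructor
  · rw [← ENNReal.add_halves ε, ← tsub_tsub]
    exact (tsub_le_tsub_right h1.1 _).trans (tsub_le_iff_right.2 h3)
  · rw [← ENNReal.add_halves ε, ← add_assoc]
    exact h2.trans (add_le_add h1.2 le_rfl)

/-- Convergence of means from convergence of truncated means. -/
theorem tendsto_lintegral_of_tendsto_lintegral_min {Y : ℕ → Ω → ℝ≥0∞}
    (hY : ∀ k, AEMeasurable (Y k) P) {l : ℝ≥0 → ℝ≥0∞} {L : ℝ≥0∞} (hL : L ≠ ∞)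
    (hl : ∀ M : ℝ≥0, Tendsto (fun k => ∫⁻ ω, min (Y k ω) M ∂P) atTop (𝓝 (l M)))
    (hle : ∀ M, l M ≤ L) (hlim : Tendsto l atTop (𝓝 L)) (hui : AsympUnifIntegrable P Y) :
    Tendsto (fun k => ∫⁻ ω, Y k ω ∂P) atTop (𝓝 L) := by
  have hltop : ∀ M, l M ≠ ∞ := fun M => ne_top_of_le_ne_top hL (hle M)
  rw [ENNReal.tendsto_nhds hL]
  intro ε hε
  have hε2 : 0 < ε / 2 := ENNReal.half_pos hε.ne'
  obtain ⟨C, hC⟩ := hui (ε / 2) hε2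
  obtain ⟨M, hM⟩ := (((ENNReal.tendsto_nhds hL).1 hlim) (ε / 2) hε2).exists
  filter_upwards [hC, ((ENNReal.tendsto_nhds (hltop C)).1 (hl C)) (ε / 2) hε2,
    ((ENNReal.tendsto_nhds (hltop M)).1 (hl M)) (ε / 2) hε2] with k h1 h2 h3
  constructor
  · rw [← ENNReal.add_halves ε, ← tsub_tsub]
    exact (tsub_le_tsub_right hM.1 _).trans (h3.1.trans (lintegral_mono fun ω => min_le_left _ _))
  -- The upper bound splits `Y` at the level `C` of uniform integrability; the lower bound needed
  -- only truncation at a high level `M`.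
  · have e : ∀ ω, Y k ω = min (Y k ω) C + (Y k ω - C) := fun ω => by
      rcases le_total (Y k ω) C with h | h
      · rw [min_eq_left h, tsub_eq_zero_of_le h, add_zero]
      · rw [min_eq_right h, add_tsub_cancel_of_le h]
    rw [lintegral_congr e, lintegral_add_left' ((hY k).min aemeasurable_const),
      ← ENNReal.add_halves ε, ← add_assoc]
    exact add_le_add (h2.2.trans (add_le_add (hle C) le_rfl)) h1

/-- Truncated means increase to the mean. -/
theorem tendsto_lintegral_min_atTop {f : Ω → ℝ≥0∞} (hf : AEMeasurable f P) :
    Tendsto (fun M : ℝ≥0 => ∫⁻ ω, min (f ω) M ∂P) atTop (𝓝 (∫⁻ ω, f ω ∂P)) := by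
  have hmono : Monotone fun M : ℝ≥0 => ∫⁻ ω, min (f ω) M ∂P := fun M N h =>
    lintegral_mono fun ω => min_le_min_left _ (ENNReal.coe_le_coe.2 h)
  have h1 := tendsto_atTop_iSup hmono
  have h2 : Tendsto (fun n : ℕ => ∫⁻ ω, min (f ω) ((n : ℝ≥0) : ℝ≥0∞) ∂P) atTop
      (𝓝 (∫⁻ ω, f ω ∂P)) := by
    refine lintegral_tendsto_of_tendsto_of_monotone (fun n => hf.min aemeasurable_const)
      (Eventually.of_forall fun ω m n h => min_le_min_left _ (by exact_mod_cast h))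
      (Eventually.of_forall fun ω => ?_)
    have := (tendsto_const_nhds (x := f ω)).min ENNReal.tendsto_nat_nhds_top
    simpa using this
  rwa [tendsto_nhds_unique (h1.comp tendsto_natCast_atTop_atTop) h2] at h1

end Truncation

/-! ### Gaussian limits of quadratic forms -/

section Gaussian

variable {ι : Type*} [Fintype ι] [DecidableEq ι]

theorem integral_quadForm_multivariateGaussian {V : Matrix ι ι ℝ} (hV : V.PosSemidef)
    (B : Matrix ι ι ℝ) :
    Integrable (quadForm B) (multivariateGaussian 0 V) ∧
      ∫ z, quadForm B z ∂(multivariateGaussian 0 V) = (B * V).trace := by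
  have hid := IsGaussian.memLp_two_id (μ := multivariateGaussian (0 : EuclideanSpace ℝ ι) V)
  have hev : ∀ i, MemLp (fun z : EuclideanSpace ℝ ι => z i) 2 (multivariateGaussian 0 V) :=
    fun i => (EuclideanSpace.proj i : EuclideanSpace ℝ ι →L[ℝ] ℝ).comp_memLp' hid
  have hint : ∀ i j, Integrable (fun z : EuclideanSpace ℝ ι => B i j * (z i * z j))
      (multivariateGaussian 0 V) := fun i j => ((hev i).integrable_mul (hev j)).const_mul _
  have hmean : ∀ i, ∫ z : EuclideanSpace ℝ ι, z i ∂(multivariateGaussian 0 V) = 0 := fun i => by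
    have h := (EuclideanSpace.proj i : EuclideanSpace ℝ ι →L[ℝ] ℝ).integral_comp_comm
      (hid.integrable one_le_two)
    simpa using h
  have hcov : ∀ i j, ∫ z : EuclideanSpace ℝ ι, z i * z j ∂(multivariateGaussian 0 V) = V i j :=
    fun i j => by
    have h := covariance_eval_multivariateGaussian (μ := (0 : EuclideanSpace ℝ ι)) hV i j
    rw [covariance_eq_sub (hev i) (hev j), hmean, zero_mul, sub_zero] at h
    exact h
  have e : quadForm B = fun z => ∑ i, ∑ j, B i j * (z i * z j) := funext (quadForm_eq_sum B)
  rw [e]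
  refine ⟨integrable_finsetSum _ fun i _ => integrable_finsetSum _ fun j _ => hint i j, ?_⟩
  rw [integral_finsetSum _ fun i _ => integrable_finsetSum _ fun j _ => hint i j]
  simp only [Matrix.trace, Matrix.diag, Matrix.mul_apply]
  refine Finset.sum_congr rfl fun i _ => ?_
  rw [integral_finsetSum _ fun j _ => hint i j]
  refine Finset.sum_congr rfl fun j _ => ?_
  rw [integral_const_mul, hcov]
  have := hV.isHermitian.apply i j
  simp only [star_trivial] at this
  rw [this]

/-- Truncated means of a continuous function of random vectors that converge in distribution. -/
theorem tendsto_lintegral_min_of_tendstoInDistribution {Ω E : Type*} [MeasurableSpace Ω]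
    [TopologicalSpace E] [MeasurableSpace E] [BorelSpace E] {P : Measure Ω}
    [IsProbabilityMeasure P] {N : Measure E} [IsProbabilityMeasure N] {S : ℕ → Ω → E}
    (hS : TendstoInDistribution S atTop id (fun _ => P) N) {f : E → ℝ} (hf : Continuous f)
    (M : ℝ≥0) :
    Tendsto (fun k => ∫⁻ ω, min (ENNReal.ofReal (f (S k ω))) M ∂P) atTop
      (𝓝 (∫⁻ z, min (ENNReal.ofReal (f z)) M ∂N)) := by
  have hc : Continuous fun z => min (f z).toNNReal M :=
    (continuous_real_toNNReal.comp hf).min continuous_const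
  let φ : BoundedContinuousFunction E ℝ≥0 :=
    { toFun := fun z => min (f z).toNNReal M
      continuous_toFun := hc
      map_bounded' := ⟨M, fun x y => by
        rw [NNReal.dist_eq, abs_le]
        have h1 : ((min (f x).toNNReal M : ℝ≥0) : ℝ) ≤ M := by exact_mod_cast min_le_right _ _
        have h2 : ((min (f y).toNNReal M : ℝ≥0) : ℝ) ≤ M := by exact_mod_cast min_le_right _ _
        have h3 := (min (f x).toNNReal M).coe_nonneg
        have h4 := (min (f y).toNNReal M).coe_nonneg
        constructor <;> linarith⟩ }
  have h := ProbabilityMeasure.tendsto_iff_forall_lintegral_tendsto.1 hS.tendsto φ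
  simp only [ProbabilityMeasure.coe_mk, Measure.map_id] at h
  have e : ∀ z, (φ z : ℝ≥0∞) = min (ENNReal.ofReal (f z)) M := fun z => by
    change ((min (f z).toNNReal M : ℝ≥0) : ℝ≥0∞) = _
    rw [ENNReal.coe_min]
    rfl
  simp only [e] at h
  refine h.congr fun k => ?_
  have hm : Measurable fun z => min (ENNReal.ofReal (f z)) (M : ℝ≥0∞) :=
    hf.measurable.ennreal_ofReal.min measurable_const
  exact lintegral_map' hm.aemeasurable (hS.forall_aemeasurable k)

end Gaussian

/-! ### Asymptotics of the Kullback-Leibler error -/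

section Estimator

variable {X : Type*} [MeasurableSpace X] {μ : Measure X}
  {ι : Type*} [Fintype ι] [DecidableEq ι]
  {p : EuclideanSpace ℝ ι → X → ℝ} {Θ : Set (EuclideanSpace ℝ ι)} {β₀ : EuclideanSpace ℝ ι}
  {pn : X → ℝ} {ν : ℝ}

/-- The matrix of the quadratic form that gives the Kullback-Leibler error as a function of the
gradient of the logistic loss. -/
def errorMatrix (μ : Measure X) (p : EuclideanSpace ℝ ι → X → ℝ) (β₀ : EuclideanSpace ℝ ι)
    (pn : X → ℝ) (ν : ℝ) : Matrix ι ι ℝ :=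
  (scoreCov μ p β₀ (misclass (p β₀) pn ν))⁻¹ * fisher μ p β₀ *
    (scoreCov μ p β₀ (misclass (p β₀) pn ν))⁻¹

namespace RegularModel

theorem quadForm_errorMatrix (hreg : RegularModel μ p Θ β₀) (hn : IsNoise μ p β₀ pn) (hν : 0 < ν)
    (u : EuclideanSpace ℝ ι) :
    quadForm (errorMatrix μ p β₀ pn ν) u = quadForm (fisher μ p β₀)
      (WithLp.toLp 2 (-((scoreCov μ p β₀ (misclass (p β₀) pn ν))⁻¹ *ᵥ fun i => u i))) := by
  have hH : ((scoreCov μ p β₀ (misclass (p β₀) pn ν))⁻¹)ᵀ =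
      (scoreCov μ p β₀ (misclass (p β₀) pn ν))⁻¹ := by
    have := (hreg.scoreCov_misclass_posDef hn hν).inv.isHermitian.eq
    rwa [conjTranspose_eq_transpose_of_trivial] at this
  set A := (scoreCov μ p β₀ (misclass (p β₀) pn ν))⁻¹
  change (fun i => u i) ⬝ᵥ ((A * fisher μ p β₀ * A) *ᵥ fun i => u i) =
    (-(A *ᵥ fun i => u i)) ⬝ᵥ (fisher μ p β₀ *ᵥ (-(A *ᵥ fun i => u i)))
  rw [mulVec_neg, neg_dotProduct_neg, ← mulVec_mulVec, ← mulVec_mulVec, dotProduct_mulVec,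
    ← mulVec_transpose, hH]

theorem quadForm_errorMatrix_nonneg (hreg : RegularModel μ p Θ β₀) (hn : IsNoise μ p β₀ pn)
    (hν : 0 < ν) (u : EuclideanSpace ℝ ι) : 0 ≤ quadForm (errorMatrix μ p β₀ pn ν) u := by
  rw [hreg.quadForm_errorMatrix hn hν]
  exact quadForm_nonneg hreg.fisher_posSemidef _

/-- `Σ` is the sandwich `I_w⁻¹ V I_w⁻¹` with `V` the gradient covariance; the rest is cyclicity of
the trace. -/
theorem trace_errorMatrix_mul_gradCov (hreg : RegularModel μ p Θ β₀) (hn : IsNoise μ p β₀ pn)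
    (hν : 0 < ν) :
    (errorMatrix μ p β₀ pn ν * gradCov μ p β₀ pn ν).trace =
      (asympCov μ p β₀ pn ν * fisher μ p β₀).trace := by
  have hdet : IsUnit (scoreCov μ p β₀ (misclass (p β₀) pn ν)).det :=
    (Matrix.isUnit_iff_isUnit_det _).1 (hreg.scoreCov_misclass_posDef hn hν).isUnit
  simp only [errorMatrix, gradCov, asympCov]
  set A := scoreCov μ p β₀ (misclass (p β₀) pn ν)
  set m := scoreMean μ p β₀ (misclass (p β₀) pn ν)
  have e : A⁻¹ * (A - (1 + 1 / ν) • vecMulVec m m) * A⁻¹ =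
      A⁻¹ - (1 + 1 / ν) • (A⁻¹ * vecMulVec m m * A⁻¹) := by
    rw [mul_sub, sub_mul, Matrix.nonsing_inv_mul A hdet, one_mul, Matrix.mul_smul, Matrix.smul_mul]
  rw [← e, mul_assoc A⁻¹, mul_assoc A⁻¹, Matrix.trace_mul_comm, mul_assoc, mul_assoc,
    Matrix.trace_mul_comm]
  simp only [mul_assoc]

theorem measurable_genKL [SigmaFinite μ] (hreg : RegularModel μ p Θ β₀) :
    Measurable fun β => genKL μ (p β₀) (p β) := by
  have h0 : Measurable fun q : EuclideanSpace ℝ ι × X => p β₀ q.2 :=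
    (hreg.measurable_apply β₀).comp measurable_snd
  have h1 : Measurable fun q : EuclideanSpace ℝ ι × X => p q.1 q.2 := hreg.measurable
  exact Measurable.lintegral_prod_right'
    (f := fun q => ENNReal.ofReal (p β₀ q.2 * Real.log (p β₀ q.2 / p q.1 q.2) - p β₀ q.2 +
      p q.1 q.2)) (((h0.mul (h0.div h1).log).sub h0).add h1).ennreal_ofReal

end RegularModel

variable {Ω : Type*} [MeasurableSpace Ω] {P : Measure Ω}
  {ξ η : ℕ → Ω → X} {Td Tn : ℕ → ℕ} {est : ℕ → Ω → EuclideanSpace ℝ ι}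

namespace IsNCEEstimator

/-- The divergence is half the Fisher form at `β̂ - β₀`, which may be replaced by the vertex `g`;
the total budget `T` is equivalent to `(ν + 1) T_d`, and `√T_d` is moved inside the quadratic form.
-/
theorem genKL_isEquivalent [IsProbabilityMeasure P] (hreg : RegularModel μ p Θ β₀)
    (hn : IsNoise μ p β₀ pn) (hν : 0 < ν)
    (he : IsNCEEstimator P μ p Θ β₀ pn ν ξ η Td Tn est) :
    (∀ᶠ q in whp P, genKL μ (p β₀) (p (est q.1 q.2)) ≠ ∞) ∧
    Asymptotics.IsEquivalent (whp P) (fun q : ℕ × Ω => ((Td q.1 + Tn q.1 : ℕ) : ℝ) *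
      (genKL μ (p β₀) (p (est q.1 q.2))).toReal) (fun q => (ν + 1) / 2 *
        quadForm (errorMatrix μ p β₀ pn ν) (√(Td q.1 : ℝ) •
          lossGrad p β₀ pn ν (Td q.1) (Tn q.1) (fun i => ξ i q.2) (fun j => η j q.2))) := by
  set g : ℕ × Ω → EuclideanSpace ℝ ι := fun q =>
    WithLp.toLp 2 (-((scoreCov μ p β₀ (misclass (p β₀) pn ν))⁻¹ *ᵥ
      fun i => lossGrad p β₀ pn ν (Td q.1) (Tn q.1) (fun i => ξ i q.2) (fun j => η j q.2) i))
    with hg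
  obtain ⟨hg0, hgo⟩ := he.sub_isLittleO hreg hn hν (g := g) fun q => rfl
  have hh0 : Tendsto (fun q : ℕ × Ω => est q.1 q.2 - β₀) (whp P) (𝓝 0) := by
    simpa using (tendstoInMeasure_iff_whp.1 he.consistent).sub_const β₀
  obtain ⟨hfin, hexp⟩ := hreg.genKL_expansion
  have hfin' := hh0.eventually hfin
  have hexp' := hexp.comp_tendsto hh0
  simp only [add_sub_cancel, Function.comp_def] at hfin' hexp'
  refine ⟨hfin', ?_⟩
  have hhg : (fun q : ℕ × Ω => est q.1 q.2 - β₀) =O[whp P] g := by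
    simpa using hgo.isBigO.add (Asymptotics.isBigO_refl g _)
  have hsq : (fun q : ℕ × Ω => ‖est q.1 q.2 - β₀‖ ^ 2) =O[whp P] fun q => ‖g q‖ ^ 2 :=
    hhg.norm_norm.pow 2
  have hquad : (fun q : ℕ × Ω => quadForm (fisher μ p β₀) (est q.1 q.2 - β₀) -
      quadForm (fisher μ p β₀) (g q)) =o[whp P] fun q => ‖g q‖ ^ 2 := by
    have h1 : (fun q : ℕ × Ω => ‖est q.1 q.2 - β₀ - g q‖ * (‖est q.1 q.2 - β₀‖ + ‖g q‖))
        =o[whp P] fun q => ‖g q‖ * ‖g q‖ :=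
      hgo.norm_norm.mul_isBigO (hhg.norm_norm.add (Asymptotics.isBigO_refl _ _))
    refine (Asymptotics.IsBigO.of_bound (∑ i, ∑ j, |fisher μ p β₀ i j|)
      (Eventually.of_forall fun q => ?_)).trans_isLittleO (h1.congr_right fun q => (pow_two _).symm)
    refine (abs_quadForm_sub_quadForm_le _ _ _).trans (le_of_eq ?_)
    rw [Real.norm_of_nonneg (by positivity)]
  -- Definiteness of the Fisher information turns errors `o(‖g‖²)` into relative errors.
  have hgO : (fun q => ‖g q‖ ^ 2) =O[whp P] fun q => quadForm (fisher μ p β₀) (g q) / 2 := by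
    obtain ⟨c, hc, hcA⟩ := exists_pos_le_quadForm hreg.fisher_posDef
    refine Asymptotics.IsBigO.of_bound (2 / c) (Eventually.of_forall fun q => ?_)
    have := hcA (g q)
    rw [Real.norm_of_nonneg (sq_nonneg _), Real.norm_of_nonneg
      (div_nonneg (quadForm_nonneg hreg.fisher_posSemidef _) two_pos.le), div_mul_div_comm,
      le_div_iff₀ (by positivity)]
    linarith
  have hkl : Asymptotics.IsEquivalent (whp P)
      (fun q : ℕ × Ω => (genKL μ (p β₀) (p (est q.1 q.2))).toReal)
      (fun q => quadForm (fisher μ p β₀) (g q) / 2) := by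
    refine (Asymptotics.IsLittleO.trans_isBigO ?_ hgO)
    refine ((hexp'.trans_isBigO hsq).add (hquad.const_mul_left (1 / 2))).congr_left fun q => ?_
    simp only [Pi.sub_apply]
    ring
  have hT : Asymptotics.IsEquivalent (whp P) (fun q : ℕ × Ω => ((Td q.1 + Tn q.1 : ℕ) : ℝ))
      (fun q => (ν + 1) * (Td q.1 : ℝ)) := by
    have h : Asymptotics.IsEquivalent atTop (fun k => ((Td k + Tn k : ℕ) : ℝ))
        (fun k => (ν + 1) * (Td k : ℝ)) := by
      refine Asymptotics.isEquivalent_of_tendsto_one ?_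
      have := (he.ratio.add_const 1).div_const (ν + 1)
      rw [div_self (by positivity)] at this
      refine this.congr' ?_
      filter_upwards [he.data_size.eventually_gt_atTop 0] with k hk
      have : (0 : ℝ) < Td k := by exact_mod_cast hk
      simp only [Pi.div_apply]
      push_cast
      field_simp
      ring
    exact h.comp_tendsto tendsto_fst_whp
  refine (hT.mul hkl).congr_right (Eventually.of_forall fun q => ?_)
  simp only [Pi.mul_apply]
  rw [quadForm_smul, hreg.quadForm_errorMatrix hn hν, Real.sq_sqrt (Nat.cast_nonneg _)]
  ring

/-- Truncated means of the scaled Kullback-Leibler error converge. -/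
theorem tendsto_lintegral_min_genKL [IsProbabilityMeasure P] (hreg : RegularModel μ p Θ β₀)
    (hn : IsNoise μ p β₀ pn) (hν : 0 < ν)
    (he : IsNCEEstimator P μ p Θ β₀ pn ν ξ η Td Tn est) (M : ℝ≥0) :
    Tendsto (fun k => ∫⁻ ω, min
      (((Td k + Tn k : ℕ) : ℝ≥0∞) * genKL μ (p β₀) (p (est k ω))) M ∂P) atTop
      (𝓝 (∫⁻ z, min (ENNReal.ofReal ((ν + 1) / 2 * quadForm (errorMatrix μ p β₀ pn ν) z)) M
        ∂(multivariateGaussian 0 (gradCov μ p β₀ pn ν)))) := by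
  obtain ⟨hfin, hequiv⟩ := he.genKL_isEquivalent hreg hn hν
  have hX0 : ∀ q : ℕ × Ω, 0 ≤ (ν + 1) / 2 * quadForm (errorMatrix μ p β₀ pn ν) (√(Td q.1 : ℝ) •
      lossGrad p β₀ pn ν (Td q.1) (Tn q.1) (fun i => ξ i q.2) (fun j => η j q.2)) := fun q =>
    mul_nonneg (by positivity) (hreg.quadForm_errorMatrix_nonneg hn hν _)
  have hY : ∀ q : ℕ × Ω, genKL μ (p β₀) (p (est q.1 q.2)) ≠ ∞ →
      ((Td q.1 + Tn q.1 : ℕ) : ℝ≥0∞) * genKL μ (p β₀) (p (est q.1 q.2)) =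
      ENNReal.ofReal (((Td q.1 + Tn q.1 : ℕ) : ℝ) *
        (genKL μ (p β₀) (p (est q.1 q.2))).toReal) := fun q hq => by
    rw [ENNReal.ofReal_mul (Nat.cast_nonneg _), ENNReal.ofReal_natCast, ENNReal.ofReal_toReal hq]
  have hof : ∀ {a b : ℝ} {ε : ℝ≥0}, 0 ≤ b → a ≤ b + ε * b →
      ENNReal.ofReal a ≤ ENNReal.ofReal b + ε * ENNReal.ofReal b := fun {a b ε} hb h => by
    rw [← ENNReal.ofReal_coe_nnreal, ← ENNReal.ofReal_mul ε.coe_nonneg,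
      ← ENNReal.ofReal_add hb (mul_nonneg ε.coe_nonneg hb)]
    exact ENNReal.ofReal_le_ofReal h
  refine tendsto_lintegral_min_congr ?_ ?_ (tendsto_lintegral_min_of_tendstoInDistribution
    (he.tendstoInDistribution_lossGrad hreg hn hν)
    ((continuous_quadForm (errorMatrix μ p β₀ pn ν)).const_mul ((ν + 1) / 2)) M)
  · intro ε hε
    filter_upwards [hfin, hequiv.isLittleO.def (c := (ε : ℝ)) (by exact_mod_cast hε)] with q h1 h2
    rw [hY q h1]
    refine hof (hX0 q) ?_
    rw [Pi.sub_apply, Real.norm_of_nonneg (hX0 q), Real.norm_eq_abs] at h2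
    linarith [(abs_le.1 h2).2]
  · intro ε hε
    have hε' : (0 : ℝ) < ε := by exact_mod_cast hε
    -- The tolerance `ε / (1 + ε)` is the one for which `|y - x| ≤ ε / (1 + ε) * x` yields `x ≤ (1 +
    -- ε) y`.
    filter_upwards [hfin, hequiv.isLittleO.def (c := (ε : ℝ) / (1 + ε)) (by positivity)]
      with q h1 h2
    rw [hY q h1]
    refine hof (by positivity) ?_
    rw [Pi.sub_apply, Real.norm_of_nonneg (hX0 q), Real.norm_eq_abs] at h2
    have h3 := (abs_le.1 h2).1
    set x := (ν + 1) / 2 * quadForm (errorMatrix μ p β₀ pn ν) (√(Td q.1 : ℝ) •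
      lossGrad p β₀ pn ν (Td q.1) (Tn q.1) (fun i => ξ i q.2) (fun j => η j q.2))
    set y := ((Td q.1 + Tn q.1 : ℕ) : ℝ) * (genKL μ (p β₀) (p (est q.1 q.2))).toReal
    have h4 : x / (1 + ε) ≤ y := by
      have : x - ε / (1 + ε) * x = x / (1 + ε) := by field_simp; ring
      linarith
    rw [div_le_iff₀ (by positivity)] at h4
    linarith

end IsNCEEstimator

theorem RegularModel.lintegral_errorMatrix (hreg : RegularModel μ p Θ β₀)
    (hn : IsNoise μ p β₀ pn) (hν : 0 < ν) :
    ∫⁻ z, ENNReal.ofReal ((ν + 1) / 2 * quadForm (errorMatrix μ p β₀ pn ν) z)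
      ∂(multivariateGaussian 0 (gradCov μ p β₀ pn ν)) =
      ENNReal.ofReal ((ν + 1) / 2 * (asympCov μ p β₀ pn ν * fisher μ p β₀).trace) := by
  obtain ⟨h1, h2⟩ := integral_quadForm_multivariateGaussian (hreg.gradCov_posSemidef hn hν)
    (errorMatrix μ p β₀ pn ν)
  rw [← ofReal_integral_eq_lintegral_ofReal (h1.const_mul _) (Eventually.of_forall fun z =>
    mul_nonneg (by positivity) (hreg.quadForm_errorMatrix_nonneg hn hν z)), integral_const_mul, h2,
    hreg.trace_errorMatrix_mul_gradCov hn hν]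

/-- The non-parametric error of the NCE estimator, to leading order. -/
theorem IsNCEEstimator.tendsto_error [SigmaFinite μ] [IsProbabilityMeasure P]
    (hreg : RegularModel μ p Θ β₀) (hn : IsNoise μ p β₀ pn) (hν : 0 < ν)
    (he : IsNCEEstimator P μ p Θ β₀ pn ν ξ η Td Tn est) :
    (∃ l : ℝ≥0 → ℝ≥0∞,
      (∀ M : ℝ≥0, Tendsto (fun k => ∫⁻ ω, min
        (((Td k + Tn k : ℕ) : ℝ≥0∞) * genKL μ (p β₀) (p (est k ω))) M ∂P) atTop (𝓝 (l M))) ∧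
      Tendsto l atTop (𝓝 (ENNReal.ofReal
        ((ν + 1) / 2 * (asympCov μ p β₀ pn ν * fisher μ p β₀).trace)))) ∧
    (AsympUnifIntegrable P
        (fun k ω => ((Td k + Tn k : ℕ) : ℝ≥0∞) * genKL μ (p β₀) (p (est k ω))) →
      Tendsto (fun k => ((Td k + Tn k : ℕ) : ℝ≥0∞) * ∫⁻ ω, genKL μ (p β₀) (p (est k ω)) ∂P)
        atTop (𝓝 (ENNReal.ofReal
          ((ν + 1) / 2 * (asympCov μ p β₀ pn ν * fisher μ p β₀).trace)))) := by
  have hlim := tendsto_lintegral_min_atTop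
    (P := multivariateGaussian 0 (gradCov μ p β₀ pn ν))
    (f := fun z => ENNReal.ofReal ((ν + 1) / 2 * quadForm (errorMatrix μ p β₀ pn ν) z))
    ((continuous_quadForm _).measurable.const_mul _).ennreal_ofReal.aemeasurable
  have hmin := fun M => he.tendsto_lintegral_min_genKL hreg hn hν M
  rw [hreg.lintegral_errorMatrix hn hν] at hlim
  refine ⟨⟨_, hmin, hlim⟩, fun hui => ?_⟩
  have h := tendsto_lintegral_of_tendsto_lintegral_min
    (fun k => (hreg.measurable_genKL.comp_aemeasurable (he.measurable k)).const_mul _)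
    ENNReal.ofReal_ne_top hmin (fun M => ?_) hlim hui
  · exact h.congr fun k => lintegral_const_mul' _ _ (ENNReal.natCast_ne_top _)
  · rw [← hreg.lintegral_errorMatrix hn hν]
    exact lintegral_mono fun z => min_le_left _ _

end Estimator

end NCE

end

theorem theorem3 {X : Type*} [MeasurableSpace X] (μ : Measure X) [SigmaFinite μ]
    {ι : Type*} [Fintype ι] [DecidableEq ι] [Nonempty ι]
    (p : EuclideanSpace ℝ ι → X → ℝ) (Θ : Set (EuclideanSpace ℝ ι)) (β₀ : EuclideanSpace ℝ ι)
    (hreg : NCE.RegularModel μ p Θ β₀)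
    (hmodel : NCE.IsNormalized μ p Θ ∨ NCE.IsUnnormalized p Θ) :
    -- the expected generalized KL error of the NCE estimator is `(ν + 1) / (2 T) tr (Σ I)`,
    -- to leading order in the sample size
    (∀ (pn : X → ℝ), NCE.IsNoise μ p β₀ pn → ∀ ν : ℝ, 0 < ν →
      ∀ (Ω : Type*) [MeasurableSpace Ω] (P : Measure Ω) [IsProbabilityMeasure P]
        (ξ η : ℕ → Ω → X) (Td Tn : ℕ → ℕ) (est : ℕ → Ω → EuclideanSpace ℝ ι),
        NCE.IsNCEEstimator P μ p Θ β₀ pn ν ξ η Td Tn est →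
        (∃ l : ℝ≥0 → ℝ≥0∞,
          (∀ M : ℝ≥0, Tendsto
            (fun k => ∫⁻ ω, min
              (((Td k + Tn k : ℕ) : ℝ≥0∞) * NCE.genKL μ (p β₀) (p (est k ω))) M ∂P)
            atTop (𝓝 (l M))) ∧
          Tendsto l atTop (𝓝 (ENNReal.ofReal
            ((ν + 1) / 2 * (NCE.asympCov μ p β₀ pn ν * NCE.fisher μ p β₀).trace)))) ∧
        (NCE.AsympUnifIntegrable P
            (fun k ω => ((Td k + Tn k : ℕ) : ℝ≥0∞) * NCE.genKL μ (p β₀) (p (est k ω))) →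
          Tendsto
            (fun k => ((Td k + Tn k : ℕ) : ℝ≥0∞) *
              ∫⁻ ω, NCE.genKL μ (p β₀) (p (est k ω)) ∂P)
            atTop (𝓝 (ENNReal.ofReal
              ((ν + 1) / 2 * (NCE.asympCov μ p β₀ pn ν * NCE.fisher μ p β₀).trace))))) ∧
    -- as `ν → ∞` the error depends on the noise through the chi-squared divergence
    (∀ (pn : X → ℝ), NCE.IsNoise μ p β₀ pn → ∀ T : ℝ, 0 < T →
      Tendsto
        (fun ν : ℝ =>
          ((NCE.klError μ p β₀ T ν pn - NCE.noiseFreePart μ p β₀ T ν : ℝ) : EReal))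
        atTop
        (𝓝 ((((∫ x, p β₀ x * NCE.w₃ μ p β₀ x ∂μ) ^ 2 / (2 * T) : ℝ) : EReal) *
          ((NCE.chiSq μ (NCE.optNoise μ p β₀) pn : ℝ≥0∞) : EReal)))) ∧
    0 < ∫ x, p β₀ x * NCE.w₃ μ p β₀ x ∂μ ∧
    -- the reweighted data density is the optimal noise, unique up to null sets
    NCE.IsNoise μ p β₀ (NCE.optNoise μ p β₀) ∧
    (∀ (pn : X → ℝ), NCE.IsNoise μ p β₀ pn →
      (NCE.chiSq μ (NCE.optNoise μ p β₀) pn = 0 ↔ pn =ᵐ[μ] NCE.optNoise μ p β₀)) ∧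
    (∀ (pn : X → ℝ), NCE.IsNoise μ p β₀ pn → ¬ pn =ᵐ[μ] NCE.optNoise μ p β₀ →
      ∀ᶠ ν : ℝ in atTop, ∀ T : ℝ, 0 < T →
        NCE.klError μ p β₀ T ν (NCE.optNoise μ p β₀) < NCE.klError μ p β₀ T ν pn) := by
  refine ⟨fun pn hn ν hν Ω _ P _ ξ η Td Tn est he => he.tendsto_error hreg hn hν,
    fun pn hn T hT => hreg.tendsto_klError_sub hmodel hn hT, hreg.integral_data_mul_w₃_pos,
    hreg.isNoise_optNoise, fun pn hn => ?_,
    fun pn hn hne => hreg.eventually_klError_lt hmodel hn hne⟩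
  have ho := hreg.isNoise_optNoise
  rw [NCE.chiSq_eq_zero_iff ho.measurable hn.measurable ho.nonneg hn.nonneg ho.prob hn.prob]
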